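/- Let $N\ge 2$ and let $\mathcal M$ be an $N$-dimensional manifold of class $C^3$ (Hausdorff, second countable). Let $F:T\mathcal M\to\mathbb R$ be a Finsler metric: $F$ is continuous; it is of class $C^3$ off the zero section when read in the coordinates $(q^i,v^i)$ induced by the charts of the given atlas of $\mathcal M$; $F(q,cv)=cF(q,v)$ for all $c>0$; $F(q,v)>0$ for $v\ne0$; and, with $G=F^2$, the matrix $g_{ij}(q,v)=\frac12\partial^2_{v^iv^j}G(q,v)$ is positive definite for all $v\neq 0$, with inverse $g^{ij}$. Let $\Phi:\mathcal M\to\mathbb R$ be of class $C^2$ and let $\Omega=\{\Phi<0\}$ have boundary $\partial\Omega=\{\Phi=0\}$, with $d\Phi\ne 0$ on $\partial\Omega$, and with $\overline\Omega$ homeomorphic to the closed unit ball of $\mathbb R^N$. For $v\in T_q\mathcal M\setminus\{0\}$ the Finsler Hessian of $\Phi$ is $H_\Phi(q,v)[v,v]=\frac{d^2}{ds^2}(\Phi\circ\gamma)(0)$, where $\gamma$ is the geodesic of $(\mathcal M,F)$ with $\gamma(0)=q$, $\dot\gamma(0)=v$, that is, the solution of $\ddot\gamma^i+\frac12 g^{ij}\big(\partial^2_{q^kv^j}G\,\dot\gamma^k-\partial_{q^j}G\big)=0$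 (at $(\gamma,\dot\gamma)$). Let $\mathfrak M$ be the set of $H^1$ curves $x:[0,1]\to\overline\Omega$ with $x(0),x(1)\in\partial\Omega$. For $x\in\mathfrak M$ let $\mathcal V^-(x)$ be the set of $H^1$ vector fields $\xi$ along $x$ such that $d\Phi(x(0))[\xi(0)]=d\Phi(x(1))[\xi(1)]=0$ and $d\Phi(x(s))[\xi(s)]\le0$ for every $s\in(0,1)$ with $x(s)\in\partial\Omega$. The Finsler energy $\mathcal J(x)=\frac12\int_0^1G(x,\dot x)\,ds$ has the differential $$d\mathcal J(x)[\xi]=\frac12\int_0^1\big(d_qG(x,\dot x)[\xi]+d_vG(x,\dot x)[\dot\xi]\big)\,ds,$$ and $x\in\mathfrak M$ is called $\mathcal V^-$-critical if $d\mathcal J(x)[\xi]\ge0$ for all $\xi\in\mathcal V^-(x)$. Proposition. Every $\mathcal V^-$-critical curve $x\in\mathfrak M$ is of class $H^{2,\infty}$: in local coordinates, $x$ is $C^1$, $\dot x$ is absolutely continuous and $\ddot x\in L^\infty$. Moreover, with $C_x=\{s\in[0,1]:x(s)\in\partial\Omega\}$, there is a function $\lambda\in L^\infty([0,1],\mathbb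 R)$ such that, in local coordinates, $$\frac12\Big(d_qG(x,\dot x)-\frac{d}{ds}d_vG(x,\dot x)\Big)=\lambda\, d\Phi(x)\qquad\text{a.e. in }[0,1],$$ $\lambda\le0$ a.e. in $[0,1]$, $\lambda(s)=0$ whenever $s\notin C_x$, and $$\lambda=\frac{H_\Phi(x,\dot x)[\dot x,\dot x]}{g^{ij}(x,\dot x)\,\partial_{q^i}\Phi(x)\,\partial_{q^j}\Phi(x)}\qquad\text{a.e. in }C_x,$$ where the right-hand side is read as $0$ at points where $\dot x=0$. -/

import Mathlib

open Set MeasureTheory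
open scoped Manifold ContDiff ENNReal

namespace Finsler

noncomputable section

/-- The Sobolev class `W^{1,p}` on `[a,b]`: primitives of functions in `L^p(a,b)`. For `p = 2` this
is `H^1`, that is, absolutely continuous functions whose derivative is square integrable. -/
def SobolevOne {V : Type*} [NormedAddCommGroup V] [NormedSpace ℝ V]
    (p : ℝ≥0∞) (a b : ℝ) (u : ℝ → V) : Prop :=
  ∃ g : ℝ → V, MemLp g p (volume.restrict (Icc a b)) ∧
    ∀ t ∈ Icc a b, u t = u a + ∫ s in a..t, g s

/-- The Sobolev class `W^{2,p}` on `[a,b]`: primitives of (automatically continuous) functions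
in `W^{1,p}`; so `u` is `C^1` and its derivative is a primitive of a function in `L^p(a,b)`. -/
def SobolevTwo {V : Type*} [NormedAddCommGroup V] [NormedSpace ℝ V]
    (p : ℝ≥0∞) (a b : ℝ) (u : ℝ → V) : Prop :=
  ∃ w : ℝ → V, SobolevOne p a b w ∧ ∀ t ∈ Icc a b, u t = u a + ∫ s in a..t, w s

section Coordinates

variable {N : ℕ}

/-- The partial derivative `∂_{q^i} f` of a function `f (q, v)` on `ℝ^N × ℝ^N`. -/
def dq (f : EuclideanSpace ℝ (Fin N) → EuclideanSpace ℝ (Fin N) → ℝ) (i : Fin N)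
    (q v : EuclideanSpace ℝ (Fin N)) : ℝ :=
  fderiv ℝ (fun y => f y v) q (EuclideanSpace.single i 1)

/-- The partial derivative `∂_{v^i} f` of a function `f (q, v)` on `ℝ^N × ℝ^N`. -/
def dv (f : EuclideanSpace ℝ (Fin N) → EuclideanSpace ℝ (Fin N) → ℝ) (i : Fin N)
    (q v : EuclideanSpace ℝ (Fin N)) : ℝ :=
  fderiv ℝ (fun w => f q w) v (EuclideanSpace.single i 1)

/-- The matrix `g_{ij}(q, v) = ½ ∂²_{v^i v^j} G(q, v)`. -/
def gMatrix (G : EuclideanSpace ℝ (Fin N) → EuclideanSpace ℝ (Fin N) → ℝ)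
    (q v : EuclideanSpace ℝ (Fin N)) : Matrix (Fin N) (Fin N) ℝ :=
  Matrix.of fun i j => (1 / 2) * dv (dv G j) i q v

end Coordinates

section Manifold

variable {N : ℕ} {M : Type*} [TopologicalSpace M] [ChartedSpace (EuclideanSpace ℝ (Fin N)) M]

/-- The function `F²` on the tangent bundle, read in the coordinates `(q^i, v^i)` that a chart `e`
of `M` induces on the tangent bundle. -/
def chartG (F : TangentBundle (𝓡 N) M → ℝ)
    (e : OpenPartialHomeomorph M (EuclideanSpace ℝ (Fin N)))
    (q v : EuclideanSpace ℝ (Fin N)) : ℝ :=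
  F ⟨e.symm q, mfderiv (𝓡 N) (𝓡 N) e.symm q v⟩ ^ 2

/-- `F` is a Finsler metric on `M`, of class `C^3` off the zero section when it is read in the
coordinates induced by the charts of the atlas. -/
structure IsFinslerMetric [IsManifold (𝓡 N) 3 M] (F : TangentBundle (𝓡 N) M → ℝ) : Prop where
  continuous : Continuous F
  contDiffOn : ∀ e ∈ atlas (EuclideanSpace ℝ (Fin N)) M,
    ContDiffOn ℝ 3
      (fun z : EuclideanSpace ℝ (Fin N) × EuclideanSpace ℝ (Fin N) =>
        F ⟨e.symm z.1, mfderiv (𝓡 N) (𝓡 N) e.symm z.1 z.2⟩)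
      (e.target ×ˢ {0}ᶜ)
  homogeneous : ∀ (q : M) (v : TangentSpace (𝓡 N) q) (c : ℝ), 0 < c →
    F ⟨q, c • v⟩ = c * F ⟨q, v⟩
  pos : ∀ (q : M) (v : TangentSpace (𝓡 N) q), v ≠ 0 → 0 < F ⟨q, v⟩
  posDef : ∀ e ∈ atlas (EuclideanSpace ℝ (Fin N)) M, ∀ q ∈ e.target,
    ∀ v : EuclideanSpace ℝ (Fin N), v ≠ 0 → (gMatrix (chartG F e) q v).PosDef

/-- The velocity of a curve in `M`, as a point of the tangent bundle. -/
def velocity (γ : ℝ → M) (s : ℝ) : TangentBundle (𝓡 N) M :=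
  ⟨γ s, mfderiv 𝓘(ℝ, ℝ) (𝓡 N) γ s (1 : ℝ)⟩

/-- `γ` is a (regular, `C^2`) geodesic of `(M, F)` on the open interval `(a, b)`: in the
coordinates of every chart of the atlas,
`γ''^i + ½ g^{ij} (∂²_{q^k v^j} G γ'^k - ∂_{q^j} G) = 0` at `(γ, γ')`, where `G = F²`. -/
def IsGeodesicOn (F : TangentBundle (𝓡 N) M → ℝ) (a b : ℝ) (γ : ℝ → M) : Prop :=
  ∀ s ∈ Ioo a b, ContinuousAt γ s ∧
    ∀ e ∈ atlas (EuclideanSpace ℝ (Fin N)) M, γ s ∈ e.source →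
      ContDiffAt ℝ 2 (e ∘ γ) s ∧ deriv (e ∘ γ) s ≠ 0 ∧
      ∀ i : Fin N,
        deriv (deriv (e ∘ γ)) s i +
          (1 / 2) * ∑ j, (gMatrix (chartG F e) (e (γ s)) (deriv (e ∘ γ) s))⁻¹ i j *
            ((∑ k, dq (dv (chartG F e) j) k (e (γ s)) (deriv (e ∘ γ) s) * deriv (e ∘ γ) s k) -
              dq (chartG F e) j (e (γ s)) (deriv (e ∘ γ) s)) = 0

open Classical in
/-- The Finsler Hessian `H_Φ(q, v)[v, v]`: the second derivative at `0` of `Φ ∘ γ`, where `γ` is a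
geodesic with `γ(0) = q` and `γ'(0) = v`; the value is `0` for `v = 0`. -/
def finslerHessian (F : TangentBundle (𝓡 N) M → ℝ) (Φ : M → ℝ)
    (p : TangentBundle (𝓡 N) M) : ℝ :=
  if h : ∃ γ : ℝ → M, ∃ ε > 0, IsGeodesicOn F (-ε) ε γ ∧ velocity γ 0 = p
  then deriv (deriv (Φ ∘ h.choose)) 0
  else 0

/-- The partial derivative `∂_{q^i} Φ` at the point with coordinates `q` in the chart `e`. -/
def chartD (Φ : M → ℝ) (e : OpenPartialHomeomorph M (EuclideanSpace ℝ (Fin N))) (i : Fin N)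
    (q : EuclideanSpace ℝ (Fin N)) : ℝ :=
  fderiv ℝ (Φ ∘ e.symm) q (EuclideanSpace.single i 1)

/-- `g^{ij}(q, v) ∂_{q^i} Φ(q) ∂_{q^j} Φ(q)` in the coordinates of the chart `e`. -/
def dualNormSq (F : TangentBundle (𝓡 N) M → ℝ) (Φ : M → ℝ)
    (e : OpenPartialHomeomorph M (EuclideanSpace ℝ (Fin N)))
    (q v : EuclideanSpace ℝ (Fin N)) : ℝ :=
  ∑ i, ∑ j, (gMatrix (chartG F e) q v)⁻¹ i j * chartD Φ e i q * chartD Φ e j q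

/-- `x` restricts to an `H^1` curve `[0,1] → M`. -/
def IsH1Curve (x : ℝ → M) : Prop :=
  ContinuousOn x (Icc 0 1) ∧
    ∀ e ∈ atlas (EuclideanSpace ℝ (Fin N)) M, ∀ a b : ℝ, 0 ≤ a → a < b → b ≤ 1 →
      MapsTo x (Icc a b) e.source → SobolevOne 2 a b (e ∘ x)

/-- `x` restricts to a curve `[0,1] → M` of class `H^{2,∞}`. -/
def IsH2InftyCurve (x : ℝ → M) : Prop :=
  ContinuousOn x (Icc 0 1) ∧
    ∀ e ∈ atlas (EuclideanSpace ℝ (Fin N)) M, ∀ a b : ℝ, 0 ≤ a → a < b → b ≤ 1 →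
      MapsTo x (Icc a b) e.source → SobolevTwo ∞ a b (e ∘ x)

/-- The components, in the chart `e`, of a vector field `ξ` along the curve `x`. -/
def fieldInChart (e : OpenPartialHomeomorph M (EuclideanSpace ℝ (Fin N))) (x : ℝ → M)
    (ξ : (s : ℝ) → TangentSpace (𝓡 N) (x s)) (s : ℝ) : EuclideanSpace ℝ (Fin N) :=
  mfderiv (𝓡 N) (𝓡 N) e (x s) (ξ s)

/-- `ξ` is an `H^1` vector field along `x` on `[0,1]`. -/
def IsH1Field (x : ℝ → M) (ξ : (s : ℝ) → TangentSpace (𝓡 N) (x s)) : Prop :=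
  ∀ e ∈ atlas (EuclideanSpace ℝ (Fin N)) M, ∀ a b : ℝ, 0 ≤ a → a < b → b ≤ 1 →
    MapsTo x (Icc a b) e.source → SobolevOne 2 a b (fieldInChart e x ξ)

/-- The space of `H^1` curves `[0,1] → closure Ω` with endpoints on the boundary of `Ω`. -/
def chordSpace (N : ℕ) {M : Type*} [TopologicalSpace M]
    [ChartedSpace (EuclideanSpace ℝ (Fin N)) M] (Ω : Set M) : Set (ℝ → M) :=
  {x | IsH1Curve (N := N) x ∧ (∀ s ∈ Icc (0 : ℝ) 1, x s ∈ closure Ω) ∧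
    x 0 ∈ frontier Ω ∧ x 1 ∈ frontier Ω}

/-- The cone `V⁻(x)` of admissible infinitesimal variations of a curve `x` of the chord space of
`Ω = {Φ < 0}`: `H^1` fields along `x`, tangent to `∂Ω` at the endpoints, and pointing into
`closure Ω` wherever `x` touches `∂Ω`. -/
def admissibleVariations (Ω : Set M) (Φ : M → ℝ) (x : ℝ → M) :
    Set ((s : ℝ) → TangentSpace (𝓡 N) (x s)) :=
  {ξ | IsH1Field x ξ ∧
    mfderiv (𝓡 N) 𝓘(ℝ, ℝ) Φ (x 0) (ξ 0) = 0 ∧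
    mfderiv (𝓡 N) 𝓘(ℝ, ℝ) Φ (x 1) (ξ 1) = 0 ∧
    ∀ s ∈ Ioo (0 : ℝ) 1, x s ∈ frontier Ω →
      (show ℝ from mfderiv (𝓡 N) 𝓘(ℝ, ℝ) Φ (x s) (ξ s)) ≤ 0}

/-- The integrand `d_q G(x, x')[ξ] + d_v G(x, x')[ξ']` of the differential of the energy, `G = F²`,
in the coordinates of the chart `e`. At points where `x` and `ξ` are differentiable
its value does not depend on the chart around `x s`. -/
def variationIntegrand (F : TangentBundle (𝓡 N) M → ℝ)
    (e : OpenPartialHomeomorph M (EuclideanSpace ℝ (Fin N))) (x : ℝ → M)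
    (ξ : (s : ℝ) → TangentSpace (𝓡 N) (x s)) (s : ℝ) : ℝ :=
  ∑ i, (dq (chartG F e) i (e (x s)) (deriv (e ∘ x) s) * fieldInChart e x ξ s i +
    dv (chartG F e) i (e (x s)) (deriv (e ∘ x) s) * deriv (fieldInChart e x ξ) s i)

/-- The differential `dJ(x)[ξ] = ½ ∫₀¹ (d_q G(x, x')[ξ] + d_v G(x, x')[ξ']) ds` of the Finsler energy
`J(x) = ½ ∫₀¹ F²(x, x') ds`. -/
def energyDifferential (F : TangentBundle (𝓡 N) M → ℝ) (x : ℝ → M)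
    (ξ : (s : ℝ) → TangentSpace (𝓡 N) (x s)) : ℝ :=
  (1 / 2) * ∫ s in (0 : ℝ)..1,
    variationIntegrand F (chartAt (EuclideanSpace ℝ (Fin N)) (x s)) x ξ s

/-- `x` is a `V⁻`-critical curve for the Finsler energy on the chord space of `Ω = {Φ < 0}`. -/
def IsVCritical (F : TangentBundle (𝓡 N) M → ℝ) (Ω : Set M) (Φ : M → ℝ) (x : ℝ → M) : Prop :=
  x ∈ chordSpace N Ω ∧ ∀ ξ ∈ admissibleVariations (N := N) Ω Φ x, 0 ≤ energyDifferential F x ξ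

end Manifold

end

end Finsler

/-! In a chart let `u` be the curve, `g` its velocity and `p = ∂_v G(u, g)` its momentum.
Criticality says, heuristically, that `p'` differs from the force `∂_q G` by a measure carried by
the contact set and directed along `dφ`, where `φ` is `Φ` read in the chart. The point is to show
that this measure has a bounded density. Testing with cutoffs times `C^1` fields gives pointwise
information at Lebesgue points (`sub_le_integral_of_trapezoid`, `Obstacle.test_le`). Let `N` satisfy
`dφ(N) = 1` on the obstacle. Fields annihilated by `dφ` at contacts are admissible with both signs,
so the tangential momentum is a primitive (`Obstacle.w_sub`). The field `-N` shows that the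
accumulated reaction `m` is nondecreasing (`Obstacle.m_mono`), and away from contact `N` shows that
it is constant (`Obstacle.m_eq`).

The heart is `Obstacle.exists_impact_estimate`. Since `φ ∘ u ≤ 0` with equality at contacts, there
are times just before a contact with `dφ(g) ≥ 0` and times just after one with `dφ(g) ≤ 0`. Take
such a pair of times at distance `δ`, and let `D` be the size of the change of velocity. The
reaction paired with that change is at most `Δm · Cδ`, while `Δm ≤ C(D + δ)`. Strong convexity of
`G` in the fibers then gives `κD² ≤ Cδ(D + δ)`, so `D` and `Δm` are `O(δ)`. As `m` moves only
between the first and the last contact, it is Lipschitz (`Obstacle.exists_m_lipschitz`), and then so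
are momentum and velocity (`Obstacle.exists_lipschitz`).

These constants depend on a bound for the velocity, which monotonicity of `m` provides first between
interior times only. The reaction does no work, so `G(u, v)` is constant
(`Obstacle.Rep.energy_const`); this makes the bound uniform and carries the regularity up to the end
points.

On the zero section `G` is known to be only `C^1`. Homogeneity and compactness of the unit sphere
still give the convexity and Lipschitz constants of the momentum for all velocities.

The multiplier is `-m'/2`. On the contact set `dφ(v) = 0`, and differentiating once more gives
`D²φ(v, v) + dφ(v') = 0` almost everywhere. The geodesic acceleration differs from `v'` by the
reaction term, which yields the formula with the Finsler Hessian (`Finsler.multiplier_eq`). Where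
`v` vanishes so does the momentum, hence `m' = 0` almost everywhere there. The multiplier is given
by a chart-independent formula, so the local results patch together (`induction_on_charts`,
`ae_of_forall_Ioo`). -/

namespace Finsler

open Filter Topology
open scoped NNReal

/-! ### Primitives of integrable functions -/

section Primitive

variable {V W X Y : Type*} [NormedAddCommGroup V] [NormedSpace ℝ V]
  [NormedAddCommGroup W] [NormedSpace ℝ W] [PseudoMetricSpace X] [PseudoMetricSpace Y]

/-- `u` is on `[a, b]` a primitive of the integrable function `g`. -/
def PrimitiveOn (u g : ℝ → V) (a b : ℝ) : Prop :=
  IntegrableOn g (Icc a b) ∧ ∀ t ∈ Icc a b, u t = u a + ∫ s in a..t, g s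

/-- On a bounded interval `L^p` embeds in `L^1`. This separates the calculus of primitives, which
needs only integrability, from the exponent `p`. -/
lemma sobolevOne_iff {p : ℝ≥0∞} (hp : 1 ≤ p) {a b : ℝ} {u : ℝ → V} :
    SobolevOne p a b u ↔
      ∃ g, MemLp g p (volume.restrict (Icc a b)) ∧ PrimitiveOn u g a b :=
  ⟨fun ⟨g, hg, h⟩ => ⟨g, hg, hg.integrable hp, h⟩, fun ⟨g, hg, h⟩ => ⟨g, hg, h.2⟩⟩

/-- Comparison principle: it is applied with `h` the primitive of `‖g‖`, and with `h` a multiple of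
`u` when `f` is a Lipschitz image of `u`. -/
lemma _root_.AbsolutelyContinuousOnInterval.of_dist_le {f : ℝ → X} {h : ℝ → Y} {a b : ℝ}
    (hh : AbsolutelyContinuousOnInterval h a b)
    (H : ∀ x ∈ uIcc a b, ∀ y ∈ uIcc a b, dist (f x) (f y) ≤ dist (h x) (h y)) :
    AbsolutelyContinuousOnInterval f a b := by
  rw [absolutelyContinuousOnInterval_iff] at hh ⊢
  intro ε hε
  obtain ⟨δ, hδ, hd⟩ := hh ε hε
  refine ⟨δ, hδ, fun E hE hlt => lt_of_le_of_lt (Finset.sum_le_sum fun i hi => ?_) (hd E hE hlt)⟩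
  exact H _ (hE.1 i hi).1 _ (hE.1 i hi).2

namespace PrimitiveOn

variable {u g : ℝ → V} {a b : ℝ}

lemma intervalIntegrable (h : PrimitiveOn u g a b) {s t : ℝ} (hs : s ∈ Icc a b)
    (ht : t ∈ Icc a b) : IntervalIntegrable g volume s t :=
  (h.1.mono_set (uIcc_subset_Icc hs ht)).intervalIntegrable

lemma sub_eq (h : PrimitiveOn u g a b) {s t : ℝ} (hs : s ∈ Icc a b) (ht : t ∈ Icc a b) :
    u t - u s = ∫ r in s..t, g r := by
  have ha : a ∈ Icc a b := ⟨le_rfl, hs.1.trans hs.2⟩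
  rw [h.2 t ht, h.2 s hs, ← intervalIntegral.integral_interval_sub_left
    (h.intervalIntegrable ha ht) (h.intervalIntegrable ha hs)]
  abel

lemma mono (h : PrimitiveOn u g a b) {c d : ℝ} (hc : a ≤ c) (hd : d ≤ b) :
    PrimitiveOn u g c d := by
  refine ⟨h.1.mono_set (Icc_subset_Icc hc hd), fun t ht => ?_⟩
  rw [← h.sub_eq ⟨hc, (ht.1.trans ht.2).trans hd⟩ ⟨hc.trans ht.1, ht.2.trans hd⟩]
  abel

lemma congr {u' g' : ℝ → V} (h : PrimitiveOn u g a b) (hu : ∀ t ∈ Icc a b, u' t = u t)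
    (hg : ∀ᵐ t ∂(volume.restrict (Icc a b)), g' t = g t) : PrimitiveOn u' g' a b := by
  refine ⟨h.1.congr (hg.mono fun t ht => ht.symm), fun t ht => ?_⟩
  have ha : a ∈ Icc a b := ⟨le_rfl, ht.1.trans ht.2⟩
  rw [hu t ht, hu a ha, h.2 t ht]
  congr 1
  refine intervalIntegral.integral_congr_ae ?_
  rw [ae_restrict_iff' measurableSet_Icc] at hg
  filter_upwards [hg] with s hs hs'
  rw [uIoc_of_le ht.1] at hs'
  exact (hs ⟨hs'.1.le, hs'.2.trans ht.2⟩).symm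

lemma of_integral (hg : IntegrableOn g (Icc a b)) (c : V) :
    PrimitiveOn (fun t => c + ∫ s in a..t, g s) g a b :=
  ⟨hg, fun t _ => by simp⟩

lemma const (c : V) : PrimitiveOn (fun _ => c) (fun _ => 0) a b :=
  ⟨integrableOn_zero, fun t _ => by simp⟩

lemma absolutelyContinuous (h : PrimitiveOn u g a b) (hab : a ≤ b) :
    AbsolutelyContinuousOnInterval u a b := by
  have hi : IntervalIntegrable (fun s => ‖g s‖) volume a b :=
    (h.intervalIntegrable (left_mem_Icc.2 hab) (right_mem_Icc.2 hab)).norm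
  refine (hi.absolutelyContinuousOnInterval_intervalIntegral (c := a) (by simp)).of_dist_le
    fun x hx y hy => ?_
  rw [uIcc_of_le hab] at hx hy
  have ha : a ∈ Icc a b := left_mem_Icc.2 hab
  rw [dist_eq_norm, Real.dist_eq, h.sub_eq hy hx,
    intervalIntegral.integral_interval_sub_left (h.intervalIntegrable ha hx).norm
      (h.intervalIntegrable ha hy).norm]
  exact intervalIntegral.norm_integral_le_abs_integral_norm

lemma continuousOn (h : PrimitiveOn u g a b) : ContinuousOn u (Icc a b) := by
  rcases le_or_gt a b with hab | hab
  · simpa [uIcc_of_le hab] using (h.absolutelyContinuous hab).continuousOn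
  · simp [Icc_eq_empty_of_lt hab]

lemma ae_hasDerivAt [CompleteSpace V] (h : PrimitiveOn u g a b) :
    ∀ᵐ t, t ∈ Ioo a b → HasDerivAt u (g t) t := by
  rcases lt_or_ge a b with hab | hab
  · have hi := h.intervalIntegrable (left_mem_Icc.2 hab.le) (right_mem_Icc.2 hab.le)
    filter_upwards [hi.ae_hasDerivAt_integral] with t ht ht'
    rw [uIcc_of_le hab.le] at ht
    refine ((ht (Ioo_subset_Icc_self ht') a (left_mem_Icc.2 hab.le)).const_add
      (u a)).congr_of_eventuallyEq ?_
    filter_upwards [isOpen_Ioo.mem_nhds ht'] with s hs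
    exact h.2 s (Ioo_subset_Icc_self hs)
  · simp [Ioo_eq_empty_of_le hab]

/-- The difference between `u` and the integral of `g` is absolutely continuous with derivative zero
almost everywhere, hence constant. -/
lemma of_ae_hasDerivAt [CompleteSpace V] (hab : a ≤ b)
    (hac : AbsolutelyContinuousOnInterval u a b) (hg : IntegrableOn g (Icc a b))
    (hd : ∀ᵐ t, t ∈ Ioo a b → HasDerivAt u (g t) t) : PrimitiveOn u g a b := by
  refine ⟨hg, ?_⟩
  have hP := of_integral hg (0 : V)
  have hsub := hac.sub (hP.absolutelyContinuous hab)
  have h₁ : ∀ᵐ x : ℝ, x ≠ a := by simp [ae_iff, measure_singleton]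
  have h₂ : ∀ᵐ x : ℝ, x ≠ b := by simp [ae_iff, measure_singleton]
  obtain ⟨C, hC⟩ := hsub.const_of_ae_hasDerivAt_zero (by
    filter_upwards [hd, hP.ae_hasDerivAt, h₁, h₂] with t h1 h2 h3 h4 ht
    rw [uIcc_of_le hab] at ht
    have ht' : t ∈ Ioo a b := ⟨lt_of_le_of_ne ht.1 (Ne.symm h3), lt_of_le_of_ne ht.2 h4⟩
    simpa using (h1 ht').sub (h2 ht'))
  intro t ht
  rw [uIcc_of_le hab] at hC
  have h1 := hC t ht
  have h2 := hC a (left_mem_Icc.2 hab)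
  simp only [Pi.sub_apply, zero_add, intervalIntegral.integral_same, sub_zero] at h1 h2
  rw [h2, ← h1]; abel

/-- The image of `u` is compact, so `Ψ` is Lipschitz on it and the composition stays absolutely
continuous; the chain rule then identifies the derivative almost everywhere. -/
lemma comp [CompleteSpace V] [CompleteSpace W] (h : PrimitiveOn u g a b) {O : Set V}
    (hO : IsOpen O) {Ψ : V → W}
    (hΨ : ContDiffOn ℝ 1 Ψ O) (hu : ∀ t ∈ Icc a b, u t ∈ O) :
    PrimitiveOn (fun t => Ψ (u t)) (fun t => fderiv ℝ Ψ (u t) (g t)) a b := by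
  rcases lt_or_ge b a with hab | hab
  · simp [PrimitiveOn, Icc_eq_empty_of_lt hab]
  have hK : IsCompact (u '' Icc a b) := isCompact_Icc.image_of_continuousOn h.continuousOn
  have hKO : u '' Icc a b ⊆ O := by rintro _ ⟨t, ht, rfl⟩; exact hu t ht
  obtain ⟨C, hC⟩ : ∃ C, LipschitzOnWith C Ψ (u '' Icc a b) := by
    refine LocallyLipschitzOn.exists_lipschitzOnWith_of_compact hK fun x hx => ?_
    obtain ⟨C, t, ht, hL⟩ := (hΨ.contDiffAt (hO.mem_nhds (hKO hx))).exists_lipschitzOnWith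
    exact ⟨C, t, mem_nhdsWithin_of_mem_nhds ht, hL⟩
  have hD : ContinuousOn (fun t => fderiv ℝ Ψ (u t)) (Icc a b) :=
    (hΨ.continuousOn_fderiv_of_isOpen hO le_rfl).comp h.continuousOn hu
  refine of_ae_hasDerivAt hab ?_ ?_ ?_
  · have hac : AbsolutelyContinuousOnInterval (fun t => (C : ℝ) • u t) a b :=
      (h.absolutelyContinuous hab).const_smul (C : ℝ)
    refine hac.of_dist_le fun x hx y hy => ?_
    rw [uIcc_of_le hab] at hx hy
    rw [dist_smul₀, Real.norm_eq_abs, abs_of_nonneg C.coe_nonneg]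
    exact hC.dist_le_mul _ (mem_image_of_mem _ hx) _ (mem_image_of_mem _ hy)
  · obtain ⟨B, hB⟩ := isCompact_Icc.exists_bound_of_continuousOn hD
    refine (h.1.norm.const_mul B).mono' ?_ ?_
    · exact (ContinuousLinearMap.id ℝ (V →L[ℝ] W)).aestronglyMeasurable_comp₂
        (hD.aestronglyMeasurable measurableSet_Icc) h.1.aestronglyMeasurable
    · filter_upwards [ae_restrict_mem measurableSet_Icc] with t ht
      exact (ContinuousLinearMap.le_opNorm _ _).trans
        (mul_le_mul_of_nonneg_right (hB t ht) (norm_nonneg _))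
  · filter_upwards [h.ae_hasDerivAt] with t ht ht'
    exact (((hΨ.contDiffAt (hO.mem_nhds (hu t (Ioo_subset_Icc_self ht')))).differentiableAt
      one_ne_zero).hasFDerivAt.comp_hasDerivAt t (ht ht'))

end PrimitiveOn

end Primitive

/-! ### Products, gluing and extension by zero of primitives -/

section PrimitiveProd

variable {V W : Type*} [NormedAddCommGroup V] [NormedSpace ℝ V]
  [NormedAddCommGroup W] [NormedSpace ℝ W]

namespace PrimitiveOn

variable {u g : ℝ → V} {u' g' : ℝ → W} {a b : ℝ}

lemma prodMk [CompleteSpace V] [CompleteSpace W] (h : PrimitiveOn u g a b)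
    (h' : PrimitiveOn u' g' a b) :
    PrimitiveOn (fun t => (u t, u' t)) (fun t => (g t, g' t)) a b := by
  refine ⟨h.1.prodMk h'.1, fun t ht => ?_⟩
  have ha : a ∈ Icc a b := ⟨le_rfl, ht.1.trans ht.2⟩
  simp only []
  rw [h.2 t ht, h'.2 t ht, intervalIntegral.integral_of_le ht.1,
    intervalIntegral.integral_of_le ht.1, intervalIntegral.integral_of_le ht.1,
    integral_pair ((intervalIntegrable_iff_integrableOn_Ioc_of_le ht.1).1
      (h.intervalIntegrable ha ht)) ((intervalIntegrable_iff_integrableOn_Ioc_of_le ht.1).1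
      (h'.intervalIntegrable ha ht))]
  rfl

lemma smul [CompleteSpace V] {τ τ' : ℝ → ℝ} (hτ : PrimitiveOn τ τ' a b)
    (h : PrimitiveOn u g a b) :
    PrimitiveOn (fun t => τ t • u t) (fun t => τ t • g t + τ' t • u t) a b := by
  have := (hτ.prodMk h).comp (O := univ) isOpen_univ
    (Ψ := fun z : ℝ × V => z.1 • z.2) (contDiff_fst.smul contDiff_snd).contDiffOn
    (fun _ _ => mem_univ _)
  refine this.congr (fun _ _ => rfl) (Eventually.of_forall fun t => ?_)
  have h2 : HasFDerivAt (fun z : ℝ × V => z.1 • z.2) _ (τ t, u t) :=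
    (hasFDerivAt_fst (𝕜 := ℝ) (p := (τ t, u t))).smul hasFDerivAt_snd
  rw [h2.fderiv]
  simp

lemma add (h : PrimitiveOn u g a b) {w k : ℝ → V} (h' : PrimitiveOn w k a b) :
    PrimitiveOn (fun t => u t + w t) (fun t => g t + k t) a b := by
  refine ⟨h.1.add h'.1, fun t ht => ?_⟩
  have ha : a ∈ Icc a b := ⟨le_rfl, ht.1.trans ht.2⟩
  simp only []
  rw [intervalIntegral.integral_add (h.intervalIntegrable ha ht) (h'.intervalIntegrable ha ht),
    h.2 t ht, h'.2 t ht]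
  abel

lemma const_smul (h : PrimitiveOn u g a b) (c : ℝ) :
    PrimitiveOn (fun t => c • u t) (fun t => c • g t) a b :=
  ⟨h.1.smul c, fun t ht => by
    simp only []
    rw [intervalIntegral.integral_smul, h.2 t ht, smul_add]⟩

lemma glue {c : ℝ} (h : PrimitiveOn u g a c) (h' : PrimitiveOn u g c b) (hac : a ≤ c)
    (hcb : c ≤ b) : PrimitiveOn u g a b := by
  have hi : IntegrableOn g (Icc a b) := by
    rw [← Icc_union_Icc_eq_Icc hac hcb]; exact h.1.union h'.1
  refine ⟨hi, fun t ht => ?_⟩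
  rcases le_total t c with htc | htc
  · exact h.2 t ⟨ht.1, htc⟩
  · rw [h'.2 t ⟨htc, ht.2⟩, h.2 c ⟨hac, le_rfl⟩, add_assoc,
      intervalIntegral.integral_add_adjacent_intervals]
    · exact h.intervalIntegrable (left_mem_Icc.2 hac) (right_mem_Icc.2 hac)
    · exact h'.intervalIntegrable (left_mem_Icc.2 hcb) ⟨htc, ht.2⟩

/-- A jump at `α` or `β` would spoil the primitive, so the end value must vanish, but only on a side
where the interval is really enlarged. -/
lemma extend_zero {α β : ℝ} (h : PrimitiveOn u g α β) (ha : a ≤ α) (hαβ : α ≤ β) (hb : β ≤ b)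
    (hl : ∀ t ∈ Ico a α, u t = 0) (hr : ∀ t ∈ Ioc β b, u t = 0)
    (hα : a < α → u α = 0) (hβ : β < b → u β = 0) :
    PrimitiveOn u ((Icc α β).indicator g) a b := by
  have hz : ∀ {c d : ℝ}, (∀ t ∈ Icc c d, u t = 0) → PrimitiveOn u (fun _ => 0) c d :=
    fun H => (const (0 : V)).congr H (Eventually.of_forall fun _ => rfl)
  have h1 : PrimitiveOn u ((Icc α β).indicator g) α β :=
    h.congr (fun _ _ => rfl) ((ae_restrict_mem measurableSet_Icc).mono fun t ht => by
      rw [indicator_of_mem ht])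
  have hne : ∀ c : ℝ, ∀ᵐ x : ℝ, x ≠ c := fun c => by simp [ae_iff, measure_singleton]
  have h0 : PrimitiveOn u ((Icc α β).indicator g) a α := by
    rcases ha.eq_or_lt with rfl | ha
    · refine ⟨by simp, fun t ht => ?_⟩
      obtain rfl : t = a := by simpa using ht
      simp
    refine (hz fun t ht => ?_).congr (fun _ _ => rfl) ?_
    · rcases ht.2.eq_or_lt with rfl | h'
      exacts [hα ha, hl t ⟨ht.1, h'⟩]
    · filter_upwards [ae_restrict_mem measurableSet_Icc, ae_restrict_of_ae (hne α)] with t ht ht'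
      exact indicator_of_notMem (fun h'' => ht' (le_antisymm ht.2 h''.1)) _
  have h2 : PrimitiveOn u ((Icc α β).indicator g) β b := by
    rcases hb.eq_or_lt with rfl | hb
    · refine ⟨by simp, fun t ht => ?_⟩
      obtain rfl : t = β := by simpa using ht
      simp
    refine (hz fun t ht => ?_).congr (fun _ _ => rfl) ?_
    · rcases ht.1.eq_or_lt with rfl | h'
      exacts [hβ hb, hr t ⟨h', ht.2⟩]
    · filter_upwards [ae_restrict_mem measurableSet_Icc, ae_restrict_of_ae (hne β)] with t ht ht'
      exact indicator_of_notMem (fun h'' => ht' (le_antisymm h''.2 ht.1)) _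
  exact h0.glue (h1.glue h2 hαβ hb) ha (hαβ.trans hb)

end PrimitiveOn

lemma _root_.LipschitzWith.primitiveOn [FiniteDimensional ℝ V] {u : ℝ → V} {C : ℝ≥0}
    (hu : LipschitzWith C u) (a b : ℝ) : PrimitiveOn u (deriv u) a b := by
  rcases lt_or_ge b a with hab | hab
  · simp [PrimitiveOn, Icc_eq_empty_of_lt hab]
  have := FiniteDimensional.complete ℝ V
  refine PrimitiveOn.of_ae_hasDerivAt hab hu.lipschitzOnWith.absolutelyContinuousOnInterval ?_ ?_
  · refine Measure.integrableOn_of_bounded (M := C) (by simp)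
      (aestronglyMeasurable_deriv u _) (Eventually.of_forall fun t => norm_deriv_le_of_lipschitz hu)
  · filter_upwards [hu.ae_differentiableAt_real] with t ht _ using ht.hasDerivAt

end PrimitiveProd

/-! ### Trapezoidal test functions -/

section Trapezoid

/-- The piecewise affine function rising from `0` to `1` on `[s, s + ε]`. -/
noncomputable def ramp (s ε x : ℝ) : ℝ := max 0 (min 1 ((x - s) / ε))

/-- The derivative of `ramp`. -/
noncomputable def rampDeriv (s ε : ℝ) : ℝ → ℝ := (Ioc s (s + ε)).indicator fun _ => ε⁻¹

lemma ramp_of_le {s ε x : ℝ} (hε : 0 < ε) (h : x ≤ s) : ramp s ε x = 0 :=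
  max_eq_left ((min_le_right _ _).trans (div_nonpos_of_nonpos_of_nonneg (by linarith) hε.le))

lemma ramp_of_ge {s ε x : ℝ} (hε : 0 < ε) (h : s + ε ≤ x) : ramp s ε x = 1 := by
  have : 1 ≤ (x - s) / ε := by rw [le_div_iff₀ hε]; linarith
  simp [ramp, min_eq_left this]

lemma ramp_anti {s t ε x : ℝ} (hε : 0 < ε) (h : s ≤ t) : ramp t ε x ≤ ramp s ε x := by
  unfold ramp; gcongr

lemma ramp_primitiveOn {s ε : ℝ} (hε : 0 < ε) (a b : ℝ) :
    PrimitiveOn (ramp s ε) (rampDeriv s ε) a b := by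
  rcases lt_or_ge b a with hab | hab
  · simp [PrimitiveOn, Icc_eq_empty_of_lt hab]
  have hL : LipschitzWith (Real.toNNReal ε⁻¹) (ramp s ε) := by
    have : LipschitzWith (Real.toNNReal ε⁻¹) fun x : ℝ => (x - s) / ε := by
      refine LipschitzWith.of_dist_le_mul fun x y => le_of_eq ?_
      rw [Real.dist_eq, Real.dist_eq, Real.coe_toNNReal _ (by positivity), ← sub_div,
        sub_sub_sub_cancel_right, abs_div, abs_of_pos hε]
      field_simp
    exact (this.const_min 1).const_max 0
  have hne : ∀ c : ℝ, ∀ᵐ x : ℝ, x ≠ c := fun c => by simp [ae_iff, measure_singleton]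
  refine PrimitiveOn.of_ae_hasDerivAt hab hL.lipschitzOnWith.absolutelyContinuousOnInterval ?_ ?_
  · exact (integrable_indicator_iff measurableSet_Ioc).2 (by simp) |>.integrableOn
  · filter_upwards [hne s, hne (s + ε)] with t h1 h2 _
    rcases lt_or_gt_of_ne h1 with h1 | h1
    · rw [rampDeriv, indicator_of_notMem (fun h => absurd h.1 h1.not_gt)]
      refine (hasDerivAt_const t (0 : ℝ)).congr_of_eventuallyEq ?_
      filter_upwards [Iio_mem_nhds h1] with x hx using ramp_of_le hε (le_of_lt hx)
    rcases lt_or_gt_of_ne h2 with h2 | h2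
    · rw [rampDeriv, indicator_of_mem (show t ∈ Ioc s (s + ε) from ⟨h1, h2.le⟩)]
      have : HasDerivAt (fun x : ℝ => (x - s) / ε) (ε⁻¹) t := by
        simpa using ((hasDerivAt_id t).sub_const s).div_const ε
      refine this.congr_of_eventuallyEq ?_
      filter_upwards [Ioo_mem_nhds h1 h2] with x hx
      have h3 : (x - s) / ε ≤ 1 := by rw [div_le_one hε]; linarith [hx.2]
      have h4 : 0 ≤ (x - s) / ε := div_nonneg (by linarith [hx.1]) hε.le
      rw [ramp, min_eq_right h3, max_eq_right h4]
    · rw [rampDeriv, indicator_of_notMem (fun h => absurd h.2 h2.not_ge)]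
      refine (hasDerivAt_const t (1 : ℝ)).congr_of_eventuallyEq ?_
      filter_upwards [Ioi_mem_nhds h2] with x hx using ramp_of_ge hε (le_of_lt hx)

/-- The trapezoid with value `1` on `[s + ε, t]` and `0` outside `[s, t + ε]`. -/
noncomputable def trapezoid (s t ε x : ℝ) : ℝ := ramp s ε x - ramp t ε x

/-- The derivative of `trapezoid`. -/
noncomputable def trapezoidDeriv (s t ε x : ℝ) : ℝ := rampDeriv s ε x - rampDeriv t ε x

lemma trapezoid_nonneg {s t ε : ℝ} (hε : 0 < ε) (h : s ≤ t) (x : ℝ) : 0 ≤ trapezoid s t ε x :=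
  sub_nonneg.2 (ramp_anti hε h)

lemma trapezoid_of_le {s t ε x : ℝ} (hε : 0 < ε) (h : s ≤ t) (hx : x ≤ s) :
    trapezoid s t ε x = 0 := by
  rw [trapezoid, ramp_of_le hε hx, ramp_of_le hε (hx.trans h), sub_zero]

lemma trapezoid_of_ge {s t ε x : ℝ} (hε : 0 < ε) (h : s ≤ t) (hx : t + ε ≤ x) :
    trapezoid s t ε x = 0 := by
  rw [trapezoid, ramp_of_ge hε hx, ramp_of_ge hε (by linarith), sub_self]

lemma trapezoid_primitiveOn {s t ε : ℝ} (hε : 0 < ε) (a b : ℝ) :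
    PrimitiveOn (trapezoid s t ε) (trapezoidDeriv s t ε) a b :=
  ((ramp_primitiveOn (s := s) hε a b).add ((ramp_primitiveOn (s := t) hε a b).const_smul (-1))).congr
    (fun x _ => by simp [trapezoid, sub_eq_add_neg])
    (Eventually.of_forall fun x => by simp [trapezoidDeriv, sub_eq_add_neg])

lemma trapezoidDeriv_memLp (s t ε : ℝ) (p : ℝ≥0∞) (a b : ℝ) :
    MemLp (trapezoidDeriv s t ε) p (volume.restrict (Icc a b)) :=
  (memLp_indicator_const p measurableSet_Ioc _ (Or.inr (measure_ne_top _ _))).sub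
    (memLp_indicator_const p measurableSet_Ioc _ (Or.inr (measure_ne_top _ _)))

lemma integral_rampDeriv_mul {a b s ε : ℝ} (hε : 0 < ε) (hs : a ≤ s) (hb : s + ε ≤ b)
    (f : ℝ → ℝ) :
    ∫ x in a..b, rampDeriv s ε x * f x = ε⁻¹ * ∫ x in s..(s + ε), f x := by
  rw [intervalIntegral.integral_of_le (by linarith), intervalIntegral.integral_of_le (by linarith),
    ← integral_const_mul]
  have : ∀ x, rampDeriv s ε x * f x = (Ioc s (s + ε)).indicator (fun x => ε⁻¹ * f x) x := by
    intro x; by_cases hx : x ∈ Ioc s (s + ε) <;> simp [rampDeriv, hx]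
  simp_rw [this]
  rw [setIntegral_indicator measurableSet_Ioc, inter_eq_right.2 (Ioc_subset_Ioc hs hb)]

/-- The averages are right difference quotients of the integral of `X`. They arise from integrating
`X` against the slope of a ramp. -/
lemma tendsto_average_right {X : ℝ → ℝ} {a b s : ℝ} (hX : IntegrableOn X (Icc a b))
    (hs : s ∈ Ioo a b) (hd : HasDerivAt (fun t => ∫ x in a..t, X x) (X s) s) :
    Tendsto (fun ε => ε⁻¹ * ∫ x in s..(s + ε), X x) (𝓝[>] 0) (𝓝 (X s)) := by
  refine (hd.tendsto_slope_zero_right).congr' ?_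
  have hlt : ∀ᶠ ε in 𝓝[>] (0 : ℝ), ε < b - s :=
    mem_nhdsWithin_of_mem_nhds (Iio_mem_nhds (by linarith [hs.2]))
  filter_upwards [hlt, self_mem_nhdsWithin] with ε h1 h2
  have h2 : 0 < ε := h2
  have hi : ∀ t ∈ Icc a b, IntervalIntegrable X volume a t := fun t ht =>
    (hX.mono_set (uIcc_subset_Icc ⟨le_rfl, ht.1.trans ht.2⟩ ht)).intervalIntegrable
  rw [intervalIntegral.integral_interval_sub_left (hi _ ⟨by linarith [hs.1], by linarith⟩)
    (hi _ (Ioo_subset_Icc_self hs)), smul_eq_mul]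

/-- A pointwise inequality at Lebesgue points, obtained by testing with trapezoids. -/
lemma sub_le_integral_of_trapezoid {α β : ℝ → ℝ} {a b s t : ℝ} (hα : IntegrableOn α (Icc a b))
    (hβ : IntegrableOn β (Icc a b)) (hs : s ∈ Ioo a b) (ht : t ∈ Ioo a b) (hst : s < t)
    (hsd : HasDerivAt (fun t => ∫ x in a..t, β x) (β s) s)
    (htd : HasDerivAt (fun t => ∫ x in a..t, β x) (β t) t)
    (H : ∀ᶠ ε in 𝓝[>] (0 : ℝ),
      0 ≤ ∫ x in a..b, (trapezoid s t ε x * α x + trapezoidDeriv s t ε x * β x)) :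
    β t - β s ≤ ∫ x in s..t, α x := by
  have hab : a ≤ b := (hs.1.trans hs.2).le
  have hA := PrimitiveOn.of_integral hα 0
  simp only [zero_add] at hA
  set A : ℝ → ℝ := fun t => ∫ x in a..t, α x with hAdef
  have hAi : IntegrableOn A (Icc a b) := hA.continuousOn.integrableOn_Icc
  -- With `A` a primitive of `α`, integration by parts turns the tested integrand into `τ' (β - A)`,
  -- so that only averages of `X` near `s` and `t` remain.
  set X : ℝ → ℝ := fun x => β x - A x
  have hX : IntegrableOn X (Icc a b) := hβ.sub hAi
  have hXd : ∀ r ∈ Ioo a b, HasDerivAt (fun t => ∫ x in a..t, β x) (β r) r →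
      HasDerivAt (fun t => ∫ x in a..t, X x) (X r) r := by
    intro r hr hd
    have hAc : HasDerivAt (fun t => ∫ x in a..t, A x) (A r) r :=
      intervalIntegral.integral_hasDerivAt_right
        ((hAi.mono_set (uIcc_subset_Icc ⟨le_rfl, hab⟩ (Ioo_subset_Icc_self hr))).intervalIntegrable)
        ((hA.continuousOn.mono Ioo_subset_Icc_self).stronglyMeasurableAtFilter isOpen_Ioo r hr)
        (hA.continuousOn.continuousAt (Icc_mem_nhds hr.1 hr.2))
    refine (hd.sub hAc).congr_of_eventuallyEq ?_
    filter_upwards [Ioo_mem_nhds hr.1 hr.2] with x hx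
    exact intervalIntegral.integral_sub
      ((hβ.mono_set (uIcc_subset_Icc ⟨le_rfl, hab⟩ (Ioo_subset_Icc_self hx))).intervalIntegrable)
      ((hAi.mono_set (uIcc_subset_Icc ⟨le_rfl, hab⟩ (Ioo_subset_Icc_self hx))).intervalIntegrable)
  have key : ∀ᶠ ε in 𝓝[>] (0 : ℝ), 0 ≤ ε⁻¹ * (∫ x in s..(s + ε), X x) -
      ε⁻¹ * ∫ x in t..(t + ε), X x := by
    have hlt : ∀ᶠ ε in 𝓝[>] (0 : ℝ), ε < b - t :=
      mem_nhdsWithin_of_mem_nhds (Iio_mem_nhds (by linarith [ht.2]))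
    filter_upwards [H, hlt, self_mem_nhdsWithin] with ε hε h1 h2
    have h2 : 0 < ε := h2
    have hτ := trapezoid_primitiveOn (s := s) (t := t) h2 a b
    -- The integral of `(τ A)'` is zero because the trapezoid vanishes at both ends.
    have hp := (hτ.smul hA).2 b ⟨hab, le_rfl⟩
    simp only [smul_eq_mul] at hp
    rw [trapezoid_of_ge h2 hst.le (by linarith), trapezoid_of_le h2 hst.le hs.1.le, zero_mul,
      zero_mul, zero_add] at hp
    have hbd : ∀ c, ∃ M, ∀ x, ‖rampDeriv c ε x‖ ≤ M := fun c => ⟨‖ε⁻¹‖, fun x =>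
      norm_indicator_le_norm_self _ _⟩
    have hri : ∀ c {f : ℝ → ℝ}, IntegrableOn f (Icc a b) →
        IntegrableOn (fun x => rampDeriv c ε x * f x) (Icc a b) := by
      intro c f hf
      obtain ⟨M, hM⟩ := hbd c
      exact Integrable.bdd_mul (c := M) hf
        ((measurable_const.indicator measurableSet_Ioc).aestronglyMeasurable)
        (Eventually.of_forall hM)
    have hti : ∀ {f : ℝ → ℝ}, IntegrableOn f (Icc a b) →
        IntegrableOn (fun x => trapezoidDeriv s t ε x * f x) (Icc a b) := by
      intro f hf
      refine ((hri s hf).sub (hri t hf)).congr (Eventually.of_forall fun x => ?_)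
      simp [trapezoidDeriv, sub_mul]
    have hI : ∀ {f : ℝ → ℝ}, IntegrableOn f (Icc a b) → IntervalIntegrable f volume a b :=
      fun hf => (intervalIntegrable_iff_integrableOn_Icc_of_le hab).2 hf
    have hτα : IntegrableOn (fun x => trapezoid s t ε x * α x) (Icc a b) :=
      hα.continuousOn_mul hτ.continuousOn isCompact_Icc
    rw [intervalIntegral.integral_add (hI hτα) (hI (hti hβ))] at hε
    rw [intervalIntegral.integral_add (hI hτα) (hI (hti hAi))] at hp
    rw [← integral_rampDeriv_mul h2 hs.1.le (by linarith : s + ε ≤ b),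
      ← integral_rampDeriv_mul h2 ht.1.le (by linarith : t + ε ≤ b),
      ← intervalIntegral.integral_sub (hI (hri s hX)) (hI (hri t hX))]
    have : ∀ x, rampDeriv s ε x * X x - rampDeriv t ε x * X x =
        trapezoidDeriv s t ε x * β x - trapezoidDeriv s t ε x * A x := by
      intro x; simp only [trapezoidDeriv, X]; ring
    simp_rw [this]
    rw [intervalIntegral.integral_sub (hI (hti hβ)) (hI (hti hAi))]
    linarith
  have hlim := (tendsto_average_right hX hs (hXd s hs hsd)).sub
    (tendsto_average_right hX ht (hXd t ht htd))
  have h0 := ge_of_tendsto hlim key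
  have hAst := hA.sub_eq (Ioo_subset_Icc_self hs) (Ioo_subset_Icc_self ht)
  simp only [X] at h0
  linarith

end Trapezoid

/-! ### Two-homogeneous Lagrangians -/

section Lagrangian

variable {E : Type*} [NormedAddCommGroup E] [NormedSpace ℝ E]

/-- `G` is, over the open set `U`, the square of a Finsler metric. -/
structure IsLagrangian (U : Set E) (G : E × E → ℝ) : Prop where
  isOpen : IsOpen U
  contDiffAt : ∀ q ∈ U, ∀ v ≠ 0, ContDiffAt ℝ 3 G (q, v)
  homog : ∀ q ∈ U, ∀ v, ∀ c : ℝ, 0 < c → G (q, c • v) = c ^ 2 * G (q, v)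
  posDef : ∀ q ∈ U, ∀ v ≠ 0, ∀ w ≠ 0, 0 < fderiv ℝ (fderiv ℝ G) (q, v) (0, w) (0, w)

/-- The derivative of `G (q, v)` with respect to `q`. -/
noncomputable def baseDeriv (G : E × E → ℝ) (z : E × E) : E →L[ℝ] ℝ :=
  (fderiv ℝ G z).comp (ContinuousLinearMap.inl ℝ E E)

/-- The derivative of `G (q, v)` with respect to `v`. -/
noncomputable def fiberDeriv (G : E × E → ℝ) (z : E × E) : E →L[ℝ] ℝ :=
  (fderiv ℝ G z).comp (ContinuousLinearMap.inr ℝ E E)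

lemma baseDeriv_apply (G : E × E → ℝ) (z : E × E) (w : E) :
    baseDeriv G z w = fderiv ℝ G z (w, 0) := rfl

lemma fiberDeriv_apply (G : E × E → ℝ) (z : E × E) (w : E) :
    fiberDeriv G z w = fderiv ℝ G z (0, w) := rfl

lemma fderiv_apply_eq (G : E × E → ℝ) (z w : E × E) :
    fderiv ℝ G z w = baseDeriv G z w.1 + fiberDeriv G z w.2 := by
  rw [baseDeriv_apply, fiberDeriv_apply, ← map_add]; simp

/-- Mean value inequality with one exceptional point, proved by splitting there. It is needed
because a segment of velocities may cross the origin, where a second derivative of `G` is not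
available. -/
lemma le_sub_of_hasDerivAt_off {h h' : ℝ → ℝ} {m t₀ : ℝ} (hc : ContinuousOn h (Icc 0 1))
    (hd : ∀ t ∈ Ioo (0 : ℝ) 1, t ≠ t₀ → HasDerivAt h (h' t) t ∧ m ≤ h' t) : m ≤ h 1 - h 0 := by
  have key : ∀ a b, 0 ≤ a → a ≤ b → b ≤ 1 → (t₀ ∉ Ioo a b) → m * (b - a) ≤ h b - h a := by
    intro a b ha hab hb ht
    rcases hab.eq_or_lt with rfl | hab
    · simp
    obtain ⟨c, hc, hc'⟩ := exists_hasDerivAt_eq_slope h h' hab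
      (hc.mono (Icc_subset_Icc ha hb)) (fun x hx => (hd x ⟨ha.trans_lt hx.1, hx.2.trans_le hb⟩
        (fun h => ht (h ▸ hx))).1)
    have := (hd c ⟨ha.trans_lt hc.1, hc.2.trans_le hb⟩ (fun h => ht (h ▸ hc))).2
    rw [hc', le_div_iff₀ (by linarith)] at this
    exact this
  by_cases ht : t₀ ∈ Ioo (0 : ℝ) 1
  · have h1 := key 0 t₀ le_rfl ht.1.le ht.2.le (fun h => lt_irrefl _ h.2)
    have h2 := key t₀ 1 ht.1.le ht.2.le le_rfl (fun h => lt_irrefl _ h.1)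
    linarith
  · simpa using key 0 1 le_rfl zero_le_one le_rfl ht

lemma exists_unit_smul {v : E} (hv : v ≠ 0) :
    ∃ (c : ℝ) (w : E), 0 < c ∧ ‖w‖ = 1 ∧ c = ‖v‖ ∧ v = c • w := by
  have hv' := norm_pos_iff.2 hv
  exact ⟨‖v‖, ‖v‖⁻¹ • v, hv', by rw [norm_smul, norm_inv, norm_norm, inv_mul_cancel₀ hv'.ne'],
    rfl, by rw [smul_smul, mul_inv_cancel₀ hv'.ne', one_smul]⟩

lemma exists_segment_ne_zero {v w : E} (hvw : v ≠ w) :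
    ∃ t₀ : ℝ, ∀ t, t ≠ t₀ → w + t • (v - w) ≠ 0 := by
  by_cases h : ∃ t₀ : ℝ, w + t₀ • (v - w) = 0
  · obtain ⟨t₀, h0⟩ := h
    refine ⟨t₀, fun t ht h1 => ht ?_⟩
    have : (t - t₀) • (v - w) = 0 := by
      rw [sub_smul]; rw [← h0] at h1; simpa [sub_eq_zero] using h1
    rcases smul_eq_zero.1 this with h2 | h2
    · linarith
    · exact absurd (sub_eq_zero.1 h2) hvw
  · push Not at h
    exact ⟨0, fun t _ => h t⟩

/-- Compactness of `K` times the unit sphere; homogeneity later carries such bounds to all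
velocities. -/
lemma exists_bound_sphere [FiniteDimensional ℝ E] {F : Type*} [SeminormedAddCommGroup F]
    {U : Set E} {f : E × E → F} (hf : ∀ q ∈ U, ∀ v ≠ 0, ContinuousAt f (q, v)) {K : Set E}
    (hK : IsCompact K) (hKU : K ⊆ U) :
    ∃ C, 0 ≤ C ∧ ∀ q ∈ K, ∀ v : E, ‖v‖ = 1 → ‖f (q, v)‖ ≤ C := by
  have hc : IsCompact (K ×ˢ Metric.sphere (0 : E) 1) := hK.prod (isCompact_sphere 0 1)
  obtain ⟨C, hC⟩ := hc.exists_bound_of_continuousOn (f := f) (fun z hz =>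
    (hf z.1 (hKU hz.1) z.2 (fun h => by
      have := hz.2; rw [h] at this; simp at this)).continuousWithinAt)
  exact ⟨max C 0, le_max_right _ _, fun q hq v hv =>
    (hC (q, v) ⟨hq, by simpa using hv⟩).trans (le_max_left _ _)⟩

namespace IsLagrangian

variable {U : Set E} {G : E × E → ℝ} (hG : IsLagrangian U G)
include hG

lemma apply_zero {q : E} (hq : q ∈ U) : G (q, 0) = 0 := by
  have := hG.homog q hq 0 2 two_pos
  rw [smul_zero] at this
  linarith

lemma exists_apply_le [FiniteDimensional ℝ E] {K : Set E} (hK : IsCompact K) (hKU : K ⊆ U) :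
    ∃ C, 0 ≤ C ∧ ∀ q ∈ K, ∀ v : E, ‖G (q, v)‖ ≤ C * ‖v‖ ^ 2 := by
  obtain ⟨C, hC0, hC⟩ := exists_bound_sphere (f := G)
    (fun q hq v hv => (hG.contDiffAt q hq v hv).continuousAt) hK hKU
  refine ⟨C, hC0, fun q hq v => ?_⟩
  rcases eq_or_ne v 0 with rfl | hv
  · simp [hG.apply_zero (hKU hq)]
  have hv' := norm_pos_iff.2 hv
  have : v = ‖v‖ • (‖v‖⁻¹ • v) := by rw [smul_smul, mul_inv_cancel₀ hv'.ne', one_smul]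
  rw [this, hG.homog q (hKU hq) _ _ hv', norm_mul, ← this, mul_comm, norm_pow, norm_norm]
  gcongr
  exact hC q hq _ (by rw [norm_smul, norm_inv, norm_norm, inv_mul_cancel₀ hv'.ne'])

lemma exists_compact_nhds [FiniteDimensional ℝ E] {q : E} (hq : q ∈ U) :
    ∃ K : Set E, IsCompact K ∧ K ⊆ U ∧ K ∈ 𝓝 q := by
  have := FiniteDimensional.proper_real E
  obtain ⟨K, hK, hKU, hKc⟩ := local_compact_nhds (hG.isOpen.mem_nhds hq)
  exact ⟨K, hKc, hKU, hK⟩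

/-- By homogeneity `G` is bounded by a multiple of `‖v‖²`, locally uniformly in the base point, so
it is quadratically small at the zero section. -/
lemma hasFDerivAt_zero [FiniteDimensional ℝ E] {q : E} (hq : q ∈ U) :
    HasFDerivAt G (0 : E × E →L[ℝ] ℝ) (q, 0) := by
  obtain ⟨K, hKc, hKU, hK⟩ := hG.exists_compact_nhds hq
  obtain ⟨C, hC0, hC⟩ := hG.exists_apply_le hKc hKU
  refine Asymptotics.IsBigO.hasFDerivAt (n := 2) ?_ one_lt_two
  refine Asymptotics.IsBigO.of_bound C ?_
  have : ∀ᶠ z : E × E in 𝓝 (q, 0), z.1 ∈ K := continuousAt_fst.eventually hK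
  filter_upwards [this] with z hz
  refine (hC z.1 hz z.2).trans ?_
  rw [norm_pow, norm_norm]
  gcongr
  have := norm_snd_le (z - (q, 0))
  simpa using this

lemma differentiableAt [FiniteDimensional ℝ E] {q : E} (hq : q ∈ U) (v : E) :
    DifferentiableAt ℝ G (q, v) := by
  rcases eq_or_ne v 0 with rfl | hv
  · exact (hG.hasFDerivAt_zero hq).differentiableAt
  · exact (hG.contDiffAt q hq v hv).differentiableAt (by norm_num)

lemma fderiv_zero [FiniteDimensional ℝ E] {q : E} (hq : q ∈ U) : fderiv ℝ G (q, 0) = 0 :=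
  (hG.hasFDerivAt_zero hq).fderiv

lemma contDiffAt_fderiv {q : E} (hq : q ∈ U) {v : E} (hv : v ≠ 0) :
    ContDiffAt ℝ 2 (fderiv ℝ G) (q, v) :=
  (hG.contDiffAt q hq v hv).fderiv_right (by norm_num)

/-- The rescaling of the fibers of `E × E`. -/
lemma fderiv_homog [FiniteDimensional ℝ E] {q : E} (hq : q ∈ U) (v : E) {c : ℝ} (hc : 0 < c)
    (ξ η : E) : fderiv ℝ G (q, c • v) (ξ, c • η) = c ^ 2 * fderiv ℝ G (q, v) (ξ, η) := by
  let S : E × E →L[ℝ] E × E := (ContinuousLinearMap.fst ℝ E E).prod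
    (c • ContinuousLinearMap.snd ℝ E E)
  have h1 : HasFDerivAt (fun z => G (S z)) ((fderiv ℝ G (q, c • v)).comp S) (q, v) :=
    (hG.differentiableAt hq (c • v)).hasFDerivAt.comp (q, v) S.hasFDerivAt
  have h2 : HasFDerivAt (fun z => c ^ 2 * G z) (c ^ 2 • fderiv ℝ G (q, v)) (q, v) :=
    (hG.differentiableAt hq v).hasFDerivAt.const_mul (c ^ 2)
  have h3 : (fun z => G (S z)) =ᶠ[𝓝 (q, v)] fun z => c ^ 2 * G z := by
    have : ∀ᶠ z : E × E in 𝓝 (q, v), z.1 ∈ U :=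
      continuousAt_fst.eventually (hG.isOpen.mem_nhds hq)
    filter_upwards [this] with z hz using hG.homog z.1 hz z.2 c hc
  have := h1.unique (h2.congr_of_eventuallyEq h3)
  simpa [S] using DFunLike.congr_fun this (ξ, η)

/-- This is the identity `fderiv_homog` differentiated once more with the direction `(ξ', η')`
fixed. -/
lemma fderiv_fderiv_homog [FiniteDimensional ℝ E] {q : E} (hq : q ∈ U) {v : E} (hv : v ≠ 0)
    {c : ℝ} (hc : 0 < c) (ξ η ξ' η' : E) :
    fderiv ℝ (fderiv ℝ G) (q, c • v) (ξ, c • η) (ξ', c • η') =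
      c ^ 2 * fderiv ℝ (fderiv ℝ G) (q, v) (ξ, η) (ξ', η') := by
  let S : E × E →L[ℝ] E × E := (ContinuousLinearMap.fst ℝ E E).prod
    (c • ContinuousLinearMap.snd ℝ E E)
  have hd : ∀ w ≠ 0, DifferentiableAt ℝ (fderiv ℝ G) (q, w) := fun w hw =>
    (hG.contDiffAt_fderiv hq hw).differentiableAt (by norm_num)
  have h1 : HasFDerivAt (fun z => fderiv ℝ G (S z))
      ((fderiv ℝ (fderiv ℝ G) (q, c • v)).comp S) (q, v) :=
    (hd (c • v) (smul_ne_zero hc.ne' hv)).hasFDerivAt.comp (q, v) S.hasFDerivAt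
  have h1' := h1.clm_apply (hasFDerivAt_const (S (ξ', η')) (q, v))
  have h2 := ((hd v hv).hasFDerivAt.clm_apply (hasFDerivAt_const (ξ', η') (q, v))).const_mul
    (c ^ 2)
  have h3 : (fun z => fderiv ℝ G (S z) (S (ξ', η'))) =ᶠ[𝓝 (q, v)]
      fun z => c ^ 2 * fderiv ℝ G z (ξ', η') := by
    have : ∀ᶠ z : E × E in 𝓝 (q, v), z.1 ∈ U :=
      continuousAt_fst.eventually (hG.isOpen.mem_nhds hq)
    filter_upwards [this] with z hz using hG.fderiv_homog hz z.2 hc ξ' η'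
  have := h1'.unique (h2.congr_of_eventuallyEq h3)
  simpa [S] using DFunLike.congr_fun this (ξ, η)

lemma fiberDeriv_homog [FiniteDimensional ℝ E] {q : E} (hq : q ∈ U) (v : E) {c : ℝ}
    (hc : 0 < c) : fiberDeriv G (q, c • v) = c • fiberDeriv G (q, v) := by
  ext η
  have := hG.fderiv_homog hq v hc 0 (c⁻¹ • η)
  rw [smul_smul, mul_inv_cancel₀ hc.ne', one_smul] at this
  rw [fiberDeriv_apply, this, smul_apply, fiberDeriv_apply]
  have h0 : ((0 : E), c⁻¹ • η) = c⁻¹ • ((0 : E), η) := by simp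
  rw [h0, map_smul, smul_eq_mul, smul_eq_mul]
  field_simp

lemma baseDeriv_homog [FiniteDimensional ℝ E] {q : E} (hq : q ∈ U) (v : E) {c : ℝ}
    (hc : 0 < c) : baseDeriv G (q, c • v) = c ^ 2 • baseDeriv G (q, v) := by
  ext ξ
  have := hG.fderiv_homog hq v hc ξ 0
  rw [smul_zero] at this
  rw [baseDeriv_apply, this, smul_apply, baseDeriv_apply, smul_eq_mul]

/-- The two factors `c⁻¹` from the arguments cancel `c²`. Degree zero is what makes bounds on the
unit sphere uniform over all nonzero velocities. -/
lemma fiberHess_homog [FiniteDimensional ℝ E] {q : E} (hq : q ∈ U) {v : E} (hv : v ≠ 0)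
    {c : ℝ} (hc : 0 < c) (η η' : E) :
    fderiv ℝ (fderiv ℝ G) (q, c • v) (0, η) (0, η') =
      fderiv ℝ (fderiv ℝ G) (q, v) (0, η) (0, η') := by
  have := hG.fderiv_fderiv_homog hq hv hc 0 (c⁻¹ • η) 0 (c⁻¹ • η')
  rw [smul_smul, smul_smul, mul_inv_cancel₀ hc.ne', one_smul, one_smul] at this
  rw [this]
  have h0 : ∀ η : E, ((0 : E), c⁻¹ • η) = c⁻¹ • ((0 : E), η) := by simp
  rw [h0, h0, map_smul, map_smul, smul_apply, smul_eq_mul, smul_eq_mul]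
  field_simp

lemma fiberDeriv_zero [FiniteDimensional ℝ E] {q : E} (hq : q ∈ U) :
    fiberDeriv G (q, 0) = 0 := by
  rw [fiberDeriv, hG.fderiv_zero hq, ContinuousLinearMap.zero_comp]

lemma baseDeriv_zero [FiniteDimensional ℝ E] {q : E} (hq : q ∈ U) :
    baseDeriv G (q, 0) = 0 := by
  rw [baseDeriv, hG.fderiv_zero hq, ContinuousLinearMap.zero_comp]

lemma continuousAt_fderiv_of_ne {q : E} (hq : q ∈ U) {v : E} (hv : v ≠ 0) :
    ContinuousAt (fderiv ℝ G) (q, v) := (hG.contDiffAt_fderiv hq hv).continuousAt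

lemma exists_deriv_bounds [FiniteDimensional ℝ E] {K : Set E} (hK : IsCompact K)
    (hKU : K ⊆ U) : ∃ C, 0 ≤ C ∧ ∀ q ∈ K, ∀ v : E,
      ‖baseDeriv G (q, v)‖ ≤ C * ‖v‖ ^ 2 ∧ ‖fiberDeriv G (q, v)‖ ≤ C * ‖v‖ := by
  obtain ⟨C₁, h1, hC₁⟩ := exists_bound_sphere (f := baseDeriv G)
    (fun q hq v hv => (hG.continuousAt_fderiv_of_ne hq hv).clm_comp continuousAt_const) hK hKU
  obtain ⟨C₂, h2, hC₂⟩ := exists_bound_sphere (f := fiberDeriv G)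
    (fun q hq v hv => (hG.continuousAt_fderiv_of_ne hq hv).clm_comp continuousAt_const) hK hKU
  refine ⟨max C₁ C₂, h1.trans (le_max_left _ _), fun q hq v => ?_⟩
  rcases eq_or_ne v 0 with rfl | hv
  · simp [hG.fiberDeriv_zero (hKU hq), hG.baseDeriv_zero (hKU hq)]
  obtain ⟨c, w, hc, hw, hcv, rfl⟩ := exists_unit_smul hv
  rw [← hcv, hG.baseDeriv_homog (hKU hq) _ hc, hG.fiberDeriv_homog (hKU hq) _ hc, norm_smul,
    norm_smul, norm_pow, Real.norm_of_nonneg hc.le, mul_comm, mul_comm c]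
  exact ⟨mul_le_mul_of_nonneg_right ((hC₁ q hq w hw).trans (le_max_left _ _)) (by positivity),
    mul_le_mul_of_nonneg_right ((hC₂ q hq w hw).trans (le_max_right _ _)) hc.le⟩

/-- Only zero velocities need an argument: there the bounds of `exists_deriv_bounds` force the
differential to tend to zero. Hence `G` is `C^1` across the zero section. -/
lemma continuousAt_fderiv [FiniteDimensional ℝ E] {q : E} (hq : q ∈ U) (v : E) :
    ContinuousAt (fderiv ℝ G) (q, v) := by
  rcases eq_or_ne v 0 with rfl | hv
  swap
  · exact hG.continuousAt_fderiv_of_ne hq hv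
  obtain ⟨K, hKc, hKU, hK⟩ := hG.exists_compact_nhds hq
  obtain ⟨C, hC0, hC⟩ := hG.exists_deriv_bounds hKc hKU
  rw [ContinuousAt, hG.fderiv_zero hq, tendsto_zero_iff_norm_tendsto_zero]
  have hlim : Tendsto (fun z : E × E => C * ‖z.2‖ ^ 2 + C * ‖z.2‖) (𝓝 (q, 0)) (𝓝 0) := by
    have : Continuous fun z : E × E => C * ‖z.2‖ ^ 2 + C * ‖z.2‖ := by fun_prop
    simpa using this.tendsto (q, 0)
  have : ∀ᶠ z : E × E in 𝓝 (q, 0), z.1 ∈ K := continuousAt_fst.eventually hK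
  refine squeeze_zero' (Eventually.of_forall fun _ => norm_nonneg _) ?_ hlim
  filter_upwards [this] with z hz
  refine ContinuousLinearMap.opNorm_le_bound _ (by positivity) fun w => ?_
  rw [fderiv_apply_eq]
  refine (norm_add_le _ _).trans ?_
  rw [add_mul]
  have h1 := (baseDeriv G z).le_opNorm w.1
  have h2 := (fiberDeriv G z).le_opNorm w.2
  have h3 := hC z.1 hz z.2
  exact add_le_add (h1.trans (mul_le_mul h3.1 (norm_fst_le w) (norm_nonneg _) (by positivity)))
    (h2.trans (mul_le_mul h3.2 (norm_snd_le w) (norm_nonneg _) (by positivity)))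

lemma continuousAt_fiberDeriv [FiniteDimensional ℝ E] {q : E} (hq : q ∈ U) (v : E) :
    ContinuousAt (fiberDeriv G) (q, v) :=
  (hG.continuousAt_fderiv hq v).clm_comp continuousAt_const

lemma continuousAt_baseDeriv [FiniteDimensional ℝ E] {q : E} (hq : q ∈ U) (v : E) :
    ContinuousAt (baseDeriv G) (q, v) :=
  (hG.continuousAt_fderiv hq v).clm_comp continuousAt_const

/-- Euler's identity. -/
lemma fiberDeriv_self [FiniteDimensional ℝ E] {q : E} (hq : q ∈ U) (v : E) :
    fiberDeriv G (q, v) v = 2 * G (q, v) := by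
  have h1 : HasDerivAt (fun c : ℝ => (q, c • v)) ((0 : E), (1 : ℝ) • v) 1 :=
    (hasDerivAt_const (1 : ℝ) q).prodMk ((hasDerivAt_id (1 : ℝ)).smul_const v)
  have hd : HasFDerivAt G (fderiv ℝ G (q, v)) (q, (1 : ℝ) • v) := by
    rw [one_smul]; exact (hG.differentiableAt hq v).hasFDerivAt
  have h2 := hd.comp_hasDerivAt (1 : ℝ) h1
  have h3 : HasDerivAt (fun c : ℝ => c ^ 2 * G (q, v)) (2 * G (q, v)) 1 := by
    simpa using (hasDerivAt_pow 2 (1 : ℝ)).mul_const (G (q, v))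
  have h4 : (G ∘ fun c : ℝ => (q, c • v)) =ᶠ[𝓝 1] fun c : ℝ => c ^ 2 * G (q, v) := by
    filter_upwards [lt_mem_nhds (zero_lt_one' ℝ)] with c hc using hG.homog q hq v c hc
  have := h2.unique (h3.congr_of_eventuallyEq h4)
  rw [one_smul] at this
  exact this

lemma hasDerivAt_segment [FiniteDimensional ℝ E] {q : E} (hq : q ∈ U) (v w η : E) {t : ℝ}
    (ht : w + t • (v - w) ≠ 0) :
    HasDerivAt (fun t : ℝ => fiberDeriv G (q, w + t • (v - w)) η)
      (fderiv ℝ (fderiv ℝ G) (q, w + t • (v - w)) (0, v - w) (0, η)) t := by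
  have h1 : HasDerivAt (fun t : ℝ => (q, w + t • (v - w))) ((0 : E), (1 : ℝ) • (v - w)) t :=
    (hasDerivAt_const t q).prodMk (((hasDerivAt_id t).smul_const (v - w)).const_add w)
  have hd : HasFDerivAt (fderiv ℝ G) (fderiv ℝ (fderiv ℝ G) (q, w + t • (v - w)))
      (q, w + t • (v - w)) :=
    ((hG.contDiffAt_fderiv hq ht).differentiableAt (by norm_num)).hasFDerivAt
  have h2 : HasDerivAt (fun t : ℝ => fderiv ℝ G (q, w + t • (v - w)))
      (fderiv ℝ (fderiv ℝ G) (q, w + t • (v - w)) ((0 : E), (1 : ℝ) • (v - w))) t :=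
    HasFDerivAt.comp_hasDerivAt (f := fun t : ℝ => (q, w + t • (v - w))) t hd h1
  have h3 := h2.clm_apply (hasDerivAt_const t ((0 : E), η))
  rw [one_smul, map_zero, add_zero] at h3
  exact h3

lemma continuous_segment [FiniteDimensional ℝ E] {q : E} (hq : q ∈ U) (v w η : E) :
    Continuous (fun t : ℝ => fiberDeriv G (q, w + t • (v - w)) η) := by
  rw [continuous_iff_continuousAt]
  intro t
  have h1 : ContinuousAt (fun t : ℝ => (q, w + t • (v - w))) t := by fun_prop
  exact (ContinuousAt.comp (f := fun t : ℝ => (q, w + t • (v - w)))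
    (hG.continuousAt_fiberDeriv hq _) h1).clm_apply continuousAt_const

/-- The vertical Hessian has a positive minimum over base points in `K` and pairs of unit vectors.
Homogeneity makes this a uniform lower bound, and the mean value inequality along the segment from
`w` to `v` turns it into monotonicity of the momentum. -/
lemma exists_strongMono [FiniteDimensional ℝ E] {K : Set E} (hK : IsCompact K)
    (hKU : K ⊆ U) : ∃ c, 0 < c ∧ ∀ q ∈ K, ∀ v w : E,
      c * ‖v - w‖ ^ 2 ≤ (fiberDeriv G (q, v) - fiberDeriv G (q, w)) (v - w) := by
  have hc : IsCompact (K ×ˢ (Metric.sphere (0 : E) 1 ×ˢ Metric.sphere (0 : E) 1)) :=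
    hK.prod ((isCompact_sphere 0 1).prod (isCompact_sphere 0 1))
  have hne : ∀ v ∈ Metric.sphere (0 : E) 1, v ≠ 0 := by
    rintro v hv rfl; simp at hv
  have hcont : ContinuousOn (fun z : E × E × E =>
      fderiv ℝ (fderiv ℝ G) (z.1, z.2.1) (0, z.2.2) (0, z.2.2))
      (K ×ˢ (Metric.sphere (0 : E) 1 ×ˢ Metric.sphere (0 : E) 1)) := by
    intro z hz
    have h1 : ContinuousAt (fderiv ℝ (fderiv ℝ G)) (z.1, z.2.1) :=
      ((hG.contDiffAt_fderiv (hKU hz.1) (hne _ hz.2.1)).fderiv_right (m := 1)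
        (by norm_num)).continuousAt
    have h2 : ContinuousAt (fun z : E × E × E => (z.1, z.2.1)) z := by fun_prop
    have h3 : ContinuousAt (fun z : E × E × E => ((0 : E), z.2.2)) z := by fun_prop
    exact ((ContinuousAt.clm_apply (ContinuousAt.clm_apply
      (ContinuousAt.comp (f := fun z : E × E × E => (z.1, z.2.1)) h1 h2) h3) h3)).continuousWithinAt
  obtain ⟨c, hc0, hcle⟩ := hc.exists_forall_le' hcont (a := 0)
    (fun z hz => hG.posDef z.1 (hKU hz.1) _ (hne _ hz.2.1) _ (hne _ hz.2.2))
  have hlow : ∀ q ∈ K, ∀ v ≠ 0, ∀ w, c * ‖w‖ ^ 2 ≤ fderiv ℝ (fderiv ℝ G) (q, v) (0, w) (0, w) := by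
    intro q hq v hv w
    rcases eq_or_ne w 0 with rfl | hw
    · have : ((0 : E), (0 : E)) = 0 := rfl
      simp [this]
    obtain ⟨d, v', hd, hv', -, rfl⟩ := exists_unit_smul hv
    obtain ⟨f, w', hf, hw', hfw, rfl⟩ := exists_unit_smul hw
    have hv0 : v' ≠ 0 := fun h => hv (by rw [h, smul_zero])
    rw [hG.fiberHess_homog (hKU hq) hv0 hd, ← hfw]
    have h0 : ((0 : E), f • w') = f • ((0 : E), w') := by simp
    rw [h0, map_smul, map_smul, smul_apply, smul_eq_mul, smul_eq_mul]
    have := hcle (q, v', w') ⟨hq, by simpa using hv', by simpa using hw'⟩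
    simp only at this
    nlinarith [mul_self_nonneg f]
  refine ⟨c, hc0, fun q hq v w => ?_⟩
  rcases eq_or_ne v w with rfl | hvw
  · simp
  obtain ⟨t₀, ht₀⟩ := exists_segment_ne_zero hvw
  have := le_sub_of_hasDerivAt_off (m := c * ‖v - w‖ ^ 2) (t₀ := t₀)
    (hG.continuous_segment (hKU hq) v w (v - w)).continuousOn
    (fun t _ ht => ⟨hG.hasDerivAt_segment (hKU hq) v w (v - w) (ht₀ t ht),
      hlow q hq _ (ht₀ t ht) _⟩)
  simpa using this

lemma exists_fiberDeriv_lipschitz [FiniteDimensional ℝ E] {K : Set E} (hK : IsCompact K)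
    (hKU : K ⊆ U) : ∃ C, 0 ≤ C ∧ ∀ q ∈ K, ∀ v w : E,
      ‖fiberDeriv G (q, v) - fiberDeriv G (q, w)‖ ≤ C * ‖v - w‖ := by
  obtain ⟨C, hC0, hC⟩ := exists_bound_sphere (f := fderiv ℝ (fderiv ℝ G))
    (fun q hq v hv => ((hG.contDiffAt_fderiv hq hv).fderiv_right (m := 1)
        (by norm_num)).continuousAt) hK hKU
  have hup : ∀ q ∈ K, ∀ v ≠ 0, ∀ w η,
      ‖fderiv ℝ (fderiv ℝ G) (q, v) (0, w) (0, η)‖ ≤ C * ‖w‖ * ‖η‖ := by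
    intro q hq v hv w η
    obtain ⟨d, v', hd, hv', -, rfl⟩ := exists_unit_smul hv
    have hv0 : v' ≠ 0 := fun h => hv (by rw [h, smul_zero])
    rw [hG.fiberHess_homog (hKU hq) hv0 hd]
    refine ((fderiv ℝ (fderiv ℝ G) (q, v')).le_opNorm₂ _ _).trans ?_
    have h1 : ∀ w : E, ‖((0 : E), w)‖ = ‖w‖ := fun w => by simp [Prod.norm_def]
    rw [h1, h1]
    gcongr
    exact hC q hq _ hv'
  refine ⟨C, hC0, fun q hq v w => ?_⟩
  rcases eq_or_ne v w with rfl | hvw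
  · simp
  obtain ⟨t₀, ht₀⟩ := exists_segment_ne_zero hvw
  refine ContinuousLinearMap.opNorm_le_bound _ (by positivity) fun η => ?_
  rw [Real.norm_eq_abs, abs_le]
  have hη : ∀ η, -(C * ‖v - w‖ * ‖η‖) ≤
      (fiberDeriv G (q, v) - fiberDeriv G (q, w)) η := by
    intro η
    have := le_sub_of_hasDerivAt_off (m := -(C * ‖v - w‖ * ‖η‖)) (t₀ := t₀)
      (hG.continuous_segment (hKU hq) v w η).continuousOn
      (fun t _ ht => ⟨hG.hasDerivAt_segment (hKU hq) v w η (ht₀ t ht),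
        neg_le_of_abs_le (hup q hq _ (ht₀ t ht) (v - w) η)⟩)
    simpa using this
  refine ⟨hη η, ?_⟩
  -- The lower bound in direction `-η` is the upper bound in direction `η`.
  have := hη (-η)
  rw [map_neg, norm_neg] at this
  linarith

/-- On the compact product of `K` and the unit sphere, local Lipschitz continuity is global even
though `K` need not be convex; homogeneity of degree one supplies the factor `‖v‖`. -/
lemma exists_fiberDeriv_lipschitz_base [FiniteDimensional ℝ E] {K : Set E} (hK : IsCompact K)
    (hKU : K ⊆ U) : ∃ C, 0 ≤ C ∧ ∀ q ∈ K, ∀ q' ∈ K, ∀ v : E,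
      ‖fiberDeriv G (q, v) - fiberDeriv G (q', v)‖ ≤ C * ‖q - q'‖ * ‖v‖ := by
  have hc : IsCompact (K ×ˢ Metric.sphere (0 : E) 1) := hK.prod (isCompact_sphere 0 1)
  have hne : ∀ v ∈ Metric.sphere (0 : E) 1, v ≠ 0 := by
    rintro v hv rfl; simp at hv
  obtain ⟨C, hC⟩ : ∃ C, LipschitzOnWith C (fiberDeriv G) (K ×ˢ Metric.sphere (0 : E) 1) := by
    refine LocallyLipschitzOn.exists_lipschitzOnWith_of_compact hc fun z hz => ?_
    have h1 : ContDiffAt ℝ 1 (fiberDeriv G) z :=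
      ((hG.contDiffAt_fderiv (hKU hz.1) (hne _ hz.2)).of_le (by norm_num)).clm_comp
        contDiffAt_const
    obtain ⟨C, t, ht, hL⟩ := h1.exists_lipschitzOnWith
    exact ⟨C, t, mem_nhdsWithin_of_mem_nhds ht, hL⟩
  refine ⟨C, C.coe_nonneg, fun q hq q' hq' v => ?_⟩
  rcases eq_or_ne v 0 with rfl | hv
  · simp [hG.fiberDeriv_zero (hKU hq), hG.fiberDeriv_zero (hKU hq')]
  obtain ⟨c, w, hc, hw, hcv, rfl⟩ := exists_unit_smul hv
  rw [hG.fiberDeriv_homog (hKU hq) _ hc, hG.fiberDeriv_homog (hKU hq') _ hc,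
    show c • fiberDeriv G (q, w) - c • fiberDeriv G (q', w) =
      c • (fiberDeriv G (q, w) - fiberDeriv G (q', w)) from (smul_sub c _ _).symm,
    norm_smul, ← hcv, Real.norm_of_nonneg hc.le, mul_comm]
  gcongr
  have := hC.dist_le_mul (q, w) ⟨hq, by simpa using hw⟩ (q', w) ⟨hq', by simpa using hw⟩
  rw [dist_eq_norm] at this
  simpa [Prod.dist_eq, dist_eq_norm] using this

end IsLagrangian

end Lagrangian

/-! ### Critical curves of a Lagrangian constrained by an obstacle -/

section Obstacle

/-- The law of `h` is concentrated on `O`, where `f` is continuous, so `f` is almost everywhere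
strongly measurable for that law. -/
lemma aestronglyMeasurable_comp_of_continuousOn {A X Y : Type*} [MeasurableSpace A]
    {μ : Measure A} [NormedAddCommGroup X] [NormedSpace ℝ X] [FiniteDimensional ℝ X]
    [NormedAddCommGroup Y] {f : X → Y} {O : Set X} (hO : IsOpen O) (hf : ContinuousOn f O)
    {h : A → X} (hh : AEStronglyMeasurable h μ) (hmem : ∀ᵐ x ∂μ, h x ∈ O) :
    AEStronglyMeasurable (fun x => f (h x)) μ := by
  have := FiniteDimensional.proper_real X
  borelize X
  have hν : (μ.map h).restrict O = μ.map h := by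
    refine Measure.restrict_eq_self_of_ae_mem ?_
    exact (ae_map_iff hh.aemeasurable hO.measurableSet).2 hmem
  have h1 := hf.aestronglyMeasurable (μ := μ.map h) hO.measurableSet
  rw [hν] at h1
  exact h1.comp_aemeasurable hh.aemeasurable

/-- An `H^1` curve `u` with derivative `g` inside `{φ ≤ 0}` that is critical with respect to the
admissible variations `τ • Y(u)`, `Y` a `C^1` vector field; `N` is a `C^1` vector field transverse to
the obstacle. -/
structure Obstacle (E : Type*) [NormedAddCommGroup E] [NormedSpace ℝ E] where
  U : Set E
  G : E × E → ℝ
  φ : E → ℝ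
  N : E → E
  a : ℝ
  b : ℝ
  u : ℝ → E
  g : ℝ → E
  lagr : IsLagrangian U G
  lt : a < b
  smooth : ContDiffOn ℝ 2 φ U
  prim : PrimitiveOn u g a b
  memLp : MemLp g 2 (volume.restrict (Icc a b))
  mem : ∀ t ∈ Icc a b, u t ∈ U
  nonpos : ∀ t ∈ Icc a b, φ (u t) ≤ 0
  smoothN : ContDiffOn ℝ 1 N U
  normal : ∀ q ∈ U, φ q = 0 → fderiv ℝ φ q (N q) = 1
  critical : ∀ (τ τ' : ℝ → ℝ) (Y : E → E), ContDiffOn ℝ 1 Y U →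
    MemLp τ' 2 (volume.restrict (Icc a b)) → PrimitiveOn τ τ' a b → τ a = 0 → τ b = 0 →
    (∀ s ∈ Icc a b, φ (u s) = 0 → τ s * fderiv ℝ φ (u s) (Y (u s)) ≤ 0) →
    0 ≤ ∫ s in a..b, (τ s * fderiv ℝ G (u s, g s) (Y (u s), fderiv ℝ Y (u s) (g s)) +
      τ' s * fiberDeriv G (u s, g s) (Y (u s)))

variable {E : Type*} [NormedAddCommGroup E] [NormedSpace ℝ E]

/-- The field is the coordinate gradient divided by its squared length `D`. Adding `φ²` to the
denominator keeps it nonzero where `D` vanishes off the obstacle, and changes nothing on the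
obstacle. -/
lemma exists_transverse [FiniteDimensional ℝ E] {U : Set E} (hU : IsOpen U) {φ : E → ℝ}
    (hφ : ContDiffOn ℝ 2 φ U) (hreg : ∀ q ∈ U, φ q = 0 → fderiv ℝ φ q ≠ 0) :
    ∃ N : E → E, ContDiffOn ℝ 1 N U ∧ ∀ q ∈ U, φ q = 0 → fderiv ℝ φ q (N q) = 1 := by
  let e := Module.finBasis ℝ E
  let D : E → ℝ := fun q => ∑ i, (fderiv ℝ φ q (e i)) ^ 2
  have hd : ∀ i, ContDiffOn ℝ 1 (fun q => fderiv ℝ φ q (e i)) U := fun i =>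
    (hφ.fderiv_of_isOpen hU (by norm_num)).clm_apply contDiffOn_const
  have hD : ContDiffOn ℝ 1 D U := ContDiffOn.sum fun i _ => (hd i).pow 2
  have hD0 : ∀ q, 0 ≤ D q := fun q => Finset.sum_nonneg fun i _ => sq_nonneg _
  have hDpos : ∀ q ∈ U, φ q = 0 → D q ≠ 0 := by
    intro q hq h0 h1
    refine hreg q hq h0 ?_
    have := (Finset.sum_eq_zero_iff_of_nonneg fun i _ => sq_nonneg _).1 h1
    have h2 : (fderiv ℝ φ q : E →ₗ[ℝ] ℝ) = 0 := e.ext fun i => by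
      simpa using this i (Finset.mem_univ _)
    ext x
    exact DFunLike.congr_fun h2 x
  refine ⟨fun q => (D q + φ q ^ 2)⁻¹ • ∑ i, fderiv ℝ φ q (e i) • e i, ?_, ?_⟩
  · refine ContDiffOn.smul (ContDiffOn.inv (hD.add ((hφ.of_le (by norm_num)).pow 2)) ?_)
      (ContDiffOn.sum fun i _ => (hd i).smul contDiffOn_const)
    intro q hq h
    have h1 : φ q ^ 2 = 0 := by nlinarith [hD0 q, sq_nonneg (φ q)]
    exact hDpos q hq (by simpa using h1) (by linarith)
  · intro q hq h0
    simp only []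
    rw [h0, map_smul, map_sum]
    have : ∑ i, fderiv ℝ φ q (fderiv ℝ φ q (e i) • e i) = D q :=
      Finset.sum_congr rfl fun i _ => by rw [map_smul, smul_eq_mul, sq]
    rw [this]
    simp [hDpos q hq h0]

namespace Obstacle

variable (O : Obstacle E)

/-- The conormal `dφ` along the curve. -/
noncomputable def n (s : ℝ) : E →L[ℝ] ℝ := fderiv ℝ O.φ (O.u s)

/-- The momentum. -/
noncomputable def p (s : ℝ) : E →L[ℝ] ℝ := fiberDeriv O.G (O.u s, O.g s)

/-- The force. -/
noncomputable def F (s : ℝ) : E →L[ℝ] ℝ := baseDeriv O.G (O.u s, O.g s)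

/-- The transverse component of the momentum. -/
noncomputable def B (s : ℝ) : ℝ := O.p s (O.N (O.u s))

/-- The tangential component of the momentum. -/
noncomputable def w (s : ℝ) : E →L[ℝ] ℝ := O.p s - O.B s • O.n s

/-- The derivative of the vector field `N` along the curve. -/
noncomputable def dN (s : ℝ) : E := fderiv ℝ O.N (O.u s) (O.g s)

/-- The derivative of the conormal along the curve. -/
noncomputable def dn (s : ℝ) : E →L[ℝ] ℝ := fderiv ℝ (fderiv ℝ O.φ) (O.u s) (O.g s)

/-- The derivative of the transverse momentum in the absence of reaction. -/
noncomputable def αN (s : ℝ) : ℝ := O.F s (O.N (O.u s)) + O.p s (O.dN s)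

/-- The derivative of the tangential momentum. -/
noncomputable def α (s : ℝ) : E →L[ℝ] ℝ :=
  O.F s - O.αN s • O.n s - O.B s • O.dn s

lemma isOpen : IsOpen O.U := O.lagr.isOpen

lemma continuousOn_u : ContinuousOn O.u (Icc O.a O.b) := O.prim.continuousOn

lemma contDiffOn_dφ : ContDiffOn ℝ 1 (fderiv ℝ O.φ) O.U :=
  O.smooth.fderiv_of_isOpen O.isOpen (by norm_num)

lemma continuousOn_comp {Y : Type*} [TopologicalSpace Y] {f : E → Y} (hf : ContinuousOn f O.U) :
    ContinuousOn (fun s => f (O.u s)) (Icc O.a O.b) := hf.comp O.continuousOn_u O.mem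

lemma continuousOn_n : ContinuousOn O.n (Icc O.a O.b) :=
  O.continuousOn_comp O.contDiffOn_dφ.continuousOn

lemma continuousOn_N : ContinuousOn (fun s => O.N (O.u s)) (Icc O.a O.b) :=
  O.continuousOn_comp O.smoothN.continuousOn

lemma continuousOn_DN : ContinuousOn (fun s => fderiv ℝ O.N (O.u s)) (Icc O.a O.b) :=
  O.continuousOn_comp (O.smoothN.continuousOn_fderiv_of_isOpen O.isOpen le_rfl)

lemma continuousOn_Dn : ContinuousOn (fun s => fderiv ℝ (fderiv ℝ O.φ) (O.u s)) (Icc O.a O.b) :=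
  O.continuousOn_comp (O.contDiffOn_dφ.continuousOn_fderiv_of_isOpen O.isOpen le_rfl)

lemma aesm_g : AEStronglyMeasurable O.g (volume.restrict (Icc O.a O.b)) :=
  O.memLp.aestronglyMeasurable

lemma integrable_g : IntegrableOn O.g (Icc O.a O.b) := O.prim.1

lemma integrable_sq : IntegrableOn (fun s => ‖O.g s‖ ^ 2) (Icc O.a O.b) :=
  O.memLp.integrable_norm_pow (by norm_num)

section FiniteDim

variable [FiniteDimensional ℝ E]

lemma n_primitiveOn : PrimitiveOn O.n O.dn O.a O.b := by
  have := FiniteDimensional.complete ℝ E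
  exact O.prim.comp O.isOpen O.contDiffOn_dφ O.mem

lemma φ_primitiveOn : PrimitiveOn (fun s => O.φ (O.u s)) (fun s => O.n s (O.g s)) O.a O.b := by
  have := FiniteDimensional.complete ℝ E
  exact O.prim.comp O.isOpen (O.smooth.of_le (by norm_num)) O.mem

lemma aesm_comp {Y : Type*} [NormedAddCommGroup Y] {f : E × E → Y}
    (hf : ∀ q ∈ O.U, ∀ v, ContinuousAt f (q, v)) :
    AEStronglyMeasurable (fun s => f (O.u s, O.g s)) (volume.restrict (Icc O.a O.b)) := by
  refine aestronglyMeasurable_comp_of_continuousOn (O := O.U ×ˢ univ)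
    (O.isOpen.prod isOpen_univ) (fun z hz => (hf z.1 hz.1 z.2).continuousWithinAt)
    ((O.continuousOn_u.aestronglyMeasurable measurableSet_Icc).prodMk O.aesm_g) ?_
  filter_upwards [ae_restrict_mem measurableSet_Icc] with s hs
  exact ⟨O.mem s hs, mem_univ _⟩

lemma aesm_p : AEStronglyMeasurable O.p (volume.restrict (Icc O.a O.b)) :=
  O.aesm_comp fun _ hq v => O.lagr.continuousAt_fiberDeriv hq v

lemma aesm_F : AEStronglyMeasurable O.F (volume.restrict (Icc O.a O.b)) :=
  O.aesm_comp fun _ hq v => O.lagr.continuousAt_baseDeriv hq v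

omit [FiniteDimensional ℝ E] in
lemma aesm_apply {Y : Type*} [NormedAddCommGroup Y] [NormedSpace ℝ Y] {f : ℝ → E →L[ℝ] Y}
    {v : ℝ → E} (hf : AEStronglyMeasurable f (volume.restrict (Icc O.a O.b)))
    (hv : AEStronglyMeasurable v (volume.restrict (Icc O.a O.b))) :
    AEStronglyMeasurable (fun s => f s (v s)) (volume.restrict (Icc O.a O.b)) :=
  (ContinuousLinearMap.id ℝ (E →L[ℝ] Y)).aestronglyMeasurable_comp₂ hf hv

lemma aesm_B : AEStronglyMeasurable O.B (volume.restrict (Icc O.a O.b)) :=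
  O.aesm_apply O.aesm_p (O.continuousOn_N.aestronglyMeasurable measurableSet_Icc)

lemma aesm_n : AEStronglyMeasurable O.n (volume.restrict (Icc O.a O.b)) := by
  exact O.continuousOn_n.aestronglyMeasurable measurableSet_Icc

lemma aesm_w : AEStronglyMeasurable O.w (volume.restrict (Icc O.a O.b)) :=
  O.aesm_p.sub (O.aesm_B.smul O.aesm_n)

lemma aesm_αN : AEStronglyMeasurable O.αN (volume.restrict (Icc O.a O.b)) :=
  (O.aesm_apply O.aesm_F (O.continuousOn_N.aestronglyMeasurable measurableSet_Icc)).add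
    (O.aesm_apply O.aesm_p (O.aesm_apply
      (O.continuousOn_DN.aestronglyMeasurable measurableSet_Icc) O.aesm_g))

lemma aesm_α : AEStronglyMeasurable O.α (volume.restrict (Icc O.a O.b)) :=
  (O.aesm_F.sub (O.aesm_αN.smul O.aesm_n)).sub (O.aesm_B.smul (O.aesm_apply
      (O.continuousOn_Dn.aestronglyMeasurable measurableSet_Icc) O.aesm_g))

/-- The coefficients are continuous along the compact curve, the momentum grows linearly and the
force quadratically with the velocity. For an `H^1` curve this makes all the quantities integrable.
-/
lemma exists_bounds : ∃ C, 1 ≤ C ∧ ∀ s ∈ Icc O.a O.b,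
    ‖O.n s‖ ≤ C ∧ ‖O.N (O.u s)‖ ≤ C ∧ ‖O.dn s‖ ≤ C * ‖O.g s‖ ∧ ‖O.p s‖ ≤ C * ‖O.g s‖ ∧
    ‖O.B s‖ ≤ C * ‖O.g s‖ ∧ ‖O.w s‖ ≤ C * ‖O.g s‖ ∧
    ‖O.αN s‖ ≤ C * ‖O.g s‖ ^ 2 ∧ ‖O.α s‖ ≤ C * ‖O.g s‖ ^ 2 := by
  obtain ⟨C₁, h1⟩ := isCompact_Icc.exists_bound_of_continuousOn O.continuousOn_n
  obtain ⟨C₂, h2⟩ := isCompact_Icc.exists_bound_of_continuousOn O.continuousOn_N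
  obtain ⟨C₃, h3⟩ := isCompact_Icc.exists_bound_of_continuousOn (E := E →L[ℝ] E →L[ℝ] ℝ)
    O.continuousOn_Dn
  obtain ⟨C₄, h4⟩ := isCompact_Icc.exists_bound_of_continuousOn O.continuousOn_DN
  obtain ⟨C₅, h50, h5⟩ := O.lagr.exists_deriv_bounds
    (isCompact_Icc.image_of_continuousOn O.continuousOn_u)
    (by rintro _ ⟨t, ht, rfl⟩; exact O.mem t ht)
  obtain ⟨M, hM1, hM⟩ : ∃ M, 1 ≤ M ∧ (C₁ ≤ M ∧ C₂ ≤ M ∧ C₃ ≤ M ∧ C₄ ≤ M ∧ C₅ ≤ M) := by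
    refine ⟨1 + |C₁| + |C₂| + |C₃| + |C₄| + |C₅|, ?_, ?_, ?_, ?_, ?_, ?_⟩ <;>
      linarith [abs_nonneg C₁, abs_nonneg C₂, abs_nonneg C₃, abs_nonneg C₄, abs_nonneg C₅,
        le_abs_self C₁, le_abs_self C₂, le_abs_self C₃, le_abs_self C₄, le_abs_self C₅]
  have hM0 : 0 ≤ M := by linarith
  have M2 : M ≤ M ^ 2 := by nlinarith
  have M3 : M ^ 2 ≤ M ^ 3 := by nlinarith [sq_nonneg M]
  have M4 : M ^ 3 ≤ M ^ 4 := by nlinarith [pow_nonneg hM0 3]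
  -- A generous common constant: as `M ≥ 1`, the worst case `M + 2M³ + M³`, for `α`, is at most
  -- `4M⁴`.
  refine ⟨10 * M ^ 4, by nlinarith, fun s hs => ?_⟩
  set x := ‖O.g s‖ with hx
  have hx0 : 0 ≤ x := norm_nonneg _
  have hn : ‖O.n s‖ ≤ M := (h1 s hs).trans hM.1
  have hN : ‖O.N (O.u s)‖ ≤ M := (h2 s hs).trans hM.2.1
  have hdn : ‖O.dn s‖ ≤ M * x := (ContinuousLinearMap.le_opNorm _ _).trans
    (mul_le_mul_of_nonneg_right ((h3 s hs).trans hM.2.2.1) hx0)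
  have hdN : ‖O.dN s‖ ≤ M * x := (ContinuousLinearMap.le_opNorm _ _).trans
    (mul_le_mul_of_nonneg_right ((h4 s hs).trans hM.2.2.2.1) hx0)
  have h5' := h5 (O.u s) (mem_image_of_mem _ hs) (O.g s)
  have hF : ‖O.F s‖ ≤ M * x ^ 2 := h5'.1.trans
    (mul_le_mul_of_nonneg_right hM.2.2.2.2 (by positivity))
  have hp : ‖O.p s‖ ≤ M * x := h5'.2.trans
    (mul_le_mul_of_nonneg_right hM.2.2.2.2 (by positivity))
  have hB : ‖O.B s‖ ≤ M ^ 2 * x := ((O.p s).le_opNorm _).trans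
    ((mul_le_mul hp hN (norm_nonneg _) (by positivity)).trans (le_of_eq (by ring)))
  have hw : ‖O.w s‖ ≤ M * x + M ^ 3 * x := (norm_sub_le _ _).trans (add_le_add hp
    ((norm_smul_le _ _).trans
      ((mul_le_mul hB hn (norm_nonneg _) (by positivity)).trans (le_of_eq (by ring)))))
  have hαN : ‖O.αN s‖ ≤ 2 * M ^ 2 * x ^ 2 := by
    refine (norm_add_le _ _).trans ?_
    have e1 := ((O.F s).le_opNorm (O.N (O.u s))).trans
      (mul_le_mul hF hN (norm_nonneg _) (by positivity))
    have e2 := ((O.p s).le_opNorm (O.dN s)).trans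
      (mul_le_mul hp hdN (norm_nonneg _) (by positivity))
    calc _ ≤ _ := add_le_add e1 e2
      _ = _ := by ring
  have hα : ‖O.α s‖ ≤ M * x ^ 2 + 2 * M ^ 3 * x ^ 2 + M ^ 3 * x ^ 2 := by
    refine (norm_sub_le _ _).trans (add_le_add ((norm_sub_le _ _).trans (add_le_add hF ?_)) ?_)
    · exact (norm_smul_le _ _).trans
        ((mul_le_mul hαN hn (norm_nonneg _) (by positivity)).trans (le_of_eq (by ring)))
    · exact (norm_smul_le _ _).trans
        ((mul_le_mul hB hdn (norm_nonneg _) (by positivity)).trans (le_of_eq (by ring)))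
  have hx2 : 0 ≤ x ^ 2 := sq_nonneg x
  have k1 : M * x ≤ M ^ 4 * x := mul_le_mul_of_nonneg_right (by linarith) hx0
  have k2 : M ^ 2 * x ≤ M ^ 4 * x := mul_le_mul_of_nonneg_right (by linarith) hx0
  have k3 : M ^ 3 * x ≤ M ^ 4 * x := mul_le_mul_of_nonneg_right (by linarith) hx0
  have l1 : M * x ^ 2 ≤ M ^ 4 * x ^ 2 := mul_le_mul_of_nonneg_right (by linarith) hx2
  have l2 : M ^ 2 * x ^ 2 ≤ M ^ 4 * x ^ 2 := mul_le_mul_of_nonneg_right (by linarith) hx2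
  have l3 : M ^ 3 * x ^ 2 ≤ M ^ 4 * x ^ 2 := mul_le_mul_of_nonneg_right (by linarith) hx2
  have k0 : 0 ≤ M * x := by positivity
  have l0 : 0 ≤ M * x ^ 2 := by positivity
  refine ⟨by linarith, by linarith, by linarith, by linarith, by linarith, by linarith,
    by linarith, by linarith⟩

lemma integrable_B : IntegrableOn O.B (Icc O.a O.b) := by
  obtain ⟨C, -, hC⟩ := O.exists_bounds
  exact (O.integrable_g.norm.const_mul C).mono' O.aesm_B
    ((ae_restrict_mem measurableSet_Icc).mono fun s hs => (hC s hs).2.2.2.2.1)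

lemma integrable_w : IntegrableOn O.w (Icc O.a O.b) := by
  obtain ⟨C, -, hC⟩ := O.exists_bounds
  exact (O.integrable_g.norm.const_mul C).mono' O.aesm_w
    ((ae_restrict_mem measurableSet_Icc).mono fun s hs => (hC s hs).2.2.2.2.2.1)

lemma integrable_αN : IntegrableOn O.αN (Icc O.a O.b) := by
  obtain ⟨C, -, hC⟩ := O.exists_bounds
  exact (O.integrable_sq.const_mul C).mono' O.aesm_αN
    ((ae_restrict_mem measurableSet_Icc).mono fun s hs => (hC s hs).2.2.2.2.2.2.1)

lemma integrable_α : IntegrableOn O.α (Icc O.a O.b) := by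
  obtain ⟨C, -, hC⟩ := O.exists_bounds
  exact (O.integrable_sq.const_mul C).mono' O.aesm_α
    ((ae_restrict_mem measurableSet_Icc).mono fun s hs => (hC s hs).2.2.2.2.2.2.2)

omit [FiniteDimensional ℝ E] in
lemma ae_hasDerivAt_integral {V : Type*} [NormedAddCommGroup V] [NormedSpace ℝ V]
    [CompleteSpace V] {f : ℝ → V} (hf : IntegrableOn f (Icc O.a O.b)) :
    ∀ᵐ s, s ∈ Ioo O.a O.b → HasDerivAt (fun t => ∫ r in O.a..t, f r) (f s) s := by
  simpa using (PrimitiveOn.of_integral hf 0).ae_hasDerivAt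

/-- The common Lebesgue points of the functions attached to the curve. -/
def good : Set ℝ := {s | s ∈ Ioo O.a O.b ∧ HasDerivAt O.u (O.g s) s ∧
  HasDerivAt (fun t => ∫ r in O.a..t, O.w r) (O.w s) s ∧
  HasDerivAt (fun t => ∫ r in O.a..t, O.B r) (O.B s) s ∧
  HasDerivAt (fun t => ∫ r in O.a..t, O.α r) (O.α s) s ∧
  HasDerivAt (fun t => ∫ r in O.a..t, O.αN r) (O.αN s) s}

lemma ae_good : ∀ᵐ s, s ∈ Ioo O.a O.b → s ∈ O.good := by
  have := FiniteDimensional.complete ℝ E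
  filter_upwards [O.prim.ae_hasDerivAt, O.ae_hasDerivAt_integral O.integrable_w,
    O.ae_hasDerivAt_integral O.integrable_B, O.ae_hasDerivAt_integral O.integrable_α,
    O.ae_hasDerivAt_integral O.integrable_αN] with s h1 h2 h3 h4 h5 hs
  exact ⟨hs, h1 hs, h2 hs, h3 hs, h4 hs, h5 hs⟩

/-- The reaction of the obstacle up to time `s`, at Lebesgue points. -/
noncomputable def m (s : ℝ) : ℝ := O.B s - ∫ r in O.a..s, O.αN r

omit [FiniteDimensional ℝ E] in
lemma intervalIntegrable {V : Type*} [NormedAddCommGroup V] {f : ℝ → V}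
    (hf : IntegrableOn f (Icc O.a O.b)) {s t : ℝ} (hs : s ∈ Icc O.a O.b) (ht : t ∈ Icc O.a O.b) :
    IntervalIntegrable f volume s t :=
  (hf.mono_set (uIcc_subset_Icc hs ht)).intervalIntegrable

lemma m_sub {s t : ℝ} (hs : s ∈ Icc O.a O.b) (ht : t ∈ Icc O.a O.b) :
    O.m t - O.m s = O.B t - O.B s - ∫ r in s..t, O.αN r := by
  have ha : O.a ∈ Icc O.a O.b := left_mem_Icc.2 O.lt.le
  rw [← intervalIntegral.integral_interval_sub_left (O.intervalIntegrable O.integrable_αN ha ht)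
    (O.intervalIntegrable O.integrable_αN ha hs), m, m]
  ring

-- Criticality is tested on the trapezoid times `Y`. The trapezoid is supported in `[s, t + ε]`, so
-- the sign of `dφ(Y)` matters only at contacts in that interval.
omit [FiniteDimensional ℝ E] in
lemma test_le {s t : ℝ} (hs : s ∈ Ioo O.a O.b) (ht : t ∈ Ioo O.a O.b) (hst : s < t)
    {Y : E → E} (hY : ContDiffOn ℝ 1 Y O.U) {α β : ℝ → ℝ} (hα : IntegrableOn α (Icc O.a O.b))
    (hβ : IntegrableOn β (Icc O.a O.b))
    (hsd : HasDerivAt (fun t => ∫ x in O.a..t, β x) (β s) s)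
    (htd : HasDerivAt (fun t => ∫ x in O.a..t, β x) (β t) t)
    (hαY : ∀ r ∈ Icc O.a O.b,
      fderiv ℝ O.G (O.u r, O.g r) (Y (O.u r), fderiv ℝ Y (O.u r) (O.g r)) = α r)
    (hβY : ∀ r ∈ Icc O.a O.b, O.p r (Y (O.u r)) = β r)
    (H : ∀ᶠ ε in 𝓝[>] (0 : ℝ), ∀ r ∈ Icc s (t + ε), r ∈ Icc O.a O.b → O.φ (O.u r) = 0 →
      O.n r (Y (O.u r)) ≤ 0) :
    β t - β s ≤ ∫ r in s..t, α r := by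
  refine sub_le_integral_of_trapezoid hα hβ hs ht hst hsd htd ?_
  have hlt : ∀ᶠ ε in 𝓝[>] (0 : ℝ), ε < O.b - t :=
    mem_nhdsWithin_of_mem_nhds (Iio_mem_nhds (by linarith [ht.2]))
  filter_upwards [H, hlt, self_mem_nhdsWithin] with ε hH hε hε0
  have hε0 : 0 < ε := hε0
  have := O.critical _ _ Y hY (trapezoidDeriv_memLp s t ε 2 _ _)
    (trapezoid_primitiveOn hε0 O.a O.b) (trapezoid_of_le hε0 hst.le hs.1.le)
    (trapezoid_of_ge hε0 hst.le (by linarith)) (fun r hr hr0 => by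
      by_cases h : r ∈ Icc s (t + ε)
      · exact mul_nonpos_of_nonneg_of_nonpos (trapezoid_nonneg hε0 hst.le r) (hH r h hr hr0)
      · have : trapezoid s t ε r = 0 := by
          rw [mem_Icc, not_and_or, not_le, not_le] at h
          rcases h with h | h
          exacts [trapezoid_of_le hε0 hst.le h.le, trapezoid_of_ge hε0 hst.le h.le]
        rw [this, zero_mul])
  refine this.trans (le_of_eq (intervalIntegral.integral_congr fun r hr => ?_))
  rw [uIcc_of_le O.lt.le] at hr
  have h2 := hβY r hr
  rw [p] at h2
  simp only [hαY r hr, h2]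

omit [FiniteDimensional ℝ E] in
lemma fderiv_test (e : E) {q : E} (hq : q ∈ O.U) (v : E) :
    fderiv ℝ (fun q => e - fderiv ℝ O.φ q e • O.N q) q v =
      -(fderiv ℝ (fderiv ℝ O.φ) q v e • O.N q) - fderiv ℝ O.φ q e • fderiv ℝ O.N q v := by
  have h1 : HasFDerivAt (fderiv ℝ O.φ) (fderiv ℝ (fderiv ℝ O.φ) q) q :=
    ((O.contDiffOn_dφ.contDiffAt (O.isOpen.mem_nhds hq)).differentiableAt
      one_ne_zero).hasFDerivAt
  have h2 : HasFDerivAt O.N (fderiv ℝ O.N q) q :=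
    ((O.smoothN.contDiffAt (O.isOpen.mem_nhds hq)).differentiableAt one_ne_zero).hasFDerivAt
  have h3 := ((h1.clm_apply (hasFDerivAt_const e q)).smul h2).const_sub e
  have h4 : HasFDerivAt (fun q => e - fderiv ℝ O.φ q e • O.N q) _ q := h3
  rw [h4.fderiv]
  simp
  abel

-- This is the projection of the constant field `e` along `N`: it is annihilated by `dφ` at
-- contacts, and it is `C^1` because `φ` is `C^2`.
omit [FiniteDimensional ℝ E] in
lemma contDiffOn_test (e : E) :
    ContDiffOn ℝ 1 (fun q => e - fderiv ℝ O.φ q e • O.N q) O.U :=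
  contDiffOn_const.sub ((O.contDiffOn_dφ.clm_apply contDiffOn_const).smul O.smoothN)

/-- The test field is the projection of `e` along `N`. Its pairing with the momentum is `w e`, and
being tangent at contacts it is admissible for `e` and for `-e`, which later yields equality. -/
lemma w_sub_le {s t : ℝ} (hs : s ∈ O.good) (ht : t ∈ O.good) (hst : s < t) (e : E) :
    (O.w t - O.w s) e ≤ (∫ r in s..t, O.α r) e := by
  have := FiniteDimensional.complete ℝ E
  have hev : ∀ {r}, HasDerivAt (fun t => ∫ r in O.a..t, O.w r) (O.w r) r → r ∈ Ioo O.a O.b →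
      HasDerivAt (fun t => ∫ r in O.a..t, O.w r e) (O.w r e) r := by
    intro r hr hr'
    have h1 := hr.clm_apply (hasDerivAt_const r e)
    simp only [map_zero, add_zero] at h1
    refine h1.congr_of_eventuallyEq ?_
    filter_upwards [Ioo_mem_nhds hr'.1 hr'.2] with x hx
    exact (ContinuousLinearMap.intervalIntegral_apply (O.intervalIntegrable O.integrable_w
      (left_mem_Icc.2 O.lt.le) (Ioo_subset_Icc_self hx)) e).symm
  have h := O.test_le hs.1 ht.1 hst (O.contDiffOn_test e)
    (α := fun r => O.α r e) (β := fun r => O.w r e)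
    (O.integrable_α.apply_continuousLinearMap e) (O.integrable_w.apply_continuousLinearMap e)
    (hev hs.2.2.1 hs.1) (hev ht.2.2.1 ht.1) (fun r hr => ?_) (fun r hr => ?_)
    (Eventually.of_forall fun ε r _ hr h0 => ?_)
  · rwa [← ContinuousLinearMap.intervalIntegral_apply (O.intervalIntegrable O.integrable_α
      (Ioo_subset_Icc_self hs.1) (Ioo_subset_Icc_self ht.1))] at h
  · rw [O.fderiv_test e (O.mem r hr), fderiv_apply_eq]
    simp only [α, αN, F, B, p, n, dn, dN, map_sub, map_neg, map_smul, sub_apply, smul_apply,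
      smul_eq_mul]
    ring
  · simp only [w, B, n, map_sub, map_smul, smul_eq_mul, sub_apply, smul_apply]
    ring
  · have h1 := O.normal _ (O.mem r hr) h0
    simp only [n, map_sub, map_smul, h1, smul_eq_mul, mul_one, sub_self, le_refl]

/-- The tangential momentum is a primitive. -/
lemma w_sub {s t : ℝ} (hs : s ∈ O.good) (ht : t ∈ O.good) (hst : s < t) :
    O.w t - O.w s = ∫ r in s..t, O.α r := by
  ext e
  refine le_antisymm (O.w_sub_le hs ht hst e) ?_
  have := O.w_sub_le hs ht hst (-e)
  rw [map_neg, map_neg] at this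
  linarith

/-- The obstacle only pushes inwards. -/
lemma m_mono {s t : ℝ} (hs : s ∈ O.good) (ht : t ∈ O.good) (hst : s ≤ t) : O.m s ≤ O.m t := by
  rcases hst.eq_or_lt with rfl | hst
  · exact le_rfl
  have hneg : ∀ {r}, HasDerivAt (fun t => ∫ r in O.a..t, O.B r) (O.B r) r →
      HasDerivAt (fun t => ∫ r in O.a..t, -O.B r) (-O.B r) r := by
    intro r hr
    simp only [intervalIntegral.integral_neg]
    exact hr.neg
  -- The field `-N` is admissible because `dφ(-N) = -1` at every contact.
  have h := O.test_le hs.1 ht.1 hst (Y := fun q => -O.N q) O.smoothN.neg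
    (α := fun r => -O.αN r) (β := fun r => -O.B r) O.integrable_αN.neg O.integrable_B.neg
    (hneg hs.2.2.2.1) (hneg ht.2.2.2.1) (fun r hr => ?_) (fun r hr => ?_)
    (Eventually.of_forall fun ε r _ hr h0 => ?_)
  · rw [intervalIntegral.integral_neg] at h
    have := O.m_sub (Ioo_subset_Icc_self hs.1) (Ioo_subset_Icc_self ht.1)
    linarith
  · rw [fderiv_fun_neg, fderiv_apply_eq]
    simp only [αN, F, p, dN, map_neg, neg_apply]
    ring
  · simp only [B, map_neg]
  · have h1 := O.normal _ (O.mem r hr) h0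
    simp only [n, map_neg, h1]
    norm_num

/-- The obstacle does not react away from the contact set. -/
lemma m_eq {s t : ℝ} (hs : s ∈ O.good) (ht : t ∈ O.good) (hst : s ≤ t)
    (hC : ∀ r ∈ Icc s t, O.φ (O.u r) ≠ 0) : O.m s = O.m t := by
  rcases hst.eq_or_lt with rfl | hst
  · rfl
  refine le_antisymm (O.m_mono hs ht hst.le) ?_
  -- Without contacts `N` itself is admissible and gives the reverse inequality. Continuity at `t`
  -- leaves room for the descending side of the trapezoid, on `[t, t + ε]`.
  have hcont : ContinuousAt (fun r => O.φ (O.u r)) t :=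
    (O.continuousOn_comp O.smooth.continuousOn).continuousAt (Icc_mem_nhds ht.1.1 ht.1.2)
  have hne := hcont.eventually_ne (hC t ⟨hst.le, le_rfl⟩)
  obtain ⟨δ, hδ, hball⟩ := Metric.eventually_nhds_iff.1 hne
  have h := O.test_le hs.1 ht.1 hst O.smoothN O.integrable_αN O.integrable_B hs.2.2.2.1
    ht.2.2.2.1 (fun r hr => ?_) (fun r hr => rfl) ?_
  · have := O.m_sub (Ioo_subset_Icc_self hs.1) (Ioo_subset_Icc_self ht.1)
    linarith
  · rw [fderiv_apply_eq]; rfl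
  · have hlt : ∀ᶠ ε in 𝓝[>] (0 : ℝ), ε < δ := mem_nhdsWithin_of_mem_nhds (Iio_mem_nhds hδ)
    filter_upwards [hlt] with ε hε r hr _ h0
    exfalso
    rcases le_total r t with h1 | h1
    · exact hC r ⟨hr.1, h1⟩ h0
    · exact hball (y := r) (by rw [Real.dist_eq, abs_of_nonneg] <;> linarith [hr.2]) h0

end FiniteDim

end Obstacle

end Obstacle

/-! ### Estimates for the velocity and the reaction between two times -/

section ObstacleEstimates

/-- Otherwise `f` would be negative almost everywhere, with negative integral. The set `S` of full
measure allows the point to be taken among the Lebesgue points. -/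
lemma exists_mem_nonneg_of_integral_nonneg {f : ℝ → ℝ} {a b : ℝ} (hab : a < b)
    (hf : IntervalIntegrable f volume a b) (h : 0 ≤ ∫ x in a..b, f x) {S : Set ℝ}
    (hS : ∀ᵐ x, x ∈ Ioo a b → x ∈ S) : ∃ x ∈ S ∩ Ioo a b, 0 ≤ f x := by
  by_contra hcon
  push Not at hcon
  have hneg : ∀ᵐ x ∂(volume.restrict (Ioo a b)), f x < 0 := by
    rw [ae_restrict_iff' measurableSet_Ioo]
    filter_upwards [hS] with x hx hx' using hcon x ⟨hx hx', hx'⟩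
  rw [intervalIntegral.integral_of_le hab.le, integral_Ioc_eq_integral_Ioo] at h
  have hfi : Integrable f (volume.restrict (Ioo a b)) :=
    ((intervalIntegrable_iff_integrableOn_Ioo_of_le hab.le).1 hf)
  have h0 : ∫ x in Ioo a b, (-f) x = 0 := by
    refine le_antisymm (by simp only [Pi.neg_apply]; rw [integral_neg]; linarith) (integral_nonneg_of_ae ?_)
    filter_upwards [hneg] with x hx
    simpa using hx.le
  rw [integral_eq_zero_iff_of_nonneg_ae (by filter_upwards [hneg] with x hx; simpa using hx.le)
    hfi.neg] at h0
  have hF : ∀ᵐ x ∂(volume.restrict (Ioo a b)), False := by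
    filter_upwards [hneg, h0] with x h1 h2
    simp only [Pi.zero_apply, Pi.neg_apply] at h2
    linarith
  rw [ae_iff] at hF
  simp at hF
  linarith

/-- With `κ = C / c`, the inequality `D > (κ + 1)δ` would give `D² > κδD + δD ≥ κδ(D + δ)`. -/
lemma le_of_sq_le {c C D δ : ℝ} (hc : 0 < c) (hC : 0 ≤ C) (hδ : 0 ≤ δ)
    (h : c * D ^ 2 ≤ C * δ * (D + δ)) : D ≤ (C / c + 1) * δ := by
  have hC' : c * (C / c) = C := by field_simp
  set κ := C / c
  have hκ : 0 ≤ κ := div_nonneg hC hc.le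
  by_contra hcon
  push Not at hcon
  have h0 : 0 ≤ (κ + 1) * δ := by positivity
  have hD : 0 < D := h0.trans_lt hcon
  have h1 : D ^ 2 ≤ κ * δ * (D + δ) := by
    rw [← hC'] at h
    have : c * D ^ 2 ≤ c * (κ * δ * (D + δ)) := by linarith
    exact le_of_mul_le_mul_left this hc
  have hδD : δ ≤ D := by nlinarith
  nlinarith [mul_le_mul_of_nonneg_right hcon.le hδ, mul_lt_mul_of_pos_right hcon hD]

namespace Obstacle

variable {E : Type*} [NormedAddCommGroup E] [NormedSpace ℝ E] [FiniteDimensional ℝ E]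
  (O : Obstacle E)

lemma norm_integral_le {V : Type*} [NormedAddCommGroup V] [NormedSpace ℝ V] {f : ℝ → V}
    {s t M : ℝ} (hst : s ≤ t) (hs : O.a ≤ s) (ht : t ≤ O.b)
    (hf : ∀ r ∈ O.good ∩ Ioo s t, ‖f r‖ ≤ M) : ‖∫ r in s..t, f r‖ ≤ M * (t - s) := by
  have hne : ∀ᵐ x : ℝ, x ≠ t := by simp [ae_iff, measure_singleton]
  have := intervalIntegral.norm_integral_le_of_norm_le_const_ae (a := s) (b := t) (f := f)
    (C := M) (by
      filter_upwards [O.ae_good, hne] with x hx hxt hx'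
      rw [uIoc_of_le hst] at hx'
      have h2 : x ∈ Ioo s t := ⟨hx'.1, lt_of_le_of_ne hx'.2 hxt⟩
      exact hf x ⟨hx ⟨hs.trans_lt h2.1, h2.2.trans_le ht⟩, h2⟩)
  rwa [abs_of_nonneg (by linarith)] at this

omit [FiniteDimensional ℝ E] in
lemma compact_image : IsCompact (O.u '' Icc O.a O.b) :=
  isCompact_Icc.image_of_continuousOn O.continuousOn_u

omit [FiniteDimensional ℝ E] in
lemma image_subset : O.u '' Icc O.a O.b ⊆ O.U := by
  rintro _ ⟨t, ht, rfl⟩; exact O.mem t ht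

/-- Lipschitz estimates in terms of a bound on the velocity, up to the reaction of the obstacle. -/
lemma exists_estimates {c d R : ℝ} (hR : 0 ≤ R)
    (hg : ∀ s ∈ O.good ∩ Ioo c d, ‖O.g s‖ ≤ R) :
    ∃ κ C, 0 < κ ∧ 0 ≤ C ∧ ∀ s ∈ O.good ∩ Ioo c d, ∀ t ∈ O.good ∩ Ioo c d, s < t →
      ‖O.n s‖ ≤ C ∧ ‖O.N (O.u s)‖ ≤ C ∧
      ‖O.n t - O.n s‖ ≤ C * (t - s) ∧
      ‖O.p t - O.p s - (O.m t - O.m s) • O.n s‖ ≤ C * (t - s) ∧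
      ‖O.p t - O.p s‖ ≤ C * ‖O.g t - O.g s‖ + C * (t - s) ∧
      κ * ‖O.g t - O.g s‖ ^ 2 ≤ (O.p t - O.p s) (O.g t - O.g s) +
        C * (t - s) * ‖O.g t - O.g s‖ := by
  obtain ⟨C₀, hC₀, hb⟩ := O.exists_bounds
  obtain ⟨κ, hκ, hmono⟩ := O.lagr.exists_strongMono O.compact_image O.image_subset
  obtain ⟨C₁, hC₁, hlip⟩ := O.lagr.exists_fiberDeriv_lipschitz O.compact_image O.image_subset
  obtain ⟨C₂, hC₂, hbase⟩ := O.lagr.exists_fiberDeriv_lipschitz_base O.compact_image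
    O.image_subset
  have hC₀0 : 0 ≤ C₀ := by linarith
  obtain ⟨L, hL⟩ : ∃ L, L = C₀ * R ^ 2 + C₀ * R ^ 2 * C₀ + C₀ * R * (C₀ * R) := ⟨_, rfl⟩
  have hL0 : 0 ≤ L := by rw [hL]; positivity
  obtain ⟨C, hC⟩ : ∃ C, C = C₀ + C₀ * R + L + C₁ + C₂ * R * R := ⟨_, rfl⟩
  have p1 : 0 ≤ C₀ * R := by positivity
  have p2 : 0 ≤ C₂ * R * R := by positivity
  have hC0 : 0 ≤ C := by linarith
  refine ⟨κ, C, hκ, hC0, fun s hs t ht hst => ?_⟩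
  have hsI := Ioo_subset_Icc_self hs.1.1
  have htI := Ioo_subset_Icc_self ht.1.1
  have hδ : 0 ≤ t - s := by linarith
  have hsub : ∀ r ∈ O.good ∩ Ioo s t, r ∈ Icc O.a O.b ∧ ‖O.g r‖ ≤ R := fun r hr =>
    ⟨Ioo_subset_Icc_self hr.1.1, hg r ⟨hr.1, hs.2.1.trans hr.2.1, hr.2.2.trans ht.2.2⟩⟩
  have hgs := hg s hs
  have hgt := hg t ht
  have hbs := hb s hsI
  have hbt := hb t htI
  have hR2 : ∀ r, ‖O.g r‖ ≤ R → C₀ * ‖O.g r‖ ^ 2 ≤ C₀ * R ^ 2 := fun r hr => by gcongr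
  have hu : ‖O.u t - O.u s‖ ≤ R * (t - s) := by
    rw [O.prim.sub_eq hsI htI]
    exact O.norm_integral_le hst.le hsI.1 htI.2 fun r hr => (hsub r hr).2
  have hn : ‖O.n t - O.n s‖ ≤ C₀ * R * (t - s) := by
    rw [O.n_primitiveOn.sub_eq hsI htI]
    exact O.norm_integral_le hst.le hsI.1 htI.2 fun r hr =>
      (hb r (hsub r hr).1).2.2.1.trans (mul_le_mul_of_nonneg_left (hsub r hr).2 hC₀0)
  have hw : ‖O.w t - O.w s‖ ≤ C₀ * R ^ 2 * (t - s) := by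
    rw [O.w_sub hs.1 ht.1 hst]
    exact O.norm_integral_le hst.le hsI.1 htI.2 fun r hr =>
      (hb r (hsub r hr).1).2.2.2.2.2.2.2.trans (hR2 r (hsub r hr).2)
  have hαN : ‖∫ r in s..t, O.αN r‖ ≤ C₀ * R ^ 2 * (t - s) :=
    O.norm_integral_le hst.le hsI.1 htI.2 fun r hr =>
      (hb r (hsub r hr).1).2.2.2.2.2.2.1.trans (hR2 r (hsub r hr).2)
  have hB : ‖O.B t‖ ≤ C₀ * R := hbt.2.2.2.2.1.trans (mul_le_mul_of_nonneg_left hgt hC₀0)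
  have hbase' : ‖fiberDeriv O.G (O.u s, O.g s) - fiberDeriv O.G (O.u t, O.g s)‖ ≤
      C₂ * R * R * (t - s) := by
    refine (hbase _ (mem_image_of_mem _ hsI) _ (mem_image_of_mem _ htI) _).trans ?_
    rw [norm_sub_rev]
    calc C₂ * ‖O.u t - O.u s‖ * ‖O.g s‖ ≤ C₂ * (R * (t - s)) * R := by gcongr
      _ = _ := by ring
  -- The change of velocity at the fixed position `u t` is separated from the change of position at
  -- the fixed velocity `g s`: the first is Lipschitz and strongly monotone, the second is `O(t -
  -- s)`.
  have hdec : O.p t - O.p s = (fiberDeriv O.G (O.u t, O.g t) - fiberDeriv O.G (O.u t, O.g s)) -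
      (fiberDeriv O.G (O.u s, O.g s) - fiberDeriv O.G (O.u t, O.g s)) := by
    simp only [p]; abel
  have k1 : C₀ * R ≤ C := by linarith
  have k2 : L ≤ C := by linarith
  have k3 : C₁ ≤ C := by linarith
  have k4 : C₂ * R * R ≤ C := by linarith
  have k5 : C₀ ≤ C := by linarith
  refine ⟨hbs.1.trans k5, hbs.2.1.trans k5,
    hn.trans (mul_le_mul_of_nonneg_right k1 hδ), ?_, ?_, ?_⟩
  · have e1 : O.p t - O.p s - (O.m t - O.m s) • O.n s =
        (O.w t - O.w s) + (∫ r in s..t, O.αN r) • O.n s + O.B t • (O.n t - O.n s) := by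
      rw [O.m_sub hsI htI, w, w]
      module
    rw [e1]
    refine (norm_add₃_le).trans (le_trans ?_ (mul_le_mul_of_nonneg_right k2 hδ))
    have e2 : ‖(∫ r in s..t, O.αN r) • O.n s‖ ≤ C₀ * R ^ 2 * (t - s) * C₀ :=
      (norm_smul_le _ _).trans (mul_le_mul hαN hbs.1 (norm_nonneg _) (by positivity))
    have e3 : ‖O.B t • (O.n t - O.n s)‖ ≤ C₀ * R * (C₀ * R * (t - s)) :=
      (norm_smul_le _ _).trans (mul_le_mul hB hn (norm_nonneg _) (by positivity))
    calc _ ≤ _ := add_le_add (add_le_add hw e2) e3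
      _ = L * (t - s) := by rw [hL]; ring
  · rw [hdec]
    refine (norm_sub_le _ _).trans (add_le_add ?_ ?_)
    · exact (hlip _ (mem_image_of_mem _ htI) _ _).trans
        (mul_le_mul_of_nonneg_right k3 (norm_nonneg _))
    · exact hbase'.trans (mul_le_mul_of_nonneg_right k4 hδ)
  · have e1 := hmono _ (mem_image_of_mem _ htI) (O.g t) (O.g s)
    rw [hdec, sub_apply]
    set A := fiberDeriv O.G (O.u s, O.g s) - fiberDeriv O.G (O.u t, O.g s)
    have e2 := (A.le_opNorm (O.g t - O.g s)).trans (mul_le_mul_of_nonneg_right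
      (hbase'.trans (mul_le_mul_of_nonneg_right k4 hδ)) (norm_nonneg _))
    have e3 := (le_abs_self _).trans e2
    linarith

/-- The reaction between two times of impact is controlled by the elapsed time. -/
lemma exists_impact_estimate {c d R : ℝ} (hR : 0 ≤ R)
    (hg : ∀ s ∈ O.good ∩ Ioo c d, ‖O.g s‖ ≤ R) :
    ∃ C, 0 ≤ C ∧ ∀ s ∈ O.good ∩ Ioo c d, ∀ t ∈ O.good ∩ Ioo c d, s < t →
      0 ≤ O.n s (O.g s) → O.n t (O.g t) ≤ 0 → 1 / 2 ≤ O.n s (O.N (O.u s)) →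
      O.m t - O.m s ≤ C * (t - s) := by
  obtain ⟨κ, C, hκ, hC, H⟩ := O.exists_estimates hR hg
  -- Pairing the momentum balance with `N` costs `C²D + 2C²δ`; dividing by the transversality `1/2`
  -- gives at most `4C²(D + δ)`.
  set C₁ := 4 * (C * C) with hC₁
  have hC₁0 : 0 ≤ C₁ := by positivity
  set C₂ := C * R * C₁ + 2 * C with hC₂
  have hC₂0 : 0 ≤ C₂ := by positivity
  refine ⟨C₁ * (C₂ / κ + 1 + 1), by positivity, fun s hs t ht hst hns hnt hN => ?_⟩
  obtain ⟨h1, h2, h3, h4, h5, h6⟩ := H s hs t ht hst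
  set D := ‖O.g t - O.g s‖ with hD
  have hD0 : 0 ≤ D := norm_nonneg _
  set δ := t - s with hδ
  have hδ0 : 0 ≤ δ := by linarith
  set Δ := O.m t - O.m s with hΔ
  have hΔ0 : 0 ≤ Δ := sub_nonneg.2 (O.m_mono hs.1 ht.1 hst.le)
  set A := O.p t - O.p s - Δ • O.n s with hA
  have hpA : O.p t - O.p s = A + Δ • O.n s := by rw [hA]; abel
  -- the reaction is controlled by the variation of the velocity
  have hΔD : Δ ≤ C₁ * (D + δ) := by
    have e1 : Δ * O.n s (O.N (O.u s)) = (O.p t - O.p s) (O.N (O.u s)) - A (O.N (O.u s)) := by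
      rw [hpA]; simp
    have e2 : |(O.p t - O.p s) (O.N (O.u s))| ≤ (C * D + C * δ) * C :=
      ((O.p t - O.p s).le_opNorm _).trans (mul_le_mul h5 h2 (norm_nonneg _) (by positivity))
    have e3 : |A (O.N (O.u s))| ≤ C * δ * C :=
      (A.le_opNorm _).trans (mul_le_mul h4 h2 (norm_nonneg _) (by positivity))
    have e4 : Δ * (1 / 2) ≤ Δ * O.n s (O.N (O.u s)) := mul_le_mul_of_nonneg_left hN hΔ0
    have e5 := le_abs_self ((O.p t - O.p s) (O.N (O.u s)))
    have e6 := neg_abs_le (A (O.N (O.u s)))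
    rw [hC₁]
    have e7 : 0 ≤ C * C * D := by positivity
    linarith
  -- The signs of the normal velocities at `s` and `t` discard the main terms; what remains is the
  -- variation of the conormal, which is Lipschitz in time.
  have hnΔ : O.n s (O.g t - O.g s) ≤ C * R * δ := by
    have e1 : O.n s (O.g t - O.g s) =
        O.n t (O.g t) - O.n s (O.g s) - (O.n t - O.n s) (O.g t) := by simp
    have e2 : |(O.n t - O.n s) (O.g t)| ≤ C * δ * R :=
      ((O.n t - O.n s).le_opNorm _).trans (mul_le_mul h3 (hg t ht) (norm_nonneg _)
        (by positivity))
    have e3 := neg_abs_le ((O.n t - O.n s) (O.g t))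
    rw [e1]
    linarith
  have hAD : A (O.g t - O.g s) ≤ C * δ * D :=
    (le_abs_self _).trans ((A.le_opNorm _).trans (mul_le_mul_of_nonneg_right h4 hD0))
  -- The reaction contributes `Δ` times a quantity of order `δ`, and `Δ` is itself at most `C₁(D +
  -- δ)`, so every term on the right carries a factor `δ`.
  have hfin : κ * D ^ 2 ≤ C₂ * δ * (D + δ) := by
    have e1 : (O.p t - O.p s) (O.g t - O.g s) =
        A (O.g t - O.g s) + Δ * O.n s (O.g t - O.g s) := by rw [hpA]; simp
    have e2 : Δ * O.n s (O.g t - O.g s) ≤ C₁ * (D + δ) * (C * R * δ) :=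
      (mul_le_mul_of_nonneg_left hnΔ hΔ0).trans
        (mul_le_mul_of_nonneg_right hΔD (by positivity))
    rw [e1] at h6
    have e3 : C * δ * D ≤ C * δ * (D + δ) := by gcongr; linarith
    calc κ * D ^ 2 ≤ C * δ * (D + δ) + C₁ * (D + δ) * (C * R * δ) + C * δ * (D + δ) := by
          linarith
      _ = C₂ * δ * (D + δ) := by rw [hC₂]; ring
  have hDδ := le_of_sq_le hκ hC₂0 hδ0 hfin
  calc Δ ≤ C₁ * (D + δ) := hΔD
    _ ≤ C₁ * ((C₂ / κ + 1) * δ + δ) := by gcongr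
    _ = C₁ * (C₂ / κ + 1 + 1) * δ := by ring

end Obstacle

end ObstacleEstimates

/-! ### Lipschitz continuity of the reaction and of the velocity -/

section ObstacleLipschitz

namespace Obstacle

variable {E : Type*} [NormedAddCommGroup E] [NormedSpace ℝ E] [FiniteDimensional ℝ E]
  (O : Obstacle E)

/-- Since `φ ∘ u` is nonpositive and reaches zero at `s`, its derivative has nonnegative integral
over `[s - ε, s]`. -/
lemma exists_good_before {s ε : ℝ} (hs : s ≤ O.b) (hε : 0 < ε) (ha : O.a ≤ s - ε)
    (h0 : O.φ (O.u s) = 0) : ∃ r ∈ O.good ∩ Ioo (s - ε) s, 0 ≤ O.n r (O.g r) := by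
  have h1 : s - ε ∈ Icc O.a O.b := ⟨ha, by linarith⟩
  have h2 : s ∈ Icc O.a O.b := ⟨by linarith, hs⟩
  refine exists_mem_nonneg_of_integral_nonneg (by linarith)
    (O.φ_primitiveOn.intervalIntegrable h1 h2) ?_ ?_
  · rw [← O.φ_primitiveOn.sub_eq h1 h2, h0]
    linarith [O.nonpos _ h1]
  · filter_upwards [O.ae_good] with x hx hx'
    exact hx ⟨ha.trans_lt hx'.1, hx'.2.trans_le hs⟩

lemma exists_good_after {s ε : ℝ} (hs : O.a ≤ s) (hε : 0 < ε) (hb : s + ε ≤ O.b)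
    (h0 : O.φ (O.u s) = 0) : ∃ r ∈ O.good ∩ Ioo s (s + ε), O.n r (O.g r) ≤ 0 := by
  have h1 : s + ε ∈ Icc O.a O.b := ⟨by linarith, hb⟩
  have h2 : s ∈ Icc O.a O.b := ⟨hs, by linarith⟩
  obtain ⟨r, hr, hr'⟩ := exists_mem_nonneg_of_integral_nonneg (f := fun r => -O.n r (O.g r))
    (by linarith : s < s + ε) (O.φ_primitiveOn.intervalIntegrable h2 h1).neg (S := O.good) (by
      rw [intervalIntegral.integral_neg, ← O.φ_primitiveOn.sub_eq h2 h1, h0]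
      linarith [O.nonpos _ h1]) (by
      filter_upwards [O.ae_good] with x hx hx'
      exact hx ⟨hs.trans_lt hx'.1, hx'.2.trans_le hb⟩)
  exact ⟨r, hr, by linarith⟩

/-- The reaction changes only between the first and the last contact in `[s, t]`. Slightly before
the one and slightly after the other the normal velocities have the signs required by the impact
estimate, and the shift `ε` is arbitrary. -/
lemma exists_m_lipschitz {c d R : ℝ} (hR : 0 ≤ R)
    (hg : ∀ s ∈ O.good ∩ Ioo c d, ‖O.g s‖ ≤ R) :
    ∃ C, 0 ≤ C ∧ ∀ s ∈ O.good ∩ Ioo c d, ∀ t ∈ O.good ∩ Ioo c d, s < t →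
      O.m t - O.m s ≤ C * (t - s) := by
  obtain ⟨C, hC, H⟩ := O.exists_impact_estimate hR hg
  refine ⟨C, hC, fun s hs t ht hst => ?_⟩
  have hsI := Ioo_subset_Icc_self hs.1.1
  have htI := Ioo_subset_Icc_self ht.1.1
  have hsub : Icc s t ⊆ Icc O.a O.b := Icc_subset_Icc hsI.1 htI.2
  set Z := Icc s t ∩ {r | O.φ (O.u r) = 0} with hZ
  rcases Z.eq_empty_or_nonempty with hZe | hZne
  · rw [O.m_eq hs.1 ht.1 hst.le (fun r hr h0 => by
      have : r ∈ Z := ⟨hr, h0⟩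
      rw [hZe] at this; exact this), sub_self]
    exact mul_nonneg hC (by linarith)
  have hZc : IsCompact Z := by
    have hcont := (O.continuousOn_comp O.smooth.continuousOn).mono hsub
    exact isCompact_Icc.of_isClosed_subset
      (hcont.preimage_isClosed_of_isClosed isClosed_Icc (isClosed_singleton (x := (0 : ℝ))))
      inter_subset_left
  obtain ⟨s₁, hs₁, hleast⟩ := hZc.exists_isLeast hZne
  obtain ⟨t₁, ht₁, hgreat⟩ := hZc.exists_isGreatest hZne
  have hst₁ : s₁ ≤ t₁ := hleast ht₁
  -- near a contact point the field `N` is transverse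
  have hnN : ContinuousAt (fun r => O.n r (O.N (O.u r))) s₁ :=
    (O.continuousOn_n.clm_apply O.continuousOn_N).continuousAt
      (Icc_mem_nhds (hs.1.1.1.trans_le hs₁.1.1) (hs₁.1.2.trans_lt ht.1.1.2))
  have hn1 : O.n s₁ (O.N (O.u s₁)) = 1 := O.normal _ (O.mem _ (hsub hs₁.1)) hs₁.2
  have hev : ∀ᶠ r in 𝓝 s₁, 1 / 2 < O.n r (O.N (O.u r)) :=
    hnN.eventually (lt_mem_nhds (by simp only [hn1]; norm_num))
  obtain ⟨δ, hδ, hball⟩ := Metric.eventually_nhds_iff.1 hev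
  refine le_of_forall_pos_le_add fun η hη => ?_
  -- The bounds keep the shifted times inside both `(c, d)` and `(a, b)` and the first of them in
  -- the region where `N` is transverse; the last one absorbs the extra length `2ε` into the error
  -- `η`.
  obtain ⟨ε, hε, hεs⟩ : ∃ ε, 0 < ε ∧ ε < δ ∧ ε < s - c ∧ ε < s - O.a ∧ ε < d - t ∧ ε < O.b - t ∧
      C * (2 * ε) ≤ η := by
    have e1 : 0 < η / (2 * (C + 1)) := by positivity
    obtain ⟨ε, h1, h2⟩ := exists_between (show (0 : ℝ) < min (min (min δ (s - c)) (s - O.a))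
      (min (min (d - t) (O.b - t)) (η / (2 * (C + 1)))) by
        refine lt_min (lt_min (lt_min hδ ?_) ?_) (lt_min (lt_min ?_ ?_) e1)
        · linarith [hs.2.1]
        · linarith [hs.1.1.1]
        · linarith [ht.2.2]
        · linarith [ht.1.1.2])
    simp only [lt_min_iff] at h2
    refine ⟨ε, h1, h2.1.1.1, h2.1.1.2, h2.1.2, h2.2.1.1, h2.2.1.2, ?_⟩
    have h3 := h2.2.2.le
    rw [le_div_iff₀ (by positivity)] at h3
    nlinarith
  obtain ⟨s', hs', hs'n⟩ := O.exists_good_before (hsub hs₁.1).2 hε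
    (by linarith [hs₁.1.1]) hs₁.2
  obtain ⟨t', ht', ht'n⟩ := O.exists_good_after (hsub ht₁.1).1 hε
    (by linarith [ht₁.1.2]) ht₁.2
  -- If `s'` lies before `s` this is monotonicity; otherwise no contact occurs between `s` and `s'`,
  -- because `s'` precedes the first contact `s₁`.
  have h1 : O.m s' ≤ O.m s := by
    rcases le_total s' s with h | h
    · exact O.m_mono hs'.1 hs.1 h
    · refine (O.m_eq hs.1 hs'.1 h fun r hr h0 => ?_).ge
      have : s₁ ≤ r := hleast ⟨⟨hr.1, by linarith [hr.2, hs'.2.2, hs₁.1.2]⟩, h0⟩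
      linarith [hr.2, hs'.2.2]
  have h2 : O.m t ≤ O.m t' := by
    rcases le_total t t' with h | h
    · exact O.m_mono ht.1 ht'.1 h
    · refine (O.m_eq ht'.1 ht.1 h fun r hr h0 => ?_).ge
      have : r ≤ t₁ := hgreat ⟨⟨by linarith [hr.1, ht'.2.1, ht₁.1.1], hr.2⟩, h0⟩
      linarith [hr.1, ht'.2.1]
  have h3 := H s' ⟨hs'.1, by linarith [hs'.2.1, hs₁.1.1], by linarith [hs'.2.2, hs₁.1.2, ht.2.2]⟩
    t' ⟨ht'.1, by linarith [ht'.2.1, ht₁.1.1, hs.2.1], by linarith [ht'.2.2, ht₁.1.2]⟩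
    (by linarith [hs'.2.2, ht'.2.1]) hs'n ht'n
    (hball (by rw [Real.dist_eq, abs_sub_comm, abs_of_nonneg] <;>
      linarith [hs'.2.1, hs'.2.2, hεs.1])).le
  have h4 : C * (t' - s') ≤ C * (t - s) + C * (2 * ε) := by
    rw [← mul_add]
    refine mul_le_mul_of_nonneg_left ?_ hC
    linarith [hs'.2.1, ht'.2.2, hs₁.1.1, ht₁.1.2]
  linarith [hεs.2.2.2.2.2]

/-- Where the velocity is bounded, it is Lipschitz, and so is the reaction of the obstacle. -/
lemma exists_lipschitz {c d R : ℝ} (hR : 0 ≤ R)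
    (hg : ∀ s ∈ O.good ∩ Ioo c d, ‖O.g s‖ ≤ R) :
    ∃ C : ℝ≥0, LipschitzOnWith C O.m (O.good ∩ Ioo c d) ∧
      LipschitzOnWith C O.g (O.good ∩ Ioo c d) := by
  obtain ⟨C₁, hC₁, h1⟩ := O.exists_m_lipschitz hR hg
  obtain ⟨κ, C, hκ, hC, h2⟩ := O.exists_estimates hR hg
  set C₂ := C₁ * C + 2 * C with hC₂
  have hC₂0 : 0 ≤ C₂ := by positivity
  have key : ∀ s ∈ O.good ∩ Ioo c d, ∀ t ∈ O.good ∩ Ioo c d, s < t →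
      ‖O.g t - O.g s‖ ≤ (C₂ / κ + 1) * (t - s) := by
    intro s hs t ht hst
    obtain ⟨e1, -, -, e4, -, e6⟩ := h2 s hs t ht hst
    have hδ0 : 0 ≤ t - s := by linarith
    have hm := h1 s hs t ht hst
    have hm0 : 0 ≤ O.m t - O.m s := sub_nonneg.2 (O.m_mono hs.1 ht.1 hst.le)
    -- Once the reaction is Lipschitz so is the momentum, and strong monotonicity transfers this to
    -- the velocity.
    have hp : ‖O.p t - O.p s‖ ≤ (C₁ * C + C) * (t - s) := by
      have : O.p t - O.p s = (O.p t - O.p s - (O.m t - O.m s) • O.n s) +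
        (O.m t - O.m s) • O.n s := by abel
      rw [this]
      refine (norm_add_le _ _).trans ?_
      have e7 : ‖(O.m t - O.m s) • O.n s‖ ≤ C₁ * (t - s) * C := by
        rw [norm_smul, Real.norm_of_nonneg hm0]
        exact mul_le_mul hm e1 (norm_nonneg _) (by positivity)
      calc _ ≤ _ := add_le_add e4 e7
        _ = _ := by ring
    refine le_of_sq_le hκ hC₂0 hδ0 ?_
    set D := ‖O.g t - O.g s‖
    have hD0 : 0 ≤ D := norm_nonneg _
    have e8 : (O.p t - O.p s) (O.g t - O.g s) ≤ (C₁ * C + C) * (t - s) * D :=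
      (le_abs_self _).trans (((O.p t - O.p s).le_opNorm _).trans
        (mul_le_mul_of_nonneg_right hp hD0))
    have e9 : 0 ≤ C₂ * (t - s) * (t - s) := by positivity
    calc κ * D ^ 2 ≤ (C₁ * C + C) * (t - s) * D + C * (t - s) * D := by linarith
      _ ≤ (C₁ * C + C) * (t - s) * D + C * (t - s) * D + C₂ * (t - s) * (t - s) := by linarith
      _ = C₂ * (t - s) * (D + (t - s)) := by rw [hC₂]; ring
  obtain ⟨L, hL1, hL2⟩ : ∃ L : ℝ≥0, C₁ ≤ L ∧ C₂ / κ + 1 ≤ L :=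
    ⟨⟨max C₁ (C₂ / κ + 1), le_max_of_le_left hC₁⟩, le_max_left _ _, le_max_right _ _⟩
  refine ⟨L, LipschitzOnWith.of_dist_le_mul fun s hs t ht => ?_,
    LipschitzOnWith.of_dist_le_mul fun s hs t ht => ?_⟩
  · wlog hst : s ≤ t generalizing s t
    · rw [dist_comm, dist_comm s]; exact this t ht s hs (le_of_not_ge hst)
    rcases hst.eq_or_lt with rfl | hst
    · simp
    rw [dist_comm, dist_comm s, Real.dist_eq, Real.dist_eq, abs_of_pos (sub_pos.2 hst),
      abs_of_nonneg (sub_nonneg.2 (O.m_mono hs.1 ht.1 hst.le))]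
    exact (h1 s hs t ht hst).trans (mul_le_mul_of_nonneg_right hL1 (sub_pos.2 hst).le)
  · wlog hst : s ≤ t generalizing s t
    · rw [dist_comm, dist_comm s]; exact this t ht s hs (le_of_not_ge hst)
    rcases hst.eq_or_lt with rfl | hst
    · simp
    rw [dist_comm, dist_comm s, dist_eq_norm, Real.dist_eq, abs_of_pos (sub_pos.2 hst)]
    exact (key s hs t ht hst).trans (mul_le_mul_of_nonneg_right hL2 (sub_pos.2 hst).le)

/-- Strong monotonicity is applied with second velocity zero, where the momentum vanishes. -/
lemma exists_norm_le_momentum : ∃ C, 0 ≤ C ∧ ∀ s ∈ Icc O.a O.b, ‖O.g s‖ ≤ C * ‖O.p s‖ := by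
  obtain ⟨κ, hκ, hmono⟩ := O.lagr.exists_strongMono O.compact_image O.image_subset
  refine ⟨κ⁻¹, by positivity, fun s hs => ?_⟩
  have h := hmono _ (mem_image_of_mem _ hs) (O.g s) 0
  rw [O.lagr.fiberDeriv_zero (O.mem s hs), sub_zero, sub_zero] at h
  have h2 : fiberDeriv O.G (O.u s, O.g s) (O.g s) ≤ ‖O.p s‖ * ‖O.g s‖ :=
    (le_abs_self _).trans ((O.p s).le_opNorm _)
  rcases (norm_nonneg (O.g s)).eq_or_lt with h0 | h0
  · rw [← h0]; positivity
  have h3 : κ * ‖O.g s‖ ≤ ‖O.p s‖ := by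
    refine le_of_mul_le_mul_right ?_ h0
    calc κ * ‖O.g s‖ * ‖O.g s‖ = κ * ‖O.g s‖ ^ 2 := by ring
      _ ≤ _ := h.trans h2
  rw [inv_mul_eq_div, le_div_iff₀ hκ]
  linarith

omit [FiniteDimensional ℝ E] in
lemma norm_integral_le_total {V : Type*} [NormedAddCommGroup V] [NormedSpace ℝ V] {f : ℝ → V}
    (hf : IntegrableOn f (Icc O.a O.b)) {s t : ℝ} (hs : s ∈ Icc O.a O.b) (ht : t ∈ Icc O.a O.b)
    (hst : s ≤ t) : ‖∫ r in s..t, f r‖ ≤ ∫ r in Icc O.a O.b, ‖f r‖ := by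
  refine (intervalIntegral.norm_integral_le_integral_norm hst).trans ?_
  rw [intervalIntegral.integral_of_le hst]
  exact setIntegral_mono_set hf.norm (Eventually.of_forall fun _ => norm_nonneg _)
    (Eventually.of_forall fun x hx => ⟨hs.1.trans hx.1.le, hx.2.trans ht.2⟩)

/-- The velocity is locally bounded. -/
lemma exists_velocity_bound {c d : ℝ} (hc : c ∈ O.good) (hd : d ∈ O.good) :
    ∃ R, 0 ≤ R ∧ ∀ s ∈ O.good ∩ Ioo c d, ‖O.g s‖ ≤ R := by
  obtain ⟨C, hC, hg⟩ := O.exists_norm_le_momentum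
  obtain ⟨C₀, hC₀, hb⟩ := O.exists_bounds
  set I₁ := ∫ r in Icc O.a O.b, ‖O.α r‖
  set I₂ := ∫ r in Icc O.a O.b, ‖O.αN r‖
  set W := ‖O.w c‖ + I₁
  set M := |O.m c| + |O.m d| + I₂
  refine ⟨|C * (W + M * C₀)|, abs_nonneg _, fun s hs => ?_⟩
  have hsI := Ioo_subset_Icc_self hs.1.1
  have hw : ‖O.w s‖ ≤ W := by
    have h1 : O.w s = O.w c + ∫ r in c..s, O.α r := by
      rw [← O.w_sub hc hs.1 hs.2.1]; abel
    rw [h1]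
    exact (norm_add_le _ _).trans (add_le_add le_rfl
      (O.norm_integral_le_total O.integrable_α (Ioo_subset_Icc_self hc.1) hsI hs.2.1.le))
  have hB : ‖O.B s‖ ≤ M := by
    have h1 : O.B s = O.m s + ∫ r in O.a..s, O.αN r := by rw [m]; ring
    rw [h1]
    refine (norm_add_le _ _).trans (add_le_add ?_
      (O.norm_integral_le_total O.integrable_αN (left_mem_Icc.2 O.lt.le) hsI hsI.1))
    -- Monotonicity confines the reaction between its values at `c` and `d`; for this reason the
    -- bound is first obtained only between two Lebesgue points.
    have h2 := O.m_mono hc hs.1 hs.2.1.le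
    have h3 := O.m_mono hs.1 hd hs.2.2.le
    rw [Real.norm_eq_abs, abs_le]
    constructor <;> linarith [neg_abs_le (O.m c), le_abs_self (O.m d), abs_nonneg (O.m c),
      abs_nonneg (O.m d)]
  have hp : ‖O.p s‖ ≤ W + M * C₀ := by
    have h1 : O.p s = O.w s + O.B s • O.n s := by rw [w]; abel
    rw [h1]
    refine (norm_add_le _ _).trans (add_le_add hw ?_)
    rw [norm_smul]
    exact mul_le_mul hB (hb s hsI).1 (norm_nonneg _) ((norm_nonneg _).trans hB)
  exact (hg s hsI).trans ((mul_le_mul_of_nonneg_left hp hC).trans (le_abs_self _))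

end Obstacle

end ObstacleLipschitz

/-! ### Equation of motion, multiplier and conservation of energy -/

section ObstacleEquation

/-- The derivative of a function vanishing on a set vanishes almost everywhere on this set. -/
lemma ae_hasDerivAt_eq_zero {V : Type*} [NormedAddCommGroup V] [NormedSpace ℝ V] {h : ℝ → V}
    {Z : Set ℝ} (hZ : ∀ t ∈ Z, h t = 0) :
    ∀ᵐ t, t ∈ Z → ∀ h' : V, HasDerivAt h h' t → h' = 0 := by
  -- Points of `Z` isolated from the right are countable. At any other point zeros of `h`
  -- accumulate, which excludes a nonzero derivative.
  have hcount := (countable_setOfPred_isolated_right_within (s := Z)).ae_notMem volume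
  filter_upwards [hcount] with t ht htZ h' hd
  by_contra hne
  refine ht ⟨htZ, ?_⟩
  have h1 : ∀ᶠ z in 𝓝[Z ∩ Ioi t] t, h z ≠ 0 :=
    (hd.eventually_ne hne).filter_mono
      (nhdsWithin_mono t (fun z (hz : z ∈ Z ∩ Ioi t) => (ne_of_gt hz.2 : z ≠ t)))
  have h2 : ∀ᶠ z in 𝓝[Z ∩ Ioi t] t, False := by
    filter_upwards [h1, self_mem_nhdsWithin] with z hz hz'
    exact hz (hZ z hz'.1)
  exact Filter.eventually_false_iff_eq_bot.1 h2

namespace Obstacle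

variable {E : Type*} [NormedAddCommGroup E] [NormedSpace ℝ E] [FiniteDimensional ℝ E]
  (O : Obstacle E)

/-- A set of full measure is dense, so relations between continuous functions extend from the
Lebesgue points to all times. -/
lemma Ioo_subset_closure {c d : ℝ} (hc : O.a ≤ c) (hd : d ≤ O.b) :
    Ioo c d ⊆ closure (O.good ∩ Ioo c d) := by
  intro x hx
  rw [mem_closure_iff]
  intro o ho hxo
  by_contra hcon
  have h0 : volume (o ∩ Ioo c d) = 0 := by
    refine measure_mono_null ?_ (ae_iff.1 O.ae_good)
    intro y hy
    simp only [mem_ofPred_eq, Classical.not_imp]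
    exact ⟨⟨hc.trans_lt hy.2.1, hy.2.2.trans_le hd⟩, fun hg => hcon ⟨y, hy.1, hg, hy.2⟩⟩
  exact ((ho.inter isOpen_Ioo).measure_pos volume ⟨x, hxo, hx⟩).ne' h0

lemma exists_good {c d : ℝ} (hc : O.a ≤ c) (hcd : c < d) (hd : d ≤ O.b) :
    (O.good ∩ Ioo c d).Nonempty := by
  rw [← closure_nonempty_iff]
  exact (nonempty_Ioo.2 hcd).mono (O.Ioo_subset_closure hc hd)

/-- `v` and `M` are Lipschitz representatives of the velocity and of the reaction on `(c, d)`. -/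
structure Rep (c d : ℝ) (v : ℝ → E) (M : ℝ → ℝ) (C : ℝ≥0) : Prop where
  left : O.a ≤ c
  lt : c < d
  right : d ≤ O.b
  lip : LipschitzWith C v
  lipM : LipschitzWith C M
  eq : EqOn O.g v (O.good ∩ Ioo c d)
  eqM : EqOn O.m M (O.good ∩ Ioo c d)

/-- Lipschitz functions on the Lebesgue points extend to the line; the extension of the
vector-valued velocity costs the factor `lipschitzExtensionConstant E`. -/
lemma exists_rep {c d R : ℝ} (hc : O.a ≤ c) (hcd : c < d) (hd : d ≤ O.b) (hR : 0 ≤ R)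
    (hg : ∀ s ∈ O.good ∩ Ioo c d, ‖O.g s‖ ≤ R) : ∃ v M C, O.Rep c d v M C := by
  obtain ⟨C, h1, h2⟩ := O.exists_lipschitz hR hg
  obtain ⟨M, hM, hMe⟩ := h1.extend_real
  obtain ⟨v, hv, hve⟩ := h2.extend_finite_dimension
  exact ⟨v, M, max C (lipschitzExtensionConstant E * C), hc, hcd, hd,
    hv.weaken (le_max_right _ _), hM.weaken (le_max_left _ _), hve, hMe⟩

namespace Rep

variable {O} {c d : ℝ} {v : ℝ → E} {M : ℝ → ℝ} {C : ℝ≥0} (h : O.Rep c d v M C)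
include h

omit [FiniteDimensional ℝ E] in
lemma mem_Ioo {t : ℝ} (ht : t ∈ Ioo c d) : t ∈ Ioo O.a O.b :=
  ⟨h.left.trans_lt ht.1, ht.2.trans_le h.right⟩

lemma ae_good : ∀ᵐ t, t ∈ Ioo c d → t ∈ O.good ∩ Ioo c d := by
  filter_upwards [O.ae_good] with t ht ht' using ⟨ht (h.mem_Ioo ht'), ht'⟩

lemma primitiveOn : PrimitiveOn O.u v c d := by
  refine (O.prim.mono h.left h.right).congr (fun _ _ => rfl) ?_
  have hne : ∀ c : ℝ, ∀ᵐ x : ℝ, x ≠ c := fun c => by simp [ae_iff, measure_singleton]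
  rw [ae_restrict_iff' measurableSet_Icc]
  filter_upwards [h.ae_good, hne c, hne d] with t ht h1 h2 h3
  exact (h.eq (ht ⟨lt_of_le_of_ne h3.1 (Ne.symm h1), lt_of_le_of_ne h3.2 h2⟩)).symm

/-- The representative `v` is continuous, so the derivative exists at every time rather than almost
every time. -/
lemma hasDerivAt_u {t : ℝ} (ht : t ∈ Ioo c d) : HasDerivAt O.u (v t) t := by
  have := FiniteDimensional.complete ℝ E
  have h1 : HasDerivAt (fun x => O.u c + ∫ r in c..x, v r) (v t) t :=
    (intervalIntegral.integral_hasDerivAt_right (h.lip.continuous.intervalIntegrable _ _)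
      (h.lip.continuous.stronglyMeasurableAtFilter _ _) h.lip.continuous.continuousAt).const_add _
  refine h1.congr_of_eventuallyEq ?_
  filter_upwards [Ioo_mem_nhds ht.1 ht.2] with x hx
  exact h.primitiveOn.2 x (Ioo_subset_Icc_self hx)

lemma Ioo_subset_closure : Ioo c d ⊆ closure (O.good ∩ Ioo c d) :=
  O.Ioo_subset_closure h.left h.right

lemma continuousAt_u {t : ℝ} (ht : t ∈ Ioo c d) : ContinuousAt O.u t :=
  (h.hasDerivAt_u ht).continuousAt

omit [FiniteDimensional ℝ E] in
lemma mem_U {t : ℝ} (ht : t ∈ Ioo c d) : O.u t ∈ O.U :=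
  O.mem t (Ioo_subset_Icc_self (h.mem_Ioo ht))

lemma continuousAt_momentum {t : ℝ} (ht : t ∈ Ioo c d) :
    ContinuousAt (fun t => fiberDeriv O.G (O.u t, v t)) t :=
  ContinuousAt.comp (f := fun t => (O.u t, v t)) (O.lagr.continuousAt_fiberDeriv (h.mem_U ht) _)
    ((h.continuousAt_u ht).prodMk h.lip.continuous.continuousAt)

/-- The equation of motion. -/
lemma ae_hasDerivAt_momentum : ∀ᵐ t, t ∈ Ioo c d →
    HasDerivAt (fun t => fiberDeriv O.G (O.u t, v t))
      (baseDeriv O.G (O.u t, v t) + deriv M t • O.n t) t := by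
  have := FiniteDimensional.complete ℝ E
  obtain ⟨s₀, hs₀⟩ := O.exists_good h.left h.lt h.right
  have hs₀I := h.mem_Ioo hs₀.2
  -- This is `w + B n` with both components replaced by continuous representatives. It equals the
  -- momentum at Lebesgue points, hence everywhere on `(c, d)` by density, and it can be
  -- differentiated term by term.
  let P : ℝ → E →L[ℝ] ℝ := fun t =>
    (O.w s₀ + ((∫ r in O.a..t, O.α r) - ∫ r in O.a..s₀, O.α r)) +
      (M t + ∫ r in O.a..t, O.αN r) • O.n t
  have ha : O.a ∈ Icc O.a O.b := left_mem_Icc.2 O.lt.le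
  have hPg : EqOn (fun t => fiberDeriv O.G (O.u t, v t)) P (O.good ∩ Ioo c d) := by
    intro t ht
    have htI := h.mem_Ioo ht.2
    have h1 : O.w t = O.w s₀ + ((∫ r in O.a..t, O.α r) - ∫ r in O.a..s₀, O.α r) := by
      rw [intervalIntegral.integral_interval_sub_left
        (O.intervalIntegrable O.integrable_α ha (Ioo_subset_Icc_self htI))
        (O.intervalIntegrable O.integrable_α ha (Ioo_subset_Icc_self hs₀I))]
      rcases lt_trichotomy s₀ t with hlt | rfl | hlt
      · rw [← O.w_sub hs₀.1 ht.1 hlt]; abel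
      · simp
      · rw [intervalIntegral.integral_symm, ← O.w_sub ht.1 hs₀.1 hlt]; abel
    have h2 : O.B t = M t + ∫ r in O.a..t, O.αN r := by
      rw [← h.eqM ht, m]; ring
    simp only [P]
    rw [← h1, ← h2, ← h.eq ht, w, p]
    abel
  have hα : ContinuousOn (fun t => ∫ r in O.a..t, O.α r) (Icc O.a O.b) := by
    simpa using (PrimitiveOn.of_integral O.integrable_α 0).continuousOn
  have hαN : ContinuousOn (fun t => ∫ r in O.a..t, O.αN r) (Icc O.a O.b) := by
    simpa using (PrimitiveOn.of_integral O.integrable_αN 0).continuousOn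
  have hIcc : Ioo c d ⊆ Icc O.a O.b := fun t ht => Ioo_subset_Icc_self (h.mem_Ioo ht)
  have hPc : ContinuousOn P (Ioo c d) := by
    refine (continuousOn_const.add ((hα.mono hIcc).sub continuousOn_const)).add
      (ContinuousOn.fun_smul ?_ (O.continuousOn_n.mono hIcc))
    exact h.lipM.continuous.continuousOn.add (hαN.mono hIcc)
  have hEq : EqOn (fun t => fiberDeriv O.G (O.u t, v t)) P (Ioo c d) :=
    hPg.of_subset_closure (fun t ht => (h.continuousAt_momentum ht).continuousWithinAt) hPc
      inter_subset_right h.Ioo_subset_closure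
  filter_upwards [h.ae_good, h.lipM.ae_differentiableAt_real, O.n_primitiveOn.ae_hasDerivAt]
    with t hgood hM hn ht
  have hg := (hgood ht).1
  have hd : HasDerivAt P (O.α t + ((M t + ∫ r in O.a..t, O.αN r) • O.dn t +
      (deriv M t + O.αN t) • O.n t)) t :=
    ((hg.2.2.2.2.1.sub_const _).const_add _).add
      ((hM.hasDerivAt.add hg.2.2.2.2.2).smul (hn (h.mem_Ioo ht)))
  have h2 : M t + ∫ r in O.a..t, O.αN r = O.B t := by
    rw [← h.eqM (hgood ht), m]; ring
  rw [h2] at hd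
  have h3 : O.α t + (O.B t • O.dn t + (deriv M t + O.αN t) • O.n t) =
      baseDeriv O.G (O.u t, v t) + deriv M t • O.n t := by
    rw [← h.eq (hgood ht), α, F]
    module
  rw [h3] at hd
  refine hd.congr_of_eventuallyEq ?_
  filter_upwards [Ioo_mem_nhds ht.1 ht.2] with x hx using hEq hx

lemma le_of_good {x y : ℝ} (hx : x ∈ O.good ∩ Ioo c d) (hy : y ∈ Ioo x d) : M x ≤ M y := by
  have hcl : IsClosed {y | M x ≤ M y} := isClosed_le continuous_const h.lipM.continuous
  have hsub : O.good ∩ Ioo x d ⊆ {y | M x ≤ M y} := by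
    intro z hz
    have hz' : z ∈ O.good ∩ Ioo c d := ⟨hz.1, hx.2.1.trans hz.2.1, hz.2.2⟩
    rw [mem_ofPred_eq, ← h.eqM hx, ← h.eqM hz']
    exact O.m_mono hx.1 hz.1 hz.2.1.le
  exact closure_minimal hsub hcl (O.Ioo_subset_closure (h.left.trans hx.2.1.le) h.right hy)

lemma ae_deriv_nonneg : ∀ᵐ t, t ∈ Ioo c d → 0 ≤ deriv M t := by
  filter_upwards [h.ae_good, h.lipM.ae_differentiableAt_real] with t hgood hM ht
  refine ge_of_tendsto hM.hasDerivAt.tendsto_slope_zero_right ?_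
  have hlt : ∀ᶠ ε in 𝓝[>] (0 : ℝ), ε < d - t :=
    mem_nhdsWithin_of_mem_nhds (Iio_mem_nhds (by linarith [ht.2]))
  filter_upwards [hlt, self_mem_nhdsWithin] with ε h1 h2
  have h2 : 0 < ε := h2
  have := h.le_of_good (hgood ht) (y := t + ε) ⟨by linarith, by linarith⟩
  exact mul_nonneg (inv_nonneg.2 h2.le) (by linarith)

lemma ae_deriv_eq_zero : ∀ᵐ t, t ∈ Ioo c d → O.φ (O.u t) ≠ 0 → deriv M t = 0 := by
  filter_upwards [h.ae_good] with t hgood ht hne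
  have hcont : ContinuousAt (fun r => O.φ (O.u r)) t :=
    (O.continuousOn_comp O.smooth.continuousOn).continuousAt
      (Icc_mem_nhds (h.mem_Ioo ht).1 (h.mem_Ioo ht).2)
  obtain ⟨δ, hδ, hball⟩ := Metric.eventually_nhds_iff.1 (hcont.eventually_ne hne)
  have hEq : ∀ y ∈ Ioo (max c (t - δ)) (min d (t + δ)), M y = M t := by
    have hcl : IsClosed {y | M y = M t} := isClosed_eq h.lipM.continuous continuous_const
    have hsub : O.good ∩ Ioo (max c (t - δ)) (min d (t + δ)) ⊆ {y | M y = M t} := by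
      rintro z ⟨hz, hz1, hz2⟩
      rw [max_lt_iff] at hz1
      rw [lt_min_iff] at hz2
      have hz' : z ∈ O.good ∩ Ioo c d := ⟨hz, hz1.1, hz2.1⟩
      have hb : ∀ r, (t ≤ r ∧ r ≤ z ∨ z ≤ r ∧ r ≤ t) → O.φ (O.u r) ≠ 0 := by
        intro r hr
        refine hball ?_
        rw [Real.dist_eq, abs_lt]
        rcases hr with hr | hr <;> constructor <;> linarith
      rw [mem_ofPred_eq, ← h.eqM (hgood ht), ← h.eqM hz']
      rcases le_total t z with hle | hle
      · exact (O.m_eq (hgood ht).1 hz hle fun r hr => hb r (Or.inl hr)).symm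
      · exact O.m_eq hz (hgood ht).1 hle fun r hr => hb r (Or.inr hr)
    exact fun y hy => closure_minimal hsub hcl (O.Ioo_subset_closure
      (h.left.trans (le_max_left _ _)) ((min_le_left _ _).trans h.right) hy)
  have : M =ᶠ[𝓝 t] fun _ => M t := by
    filter_upwards [Ioo_mem_nhds (max_lt ht.1 (sub_lt_self t hδ)) (lt_min ht.2 (lt_add_of_pos_right t hδ))]
      with y hy using hEq y hy
  rw [this.deriv_eq, deriv_const]

/-- At a contact `φ ∘ u` has an interior maximum, and it is now differentiable there: contacts are
tangential. -/
lemma n_apply_eq_zero {t : ℝ} (ht : t ∈ Ioo c d) (h0 : O.φ (O.u t) = 0) : O.n t (v t) = 0 := by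
  have hd : HasDerivAt (fun t => O.φ (O.u t)) (O.n t (v t)) t :=
    ((O.smooth.contDiffAt (O.isOpen.mem_nhds (h.mem_U ht))).differentiableAt
      two_ne_zero).hasFDerivAt.comp_hasDerivAt t (h.hasDerivAt_u ht)
  refine IsLocalMax.hasDerivAt_eq_zero ?_ hd
  filter_upwards [Ioo_mem_nhds (h.mem_Ioo ht).1 (h.mem_Ioo ht).2] with x hx
  rw [h0]
  exact O.nonpos x (Ioo_subset_Icc_self hx)

lemma hasDerivAt_n {t : ℝ} (ht : t ∈ Ioo c d) :
    HasDerivAt O.n (fderiv ℝ (fderiv ℝ O.φ) (O.u t) (v t)) t :=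
  ((O.contDiffOn_dφ.contDiffAt (O.isOpen.mem_nhds (h.mem_U ht))).differentiableAt
    one_ne_zero).hasFDerivAt.comp_hasDerivAt t (h.hasDerivAt_u ht)

/-- The normal velocity vanishes on the contact set, hence so does its derivative at almost every
contact; the left side is that derivative. -/
lemma ae_second_order : ∀ᵐ t, t ∈ Ioo c d → O.φ (O.u t) = 0 → DifferentiableAt ℝ v t →
    fderiv ℝ (fderiv ℝ O.φ) (O.u t) (v t) (v t) + O.n t (deriv v t) = 0 := by
  filter_upwards [ae_hasDerivAt_eq_zero (h := fun t => O.n t (v t))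
    (Z := {t | t ∈ Ioo c d ∧ O.φ (O.u t) = 0}) (fun t ht => h.n_apply_eq_zero ht.1 ht.2)]
    with t hZ ht h0 hv
  exact hZ ⟨ht, h0⟩ _ ((h.hasDerivAt_n ht).clm_apply hv.hasDerivAt)

/-- Where `v` vanishes the momentum vanishes, and so does its derivative almost everywhere. The
force is zero there too, so the equation of motion leaves only the reaction, which is read off by
pairing with `N`. -/
lemma ae_deriv_eq_zero_of_velocity : ∀ᵐ t, t ∈ Ioo c d → v t = 0 → deriv M t = 0 := by
  filter_upwards [ae_hasDerivAt_eq_zero (h := fun t => fiberDeriv O.G (O.u t, v t))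
    (Z := {t | t ∈ Ioo c d ∧ v t = 0}) (fun t ht => by
      simp only [ht.2, O.lagr.fiberDeriv_zero (h.mem_U ht.1)]),
    h.ae_hasDerivAt_momentum, h.ae_deriv_eq_zero] with t hZ hmom hoff ht hv
  have h1 := hZ ⟨ht, hv⟩ _ (hmom ht)
  by_cases h0 : O.φ (O.u t) = 0
  · rw [hv, O.lagr.baseDeriv_zero (h.mem_U ht), zero_add] at h1
    have h2 := DFunLike.congr_fun h1 (O.N (O.u t))
    have h3 : O.n t (O.N (O.u t)) = 1 := O.normal _ (h.mem_U ht) h0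
    simpa [h3] using h2
  · exact hoff ht h0

lemma hasDerivAt_pair {t : ℝ} (ht : t ∈ Ioo c d) (hv : DifferentiableAt ℝ v t) :
    HasDerivAt (fun t => (O.u t, v t)) (v t, deriv v t) t :=
  (h.hasDerivAt_u ht).prodMk hv.hasDerivAt

/-- For nonzero velocity `G` is smooth enough to expand the derivative of the momentum by the chain
rule. -/
lemma acceleration {t : ℝ} (ht : t ∈ Ioo c d) (hv : DifferentiableAt ℝ v t)
    (hmom : HasDerivAt (fun t => fiberDeriv O.G (O.u t, v t))
      (baseDeriv O.G (O.u t, v t) + deriv M t • O.n t) t) (h0 : v t ≠ 0) (e : E) :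
    fderiv ℝ (fderiv ℝ O.G) (O.u t, v t) (v t, deriv v t) (0, e) =
      baseDeriv O.G (O.u t, v t) e + deriv M t * O.n t e := by
  have h1 : HasFDerivAt (fderiv ℝ O.G) (fderiv ℝ (fderiv ℝ O.G) (O.u t, v t)) (O.u t, v t) :=
    ((O.lagr.contDiffAt_fderiv (h.mem_U ht) h0).differentiableAt two_ne_zero).hasFDerivAt
  have h2 : HasDerivAt (fun t => fderiv ℝ O.G (O.u t, v t))
      (fderiv ℝ (fderiv ℝ O.G) (O.u t, v t) (v t, deriv v t)) t :=
    HasFDerivAt.comp_hasDerivAt (f := fun t => (O.u t, v t)) t h1 (h.hasDerivAt_pair ht hv)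
  have h3 := h2.clm_apply (hasDerivAt_const t ((0 : E), e))
  have h4 := hmom.clm_apply (hasDerivAt_const t e)
  rw [map_zero, add_zero] at h3 h4
  have := h3.unique h4
  simpa using this

/-- Conservation of energy. -/
lemma energy_const : ∃ e : ℝ, ∀ t ∈ Icc c d, O.G (O.u t, v t) = e := by
  have := FiniteDimensional.complete ℝ E
  -- Continuous differentiability across the zero section suffices for `G(u, v)` to be a primitive,
  -- even if the velocity vanishes somewhere.
  have hC1 : ContDiffOn ℝ 1 O.G (O.U ×ˢ univ) := by
    have h01 : (1 : ℕ∞ω) = 0 + 1 := by norm_num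
    rw [h01, contDiffOn_succ_iff_fderiv_of_isOpen (O.isOpen.prod isOpen_univ)]
    exact ⟨fun z hz => (O.lagr.differentiableAt hz.1 z.2).differentiableWithinAt, by simp,
      contDiffOn_zero.2 fun z hz => (O.lagr.continuousAt_fderiv hz.1 z.2).continuousWithinAt⟩
  have hp := (h.primitiveOn.prodMk (h.lip.primitiveOn c d)).comp
    (O.isOpen.prod isOpen_univ) hC1 (fun t ht =>
      ⟨O.mem t ⟨h.left.trans ht.1, ht.2.trans h.right⟩, mem_univ _⟩)
  have h0 : ∀ᵐ t, t ∈ Ioo c d → fderiv ℝ O.G (O.u t, v t) (v t, deriv v t) = 0 := by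
    filter_upwards [h.ae_hasDerivAt_momentum, h.lip.ae_differentiableAt_real,
      h.ae_deriv_eq_zero] with t hmom hv hoff ht
    have hU := h.mem_U ht
    have h1 := (hmom ht).clm_apply hv.hasDerivAt
    have h2 : HasDerivAt (fun t => O.G (O.u t, v t))
        (fderiv ℝ O.G (O.u t, v t) (v t, deriv v t)) t :=
      HasFDerivAt.comp_hasDerivAt (f := fun t => (O.u t, v t)) t
        (O.lagr.differentiableAt hU _).hasFDerivAt (h.hasDerivAt_pair ht hv)
    -- By Euler's identity the derivative of `p(v)` is twice that of `G(u, v)`. By the equation of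
    -- motion it is also the derivative of `G(u, v)` plus the power of the reaction, which is zero.
    have h3 : (fun t => fiberDeriv O.G (O.u t, v t) (v t)) =ᶠ[𝓝 t]
        fun t => 2 * O.G (O.u t, v t) := by
      filter_upwards [Ioo_mem_nhds ht.1 ht.2] with x hx
        using O.lagr.fiberDeriv_self (h.mem_U hx) _
    have h4 := h1.unique ((h2.const_mul 2).congr_of_eventuallyEq h3)
    have h5 : deriv M t * O.n t (v t) = 0 := by
      by_cases h0 : O.φ (O.u t) = 0
      · rw [h.n_apply_eq_zero ht h0, mul_zero]
      · rw [hoff ht h0, zero_mul]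
    rw [fderiv_apply_eq] at h4 ⊢
    simp only [add_apply, smul_apply, smul_eq_mul, h5] at h4
    linarith
  refine ⟨O.G (O.u c, v c), fun t ht => ?_⟩
  have hpt := hp.2 t ht
  have hz : ∫ s in c..t, fderiv ℝ O.G (O.u s, v s) (v s, deriv v s) = 0 := by
    refine intervalIntegral.integral_zero_ae ?_
    have hne : ∀ᵐ x : ℝ, x ≠ t := by simp [ae_iff, measure_singleton]
    filter_upwards [h0, hne] with x hx hxt hx'
    rw [uIoc_of_le ht.1] at hx'
    exact hx ⟨hx'.1, (lt_of_le_of_ne hx'.2 hxt).trans_le ht.2⟩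
  rwa [hz, add_zero] at hpt

end Rep

/-- Any two Lebesgue points lie strictly between two others, so the energy is the same at all of
them. Coercivity, `κ‖g‖² ≤ p(g) = 2G`, then bounds the velocity independently of the subinterval. -/
lemma exists_uniform_velocity_bound : ∃ R, 0 ≤ R ∧ ∀ s ∈ O.good, ‖O.g s‖ ≤ R := by
  obtain ⟨κ, hκ, hmono⟩ := O.lagr.exists_strongMono O.compact_image O.image_subset
  have hconst : ∀ s ∈ O.good, ∀ t ∈ O.good, s ≤ t → O.G (O.u s, O.g s) = O.G (O.u t, O.g t) := by
    intro s hs t ht hst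
    obtain ⟨c, hc, hcI⟩ := O.exists_good le_rfl hs.1.1 hs.1.2.le
    obtain ⟨d, hd, hdI⟩ := O.exists_good ht.1.1.le ht.1.2 le_rfl
    have hcd : c < d := hcI.2.trans_le (hst.trans hdI.1.le)
    obtain ⟨R, hR, hg⟩ := O.exists_velocity_bound hc hd
    obtain ⟨v, M, C, h⟩ := O.exists_rep hc.1.1.le hcd hd.1.2.le hR hg
    obtain ⟨e, he⟩ := h.energy_const
    have hsI : s ∈ Ioo c d := ⟨hcI.2, hst.trans_lt hdI.1⟩
    have htI : t ∈ Ioo c d := ⟨hcI.2.trans_le hst, hdI.1⟩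
    rw [h.eq ⟨hs, hsI⟩, h.eq ⟨ht, htI⟩, he s (Ioo_subset_Icc_self hsI),
      he t (Ioo_subset_Icc_self htI)]
  obtain ⟨s₀, hs₀, -⟩ := O.exists_good le_rfl O.lt le_rfl
  set e := O.G (O.u s₀, O.g s₀)
  have hle : ∀ s ∈ O.good, ‖O.g s‖ ^ 2 ≤ 2 * e / κ := by
    intro s hs
    have hsI := Ioo_subset_Icc_self hs.1
    have he : O.G (O.u s, O.g s) = e := by
      rcases le_total s s₀ with hle | hle
      exacts [hconst s hs s₀ hs₀ hle, (hconst s₀ hs₀ s hs hle).symm]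
    have h := hmono _ (mem_image_of_mem _ hsI) (O.g s) 0
    rw [O.lagr.fiberDeriv_zero (O.mem s hsI), sub_zero, sub_zero,
      O.lagr.fiberDeriv_self (O.mem s hsI), he] at h
    rw [le_div_iff₀ hκ]
    linarith
  have he0 : 0 ≤ 2 * e / κ := (sq_nonneg _).trans (hle s₀ hs₀)
  -- This uses `x ≤ 1 + x²`.
  refine ⟨1 + 2 * e / κ, by positivity, fun s hs => ?_⟩
  nlinarith [hle s hs, sq_nonneg (‖O.g s‖ - 1)]

/-- Regularity up to the end points of the interval. -/
lemma exists_rep_Icc : ∃ v M C, O.Rep O.a O.b v M C := by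
  obtain ⟨R, hR, hg⟩ := O.exists_uniform_velocity_bound
  exact O.exists_rep le_rfl O.lt le_rfl hR fun s hs => hg s hs.1

end Obstacle

end ObstacleEquation

/-! ### Changes of coordinates -/

section Transition

variable {E : Type*} [NormedAddCommGroup E] [NormedSpace ℝ E] [FiniteDimensional ℝ E]

/-- The map `ψ` is a change of coordinates, defined on `V`, carrying the Lagrangian `G` to `G'`. -/
structure IsTransition (U U' V : Set E) (G G' : E × E → ℝ) (ψ : E → E) : Prop where
  left : IsLagrangian U G
  right : IsLagrangian U' G'
  isOpen : IsOpen V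
  subset : V ⊆ U
  mapsTo : MapsTo ψ V U'
  contDiffOn : ContDiffOn ℝ 2 ψ V
  surjective : ∀ q ∈ V, Function.Surjective (fderiv ℝ ψ q)
  eq : ∀ q ∈ V, ∀ v, G (q, v) = G' (ψ q, fderiv ℝ ψ q v)

namespace IsTransition

variable {U U' V : Set E} {G G' : E × E → ℝ} {ψ : E → E} (h : IsTransition U U' V G G' ψ)
include h

omit [FiniteDimensional ℝ E] in
lemma contDiffAt {q : E} (hq : q ∈ V) : ContDiffAt ℝ 2 ψ q :=
  h.contDiffOn.contDiffAt (h.isOpen.mem_nhds hq)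

omit [FiniteDimensional ℝ E] in
lemma hasFDerivAt {q : E} (hq : q ∈ V) : HasFDerivAt ψ (fderiv ℝ ψ q) q :=
  ((h.contDiffAt hq).differentiableAt (by norm_num)).hasFDerivAt

omit [FiniteDimensional ℝ E] in
lemma hasFDerivAt_fderiv {q : E} (hq : q ∈ V) :
    HasFDerivAt (fderiv ℝ ψ) (fderiv ℝ (fderiv ℝ ψ) q) q :=
  (((h.contDiffAt hq).fderiv_right (m := 1) (by norm_num)).differentiableAt
    (by norm_num)).hasFDerivAt

omit [FiniteDimensional ℝ E] in
lemma symm {q : E} (hq : q ∈ V) (v w : E) :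
    fderiv ℝ (fderiv ℝ ψ) q v w = fderiv ℝ (fderiv ℝ ψ) q w v :=
  ((h.contDiffAt hq).isSymmSndFDerivAt (by simp)).eq v w

lemma injective {q : E} (hq : q ∈ V) : Function.Injective (fderiv ℝ ψ q) :=
  (LinearMap.injective_iff_surjective (f := (fderiv ℝ ψ q : E →ₗ[ℝ] E))).2 (h.surjective q hq)

lemma ne_zero {q : E} (hq : q ∈ V) {v : E} (hv : v ≠ 0) : fderiv ℝ ψ q v ≠ 0 := fun h0 =>
  hv (h.injective hq (by rw [h0, map_zero]))

/-- This is the chain rule for `G'` composed with the tangent map of `ψ`, whose fiber component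
depends on the base point through the derivative of `ψ`. -/
lemma fderiv_eq {q : E} (hq : q ∈ V) (v ξ η : E) :
    fderiv ℝ G (q, v) (ξ, η) = fderiv ℝ G' (ψ q, fderiv ℝ ψ q v)
      (fderiv ℝ ψ q ξ, fderiv ℝ (fderiv ℝ ψ) q ξ v + fderiv ℝ ψ q η) := by
  have h1 : HasFDerivAt (fun z : E × E => (ψ z.1, fderiv ℝ ψ z.1 z.2))
      _ (q, v) :=
    ((h.hasFDerivAt hq).comp (q, v) hasFDerivAt_fst).prodMk
      (((h.hasFDerivAt_fderiv hq).comp (q, v) hasFDerivAt_fst).clm_apply hasFDerivAt_snd)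
  have h2 := HasFDerivAt.comp (f := fun z : E × E => (ψ z.1, fderiv ℝ ψ z.1 z.2)) (q, v)
    (h.right.differentiableAt (h.mapsTo hq) (fderiv ℝ ψ q v)).hasFDerivAt h1
  have h3 : G =ᶠ[𝓝 (q, v)] G' ∘ (fun z : E × E => (ψ z.1, fderiv ℝ ψ z.1 z.2)) := by
    have : ∀ᶠ z : E × E in 𝓝 (q, v), z.1 ∈ V :=
      continuousAt_fst.eventually (h.isOpen.mem_nhds hq)
    filter_upwards [this] with z hz using h.eq z.1 hz z.2
  have h4 := (h2.congr_of_eventuallyEq h3).fderiv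
  rw [h4]
  simp [add_comm]

lemma fiberDeriv_eq {q : E} (hq : q ∈ V) (v η : E) :
    fiberDeriv G (q, v) η = fiberDeriv G' (ψ q, fderiv ℝ ψ q v) (fderiv ℝ ψ q η) := by
  rw [fiberDeriv_apply, h.fderiv_eq hq, fiberDeriv_apply]
  simp

lemma baseDeriv_eq {q : E} (hq : q ∈ V) (v ξ : E) :
    baseDeriv G (q, v) ξ = baseDeriv G' (ψ q, fderiv ℝ ψ q v) (fderiv ℝ ψ q ξ) +
      fiberDeriv G' (ψ q, fderiv ℝ ψ q v) (fderiv ℝ (fderiv ℝ ψ) q ξ v) := by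
  rw [baseDeriv_apply, h.fderiv_eq hq, fderiv_apply_eq]
  simp

/-- The base point stays fixed along `v + t • w`, so no second derivative of `ψ` enters. -/
lemma fiberHess_eq {q : E} (hq : q ∈ V) {v : E} (hv : v ≠ 0) (w η : E) :
    fderiv ℝ (fderiv ℝ G) (q, v) (0, w) (0, η) =
      fderiv ℝ (fderiv ℝ G') (ψ q, fderiv ℝ ψ q v) (0, fderiv ℝ ψ q w) (0, fderiv ℝ ψ q η) := by
  have hc : HasDerivAt (fun t : ℝ => v + t • w) w 0 := by
    simpa using ((hasDerivAt_id (0 : ℝ)).smul_const w).const_add v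
  have h1 : HasDerivAt (fun t : ℝ => (q, v + t • w)) ((0 : E), w) 0 :=
    (hasDerivAt_const (0 : ℝ) q).prodMk hc
  have h2 : HasDerivAt (fun t : ℝ => (ψ q, fderiv ℝ ψ q (v + t • w)))
      ((0 : E), fderiv ℝ ψ q w) 0 :=
    (hasDerivAt_const (0 : ℝ) _).prodMk ((fderiv ℝ ψ q).hasFDerivAt.comp_hasDerivAt 0 hc)
  have d1 : HasFDerivAt (fderiv ℝ G) (fderiv ℝ (fderiv ℝ G) (q, v)) (q, v + (0 : ℝ) • w) := by
    rw [zero_smul, add_zero]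
    exact ((h.left.contDiffAt_fderiv (h.subset hq) hv).differentiableAt (by norm_num)).hasFDerivAt
  have d2 : HasFDerivAt (fderiv ℝ G') (fderiv ℝ (fderiv ℝ G') (ψ q, fderiv ℝ ψ q v))
      (ψ q, fderiv ℝ ψ q (v + (0 : ℝ) • w)) := by
    rw [zero_smul, add_zero]
    exact ((h.right.contDiffAt_fderiv (h.mapsTo hq) (h.ne_zero hq hv)).differentiableAt
      (by norm_num)).hasFDerivAt
  have e1 := (HasFDerivAt.comp_hasDerivAt (f := fun t : ℝ => (q, v + t • w)) 0 d1 h1).clm_apply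
    (hasDerivAt_const (0 : ℝ) ((0 : E), η))
  have e2 := (HasFDerivAt.comp_hasDerivAt (f := fun t : ℝ => (ψ q, fderiv ℝ ψ q (v + t • w)))
    0 d2 h2).clm_apply (hasDerivAt_const (0 : ℝ) ((0 : E), fderiv ℝ ψ q η))
  rw [map_zero, add_zero] at e1 e2
  refine e1.unique (e2.congr_of_eventuallyEq (Eventually.of_forall fun t => ?_))
  exact h.fiberDeriv_eq hq (v + t • w) η

end IsTransition

/-- The Euler–Lagrange equation of `G` for a curve with position `q`, velocity `v` and
acceleration `a`. -/
def EulerLagrange (G : E × E → ℝ) (q v a : E) : Prop :=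
  ∀ w, fderiv ℝ (fderiv ℝ G) (q, v) (v, a) (0, w) = baseDeriv G (q, v) w

omit [FiniteDimensional ℝ E] in
lemma IsLagrangian.hasDerivAt_fiberDeriv {U : Set E} {G : E × E → ℝ} (hG : IsLagrangian U G)
    {c v : ℝ → E} {c' v' : E} {s : ℝ} (hq : c s ∈ U) (hv : v s ≠ 0) (hc : HasDerivAt c c' s)
    (hv' : HasDerivAt v v' s) (w : E) :
    HasDerivAt (fun t => fiberDeriv G (c t, v t) w)
      (fderiv ℝ (fderiv ℝ G) (c s, v s) (c', v') (0, w)) s := by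
  have d1 : HasFDerivAt (fderiv ℝ G) (fderiv ℝ (fderiv ℝ G) (c s, v s)) (c s, v s) :=
    ((hG.contDiffAt_fderiv hq hv).differentiableAt (by norm_num)).hasFDerivAt
  have e1 := (HasFDerivAt.comp_hasDerivAt (f := fun t : ℝ => (c t, v t)) s d1
    (hc.prodMk hv')).clm_apply (hasDerivAt_const s ((0 : E), w))
  rw [map_zero, add_zero] at e1
  exact e1

lemma IsTransition.eulerLagrange {U U' V : Set E} {G G' : E × E → ℝ} {ψ : E → E}
    (h : IsTransition U U' V G G' ψ) {q v a : E} (hq : q ∈ V) (hv : v ≠ 0)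
    (hEL : EulerLagrange G q v a) :
    EulerLagrange G' (ψ q) (fderiv ℝ ψ q v)
      (fderiv ℝ (fderiv ℝ ψ) q v v + fderiv ℝ ψ q a) := by
  intro w'
  obtain ⟨w, rfl⟩ := h.surjective q hq w'
  -- The equation depends only on the 2-jet of a curve, so a parabola serves to compare the
  -- derivatives of the momentum in the two coordinate systems.
  let c : ℝ → E := fun t => q + t • v + (t ^ 2 / 2) • a
  let c' : ℝ → E := fun t => v + t • a
  have hc : ∀ t, HasDerivAt c (c' t) t := fun t => by
    have h1 := (((hasDerivAt_id t).smul_const v).const_add q).add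
      (((hasDerivAt_pow 2 t).div_const 2).smul_const a)
    exact HasDerivAt.congr_deriv (f := c) h1 (by simp [c'])
  have hc' : HasDerivAt c' a 0 := by
    have h1 := ((hasDerivAt_id (0 : ℝ)).smul_const a).const_add v
    rw [one_smul] at h1
    exact h1
  have hc0 : c 0 = q := by simp [c]
  have hc0' : c' 0 = v := by simp [c']
  have hcV : ∀ᶠ t in 𝓝 (0 : ℝ), c t ∈ V :=
    (hc 0).continuousAt.eventually (h.isOpen.mem_nhds (hc0.symm ▸ hq))
  have hq' : c 0 ∈ V := hc0.symm ▸ hq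
  have e1 := h.left.hasDerivAt_fiberDeriv (h.subset hq') (hc0'.symm ▸ hv) (hc 0) hc' w
  have hD : HasDerivAt (fun t => fderiv ℝ ψ (c t)) (fderiv ℝ (fderiv ℝ ψ) q v) 0 := by
    have := (h.hasFDerivAt_fderiv hq').comp_hasDerivAt 0 (hc 0)
    rwa [hc0, hc0'] at this
  have hψ : HasDerivAt (fun t => ψ (c t)) (fderiv ℝ ψ q v) 0 := by
    have := (h.hasFDerivAt hq').comp_hasDerivAt 0 (hc 0)
    rwa [hc0, hc0'] at this
  have hv2 : HasDerivAt (fun t => fderiv ℝ ψ (c t) (c' t))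
      (fderiv ℝ (fderiv ℝ ψ) q v v + fderiv ℝ ψ q a) 0 := by
    have := hD.clm_apply hc'
    rwa [hc0, hc0'] at this
  have hw2 : HasDerivAt (fun t => fderiv ℝ ψ (c t) w) (fderiv ℝ (fderiv ℝ ψ) q v w) 0 := by
    have := hD.clm_apply (hasDerivAt_const 0 w)
    rwa [map_zero, add_zero] at this
  have d2 : HasFDerivAt (fderiv ℝ G') (fderiv ℝ (fderiv ℝ G') (ψ q, fderiv ℝ ψ q v))
      (ψ (c 0), fderiv ℝ ψ (c 0) (c' 0)) := by
    rw [hc0, hc0']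
    exact ((h.right.contDiffAt_fderiv (h.mapsTo hq) (h.ne_zero hq hv)).differentiableAt
      (by norm_num)).hasFDerivAt
  have e2 := (HasFDerivAt.comp_hasDerivAt (f := fun t : ℝ => (ψ (c t), fderiv ℝ ψ (c t) (c' t)))
    0 d2 (hψ.prodMk hv2)).clm_apply ((hasDerivAt_const 0 (0 : E)).prodMk hw2)
  have e3 := e1.unique (e2.congr_of_eventuallyEq (by
    filter_upwards [hcV] with t ht
    exact h.fiberDeriv_eq ht (c' t) w))
  simp only [Function.comp_apply, hc0, hc0'] at e3
  have e4 := hEL w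
  -- The second derivative of `ψ` enters both the transformed force and the derivative of the
  -- transported direction; by symmetry the two terms cancel.
  rw [e4, h.baseDeriv_eq hq, h.symm hq w v] at e3
  have : ∀ η, fderiv ℝ G' (ψ q, fderiv ℝ ψ q v) (0, η) = fiberDeriv G' (ψ q, fderiv ℝ ψ q v) η :=
    fun _ => rfl
  rw [this] at e3
  linarith

end Transition

/-! ### Local existence of geodesics -/

section Geodesics

variable {E : Type*} [NormedAddCommGroup E] [NormedSpace ℝ E] [FiniteDimensional ℝ E]

omit [FiniteDimensional ℝ E] in
lemma contDiffOn_succ_of_hasDerivAt {f f' : ℝ → E} {s : Set ℝ} {n m : ℕ} (hs : IsOpen s)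
    (hf : ∀ t ∈ s, HasDerivAt f (f' t) t) (hf' : ContDiffOn ℝ n f' s) (hm : m = n + 1 := by rfl) :
    ContDiffOn ℝ m f s := by
  subst hm
  push_cast
  rw [contDiffOn_succ_iff_deriv_of_isOpen hs]
  exact ⟨fun t ht => (hf t ht).differentiableAt.differentiableWithinAt, by simp,
    hf'.congr fun t ht => (hf t ht).deriv⟩

/-- The vertical Hessian of `G`, as an operator from `E` to its dual. -/
noncomputable def fiberHess (G : E × E → ℝ) (z : E × E) : E →L[ℝ] (E →L[ℝ] ℝ) :=
  ((ContinuousLinearMap.compL ℝ E (E × E) ℝ).flip (ContinuousLinearMap.inr ℝ E E)).comp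
    ((fderiv ℝ (fderiv ℝ G) z).comp (ContinuousLinearMap.inr ℝ E E))

omit [FiniteDimensional ℝ E] in
lemma fiberHess_apply (G : E × E → ℝ) (z : E × E) (w η : E) :
    fiberHess G z w η = fderiv ℝ (fderiv ℝ G) z (0, w) (0, η) := rfl

namespace IsLagrangian

variable {U : Set E} {G : E × E → ℝ} (hG : IsLagrangian U G)
include hG

/-- The vertical Hessian as a linear equivalence. -/
lemma exists_fiberHess_equiv {q : E} (hq : q ∈ U) {v : E} (hv : v ≠ 0) :
    ∃ A : E ≃L[ℝ] (E →L[ℝ] ℝ), (A : E →L[ℝ] (E →L[ℝ] ℝ)) = fiberHess G (q, v) := by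
  have hinj : Function.Injective (fiberHess G (q, v) : E →ₗ[ℝ] (E →L[ℝ] ℝ)) := by
    rw [← LinearMap.ker_eq_bot, LinearMap.ker_eq_bot']
    intro w hw
    by_contra hw0
    have h1 := hG.posDef q hq v hv w hw0
    rw [← fiberHess_apply] at h1
    have h2 : fiberHess G (q, v) w = 0 := hw
    rw [h2] at h1
    exact lt_irrefl _ h1
  have hfin : Module.finrank ℝ E = Module.finrank ℝ (E →L[ℝ] ℝ) := by
    rw [← (LinearMap.toContinuousLinearMap (𝕜 := ℝ) (E := E) (F' := ℝ)).finrank_eq]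
    exact (Subspace.dual_finrank_eq).symm
  exact ⟨(LinearEquiv.ofInjectiveOfFinrankEq _ hinj hfin).toContinuousLinearEquiv, by
    ext w; rfl⟩

/-- The dual vector of a covector with respect to the vertical Hessian. -/
lemma exists_fiberHess_eq {q : E} (hq : q ∈ U) {v : E} (hv : v ≠ 0) (n : E →L[ℝ] ℝ) :
    ∃ w, ∀ η, fderiv ℝ (fderiv ℝ G) (q, v) (0, w) (0, η) = n η := by
  obtain ⟨A, hA⟩ := hG.exists_fiberHess_equiv hq hv
  refine ⟨A.symm n, fun η => ?_⟩
  rw [← fiberHess_apply, ← hA]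
  simp

/-- The Euler–Lagrange equation is solved for the acceleration by inverting the vertical Hessian.
The solution is `C^1` because `G` is `C^3` there, which suffices for the local existence theorem for
differential equations. -/
lemma exists_spray {q : E} (hq : q ∈ U) {v : E} (hv : v ≠ 0) :
    ∃ Γ : E × E → E, ContDiffAt ℝ 1 Γ (q, v) ∧
      ∀ᶠ z in 𝓝 (q, v), EulerLagrange G z.1 z.2 (Γ z) := by
  let D := fderiv ℝ (fderiv ℝ G)
  let R : (E × E →L[ℝ] ℝ) →L[ℝ] (E →L[ℝ] ℝ) :=
    (ContinuousLinearMap.compL ℝ E (E × E) ℝ).flip (ContinuousLinearMap.inr ℝ E E)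
  let Γ : E × E → E := fun z =>
    (fiberHess G z).inverse (baseDeriv G z - R (D z (z.2, 0)))
  have hD : ContDiffAt ℝ 1 D (q, v) :=
    (hG.contDiffAt_fderiv hq hv).fderiv_right (by norm_num)
  have hH : ContDiffAt ℝ 1 (fiberHess G) (q, v) :=
    contDiffAt_const.clm_comp (hD.clm_comp contDiffAt_const)
  obtain ⟨A, hA⟩ := hG.exists_fiberHess_equiv hq hv
  have hinv : ContDiffAt ℝ 1 (fun z => (fiberHess G z).inverse) (q, v) := by
    have h1 := contDiffAt_map_inverse (𝕜 := ℝ) (n := 1) A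
    rw [hA] at h1
    exact h1.comp (q, v) hH
  refine ⟨Γ, hinv.clm_apply ((ContDiffAt.clm_comp ((hG.contDiffAt_fderiv hq hv).of_le
    (by norm_num)) contDiffAt_const).sub (R.contDiff.contDiffAt.comp (q, v)
    (hD.clm_apply (contDiffAt_snd.prodMk contDiffAt_const)))), ?_⟩
  have hU : ∀ᶠ z : E × E in 𝓝 (q, v), z.1 ∈ U :=
    continuousAt_fst.eventually (hG.isOpen.mem_nhds hq)
  have hne : ∀ᶠ z : E × E in 𝓝 (q, v), z.2 ≠ 0 :=
    continuousAt_snd.eventually_ne hv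
  filter_upwards [hU, hne] with z hz hz' w
  obtain ⟨B, hB⟩ := hG.exists_fiberHess_equiv hz hz'
  have h1 : fiberHess G z (Γ z) = baseDeriv G z - R (D z (z.2, 0)) := by
    simp only [Γ]
    rw [show fiberHess G z = B from hB.symm]
    simp
  have h2 : ((z.2, Γ z) : E × E) = (z.2, 0) + (0, Γ z) := by simp
  have h3 := DFunLike.congr_fun h1 w
  rw [fiberHess_apply] at h3
  change D z (z.2, Γ z) (0, w) = _
  rw [h2, map_add, add_apply]
  rw [show D z (0, Γ z) (0, w) = _ from h3, sub_apply]
  change D z (z.2, 0) (0, w) + (baseDeriv G z w - D z (z.2, 0) (0, w)) = _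
  ring

lemma exists_geodesic {q : E} (hq : q ∈ U) {v : E} (hv : v ≠ 0) :
    ∃ c : ℝ → E, ∃ ε > 0, c 0 = q ∧ deriv c 0 = v ∧ ∀ t ∈ Ioo (-ε) ε, c t ∈ U ∧
      ContDiffAt ℝ 2 c t ∧ deriv c t ≠ 0 ∧
      EulerLagrange G (c t) (deriv c t) (deriv (deriv c) t) := by
  obtain ⟨Γ, hΓ, hEL⟩ := hG.exists_spray hq hv
  have hf : ContDiffAt ℝ 1 (fun z : E × E => (z.2, Γ z)) (q, v) := contDiffAt_snd.prodMk hΓ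
  obtain ⟨α, hα0, ε, hε, hα⟩ := hf.exists_forall_mem_closedBall_exists_eq_forall_mem_Ioo_hasDerivAt₀ 0
  have hα' : ∀ t ∈ Ioo (-ε) ε, HasDerivAt α ((α t).2, Γ (α t)) t := by simpa using hα
  have h0 : (0 : ℝ) ∈ Ioo (-ε) ε := ⟨by linarith, hε⟩
  have hαc : ContinuousAt α 0 := (hα' 0 h0).continuousAt
  have hΓ1 : ∀ᶠ z in 𝓝 (q, v), ContDiffAt ℝ 1 Γ z := hΓ.eventually (by simp)
  have hU : ∀ᶠ z : E × E in 𝓝 (q, v), z.1 ∈ U :=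
    continuousAt_fst.eventually (hG.isOpen.mem_nhds hq)
  have hne : ∀ᶠ z : E × E in 𝓝 (q, v), z.2 ≠ 0 :=
    continuousAt_snd.eventually_ne hv
  have hall : ∀ᶠ t in 𝓝 (0 : ℝ), ContDiffAt ℝ 1 Γ (α t) ∧ (α t).1 ∈ U ∧ (α t).2 ≠ 0 ∧
      EulerLagrange G (α t).1 (α t).2 (Γ (α t)) := by
    have h1 := hΓ1.and (hU.and (hne.and hEL))
    rw [← hα0] at h1
    exact hαc.eventually h1
  obtain ⟨δ, hδ, hδ'⟩ := Metric.eventually_nhds_iff.1 hall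
  have hsub : ∀ t ∈ Ioo (-min ε δ) (min ε δ), t ∈ Ioo (-ε) ε ∧ dist t 0 < δ := by
    intro t ht
    refine ⟨⟨(neg_le_neg (min_le_left ε δ)).trans_lt ht.1, ht.2.trans_le (min_le_left ε δ)⟩, ?_⟩
    rw [Real.dist_eq, sub_zero, abs_lt]
    exact ⟨(neg_le_neg (min_le_right ε δ)).trans_lt ht.1, ht.2.trans_le (min_le_right ε δ)⟩
  have hd1 : ∀ t ∈ Ioo (-ε) ε, HasDerivAt (fun t => (α t).1) (α t).2 t := fun t ht =>
    (hα' t ht).fst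
  have hd2 : ∀ t ∈ Ioo (-ε) ε, HasDerivAt (fun t => (α t).2) (Γ (α t)) t := fun t ht =>
    (hα' t ht).snd
  have hdd : ∀ t ∈ Ioo (-ε) ε, deriv (fun t => (α t).1) =ᶠ[𝓝 t] fun t => (α t).2 := by
    intro t ht
    filter_upwards [Ioo_mem_nhds ht.1 ht.2] with r hr using (hd1 r hr).deriv
  refine ⟨fun t => (α t).1, min ε δ, lt_min hε hδ, by simp [hα0], ?_, fun t ht => ?_⟩
  · rw [(hd1 0 h0).deriv, hα0]
  obtain ⟨ht1, ht2⟩ := hsub t ht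
  obtain ⟨k1, k2, k3, k4⟩ := hδ' ht2
  refine ⟨k2, ?_, ?_, ?_⟩
  · have hopen : IsOpen (Ioo (-min ε δ) (min ε δ)) := isOpen_Ioo
    have c0 : ContDiffOn ℝ 0 (fun t => Γ (α t)) (Ioo (-min ε δ) (min ε δ)) :=
      contDiffOn_zero.2 fun r hr => (ContinuousAt.comp (f := α)
        (hδ' (hsub r hr).2).1.continuousAt (hα' r (hsub r hr).1).continuousAt).continuousWithinAt
    have c1 : ContDiffOn ℝ 1 (fun t => (α t).2) (Ioo (-min ε δ) (min ε δ)) :=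
      contDiffOn_succ_of_hasDerivAt (n := 0) (m := 1) hopen (fun r hr => hd2 r (hsub r hr).1) c0
    have c2 : ContDiffOn ℝ 2 (fun t => (α t).1) (Ioo (-min ε δ) (min ε δ)) :=
      contDiffOn_succ_of_hasDerivAt (n := 1) (m := 2) hopen (fun r hr => hd1 r (hsub r hr).1) c1
    exact c2.contDiffAt (hopen.mem_nhds ht)
  · rwa [(hd1 t ht1).deriv]
  · rw [(hd1 t ht1).deriv, (hdd t ht1).deriv_eq, (hd2 t ht1).deriv]
    exact k4

end IsLagrangian

end Geodesics

/-! ### Partial derivatives in coordinates -/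

section Coordinates

variable {N : ℕ}

lemma apply_eq_sum (L : EuclideanSpace ℝ (Fin N) →L[ℝ] ℝ) (w : EuclideanSpace ℝ (Fin N)) :
    L w = ∑ i, w i * L (EuclideanSpace.single i 1) := by
  have h := (EuclideanSpace.basisFun (Fin N) ℝ).sum_repr w
  conv_lhs => rw [← h]
  rw [map_sum]
  simp

lemma eq_zero_of_single {L : EuclideanSpace ℝ (Fin N) →L[ℝ] ℝ}
    (h : ∀ i, L (EuclideanSpace.single i 1) = 0) : L = 0 := by
  ext w
  rw [apply_eq_sum]
  simp [h]

variable {H : EuclideanSpace ℝ (Fin N) → EuclideanSpace ℝ (Fin N) → ℝ}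
  {U : Set (EuclideanSpace ℝ (Fin N))}

lemma dv_eq_of_differentiableAt {q v : EuclideanSpace ℝ (Fin N)}
    (h : DifferentiableAt ℝ (Function.uncurry H) (q, v)) (i : Fin N) :
    dv H i q v = fiberDeriv (Function.uncurry H) (q, v) (EuclideanSpace.single i 1) := by
  have h1 : HasFDerivAt (fun w => Function.uncurry H (q, w)) _ v :=
    HasFDerivAt.comp (f := fun w => (q, w)) v h.hasFDerivAt (hasFDerivAt_prodMk_right q v)
  exact DFunLike.congr_fun h1.fderiv _

lemma dq_eq_of_differentiableAt {q v : EuclideanSpace ℝ (Fin N)}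
    (h : DifferentiableAt ℝ (Function.uncurry H) (q, v)) (i : Fin N) :
    dq H i q v = baseDeriv (Function.uncurry H) (q, v) (EuclideanSpace.single i 1) := by
  have h1 : HasFDerivAt (fun y => Function.uncurry H (y, v)) _ q :=
    HasFDerivAt.comp (f := fun y => (y, v)) q h.hasFDerivAt (hasFDerivAt_prodMk_left q v)
  exact DFunLike.congr_fun h1.fderiv _

section SecondOrder

variable {q v : EuclideanSpace ℝ (Fin N)} (h : ContDiffAt ℝ 3 (Function.uncurry H) (q, v))
include h

lemma eventually_dv_eq (j : Fin N) : ∀ᶠ z in 𝓝 (q, v), dv H j z.1 z.2 =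
    fderiv ℝ (Function.uncurry H) z (0, EuclideanSpace.single j 1) := by
  filter_upwards [h.eventually (by simp)] with z hz
  exact dv_eq_of_differentiableAt (hz.differentiableAt (by norm_num)) j

lemma hasFDerivAt_dv (j : Fin N) : HasFDerivAt (fun z : _ × _ => dv H j z.1 z.2)
    ((fderiv ℝ (fderiv ℝ (Function.uncurry H)) (q, v)).flip
      (0, EuclideanSpace.single j 1)) (q, v) := by
  have h1 : HasFDerivAt (fderiv ℝ (Function.uncurry H))
      (fderiv ℝ (fderiv ℝ (Function.uncurry H)) (q, v)) (q, v) :=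
    ((h.fderiv_right (m := 2) (by norm_num)).differentiableAt (by norm_num)).hasFDerivAt
  have h2 := h1.clm_apply (hasFDerivAt_const ((0 : EuclideanSpace ℝ (Fin N)),
    EuclideanSpace.single j (1 : ℝ)) (q, v))
  have h3 := h2.congr_of_eventuallyEq (eventually_dv_eq h j)
  rwa [ContinuousLinearMap.comp_zero, zero_add] at h3

lemma dv_dv_eq (i j : Fin N) : dv (dv H j) i q v = fderiv ℝ (fderiv ℝ (Function.uncurry H)) (q, v)
      (0, EuclideanSpace.single i 1) (0, EuclideanSpace.single j 1) := by
  have h1 := HasFDerivAt.comp (f := fun w => (q, w)) v (hasFDerivAt_dv h j)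
    (hasFDerivAt_prodMk_right q v)
  exact DFunLike.congr_fun h1.fderiv _

lemma dq_dv_eq (k j : Fin N) : dq (dv H j) k q v = fderiv ℝ (fderiv ℝ (Function.uncurry H)) (q, v)
      (EuclideanSpace.single k 1, 0) (0, EuclideanSpace.single j 1) := by
  have h1 := HasFDerivAt.comp (f := fun y => (y, v)) q (hasFDerivAt_dv h j)
    (hasFDerivAt_prodMk_left q v)
  exact DFunLike.congr_fun h1.fderiv _

lemma sum_gMatrix (w : EuclideanSpace ℝ (Fin N)) (j : Fin N) :
    fderiv ℝ (fderiv ℝ (Function.uncurry H)) (q, v) (0, w) (0, EuclideanSpace.single j 1) =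
      2 * ∑ i, gMatrix H q v i j * w i := by
  have h1 := apply_eq_sum ((((fderiv ℝ (fderiv ℝ (Function.uncurry H)) (q, v)).flip
    (0, EuclideanSpace.single j 1))).comp (ContinuousLinearMap.inr ℝ _ _)) w
  rw [Finset.mul_sum]
  refine h1.trans (Finset.sum_congr rfl fun i _ => ?_)
  simp only [gMatrix, Matrix.of_apply, dv_dv_eq h i j]
  simp only [ContinuousLinearMap.comp_apply, ContinuousLinearMap.flip_apply,
    ContinuousLinearMap.inr_apply]
  ring

lemma sum_dq_dv (w : EuclideanSpace ℝ (Fin N)) (j : Fin N) :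
    fderiv ℝ (fderiv ℝ (Function.uncurry H)) (q, v) (w, 0) (0, EuclideanSpace.single j 1) =
      ∑ k, dq (dv H j) k q v * w k := by
  have h1 := apply_eq_sum ((((fderiv ℝ (fderiv ℝ (Function.uncurry H)) (q, v)).flip
    (0, EuclideanSpace.single j 1))).comp (ContinuousLinearMap.inl ℝ _ _)) w
  refine h1.trans (Finset.sum_congr rfl fun i _ => ?_)
  rw [dq_dv_eq h i j, mul_comm]
  rfl

lemma gMatrix_quadratic (w : EuclideanSpace ℝ (Fin N)) :
    fderiv ℝ (fderiv ℝ (Function.uncurry H)) (q, v) (0, w) (0, w) =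
      2 * (w.ofLp ⬝ᵥ (gMatrix H q v).mulVec w.ofLp) := by
  have h1 := apply_eq_sum (((fderiv ℝ (fderiv ℝ (Function.uncurry H)) (q, v)) (0, w)).comp
    (ContinuousLinearMap.inr ℝ _ _)) w
  refine h1.trans ?_
  simp only [ContinuousLinearMap.comp_apply, ContinuousLinearMap.inr_apply, sum_gMatrix h,
    dotProduct, Matrix.mulVec, Finset.mul_sum]
  rw [Finset.sum_comm]
  refine Finset.sum_congr rfl fun i _ => Finset.sum_congr rfl fun j _ => ?_
  ring

end SecondOrder

lemma isLagrangian_of_posDef (hU : IsOpen U)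
    (hC : ∀ q ∈ U, ∀ v ≠ 0, ContDiffAt ℝ 3 (Function.uncurry H) (q, v))
    (hh : ∀ q ∈ U, ∀ v, ∀ c : ℝ, 0 < c → H q (c • v) = c ^ 2 * H q v)
    (hp : ∀ q ∈ U, ∀ v ≠ 0, (gMatrix H q v).PosDef) : IsLagrangian U (Function.uncurry H) where
  isOpen := hU
  contDiffAt := hC
  homog := hh
  posDef q hq v hv w hw := by
    rw [gMatrix_quadratic (hC q hq v hv)]
    have := (hp q hq v hv).dotProduct_mulVec_pos (x := w.ofLp)
      (fun h0 => hw (by ext i; exact congrFun h0 i))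
    simp only [star_trivial] at this
    linarith

namespace IsLagrangian

variable (hG : IsLagrangian U (Function.uncurry H)) {q v : EuclideanSpace ℝ (Fin N)}
include hG

lemma dv_eq (hq : q ∈ U) (i : Fin N) :
    dv H i q v = fiberDeriv (Function.uncurry H) (q, v) (EuclideanSpace.single i 1) :=
  dv_eq_of_differentiableAt (hG.differentiableAt hq v) i

lemma dq_eq (hq : q ∈ U) (i : Fin N) :
    dq H i q v = baseDeriv (Function.uncurry H) (q, v) (EuclideanSpace.single i 1) :=
  dq_eq_of_differentiableAt (hG.differentiableAt hq v) i

lemma fderiv_eq_sum (hq : q ∈ U) (ξ η : EuclideanSpace ℝ (Fin N)) :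
    fderiv ℝ (Function.uncurry H) (q, v) (ξ, η) = ∑ i, (dq H i q v * ξ i + dv H i q v * η i) := by
  rw [fderiv_apply_eq, apply_eq_sum (baseDeriv _ _), apply_eq_sum (fiberDeriv _ _),
    ← Finset.sum_add_distrib]
  refine Finset.sum_congr rfl fun i _ => ?_
  rw [hG.dq_eq hq, hG.dv_eq hq]
  ring

lemma gMatrix_mulVec_eq (hq : q ∈ U) (hv : v ≠ 0) (hp : (gMatrix H q v).PosDef)
    {w : EuclideanSpace ℝ (Fin N)} {n : Fin N → ℝ} :
    (∀ j, fderiv ℝ (fderiv ℝ (Function.uncurry H)) (q, v) (0, w) (0, EuclideanSpace.single j 1) =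
      2 * n j) ↔ w.ofLp = (gMatrix H q v)⁻¹.mulVec n := by
  have hdet : IsUnit (gMatrix H q v).det := hp.isUnit.map Matrix.detMonoidHom
  have hsymm : ∀ i j, gMatrix H q v i j = gMatrix H q v j i := fun i j => by
    have := hp.isHermitian.apply j i
    simpa using this
  have h1 : (∀ j, fderiv ℝ (fderiv ℝ (Function.uncurry H)) (q, v) (0, w)
      (0, EuclideanSpace.single j 1) = 2 * n j) ↔ (gMatrix H q v).mulVec w.ofLp = n := by
    rw [funext_iff]
    refine forall_congr' fun j => ?_
    rw [sum_gMatrix (hG.contDiffAt q hq v hv)]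
    simp only [Matrix.mulVec, dotProduct]
    rw [mul_right_inj' two_ne_zero]
    simp only [hsymm _ j]
  rw [h1]
  constructor
  · rintro rfl
    rw [Matrix.mulVec_mulVec, Matrix.nonsing_inv_mul _ hdet, Matrix.one_mulVec]
  · intro h
    rw [h, Matrix.mulVec_mulVec, Matrix.mul_nonsing_inv _ hdet, Matrix.one_mulVec]

/-- In coordinates the acceleration enters the Euler–Lagrange equation through `2 g a`; applying
`g⁻¹` gives the explicit form. -/
lemma geodesic_iff (hq : q ∈ U) (hv : v ≠ 0) (hp : (gMatrix H q v).PosDef)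
    (a : EuclideanSpace ℝ (Fin N)) :
    (∀ i, a i + (1 / 2) * ∑ j, (gMatrix H q v)⁻¹ i j *
      ((∑ k, dq (dv H j) k q v * v k) - dq H j q v) = 0) ↔
        EulerLagrange (Function.uncurry H) q v a := by
  have h1 := hG.gMatrix_mulVec_eq hq hv hp (w := a)
    (n := fun j => (1 / 2) * (dq H j q v - (∑ k, dq (dv H j) k q v * v k)))
  have h2 : EulerLagrange (Function.uncurry H) q v a ↔ ∀ j,
      fderiv ℝ (fderiv ℝ (Function.uncurry H)) (q, v) (0, a) (0, EuclideanSpace.single j 1) =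
      2 * ((1 / 2) * (dq H j q v - (∑ k, dq (dv H j) k q v * v k))) := by
    have h3 : ∀ w, fderiv ℝ (fderiv ℝ (Function.uncurry H)) (q, v) (v, a) w =
        fderiv ℝ (fderiv ℝ (Function.uncurry H)) (q, v) (v, 0) w +
        fderiv ℝ (fderiv ℝ (Function.uncurry H)) (q, v) (0, a) w := fun w => by
      rw [← add_apply, ← map_add]; simp
    constructor
    · intro h j
      have := h (EuclideanSpace.single j 1)
      rw [h3, sum_dq_dv (hG.contDiffAt q hq v hv), ← hG.dq_eq hq] at this
      linarith
    · intro h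
      have : ((fderiv ℝ (fderiv ℝ (Function.uncurry H)) (q, v) (v, a)).comp
          (ContinuousLinearMap.inr ℝ _ _) - baseDeriv (Function.uncurry H) (q, v)) = 0 := by
        refine eq_zero_of_single fun j => ?_
        rw [sub_apply, ← hG.dq_eq hq]
        change fderiv ℝ (fderiv ℝ (Function.uncurry H)) (q, v) (v, a)
          (0, EuclideanSpace.single j 1) - _ = 0
        rw [h3, sum_dq_dv (hG.contDiffAt q hq v hv), h j]
        ring
      exact fun w => DFunLike.congr_fun (sub_eq_zero.1 this) w
  rw [h2, h1, funext_iff]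
  refine forall_congr' fun i => ?_
  simp only [Matrix.mulVec, dotProduct]
  have : ∑ j, (gMatrix H q v)⁻¹ i j * (1 / 2 * (dq H j q v - ∑ k, dq (dv H j) k q v * v k)) =
      -((1 / 2) * ∑ j, (gMatrix H q v)⁻¹ i j *
        ((∑ k, dq (dv H j) k q v * v k) - dq H j q v)) := by
    rw [Finset.mul_sum, ← Finset.sum_neg_distrib]
    exact Finset.sum_congr rfl fun j _ => by ring
  rw [this]
  constructor <;> intro h <;> linarith

/-- The hypothesis says that `w` has components `g^{ij} n_j`; the factor 2 compensates the half in
the definition of `g`. -/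
lemma sum_inv_eq (hq : q ∈ U) (hv : v ≠ 0) (hp : (gMatrix H q v).PosDef)
    {n : EuclideanSpace ℝ (Fin N) →L[ℝ] ℝ} {w : EuclideanSpace ℝ (Fin N)}
    (hw : ∀ η, fderiv ℝ (fderiv ℝ (Function.uncurry H)) (q, v) (0, w) (0, η) = 2 * n η) :
    ∑ i, ∑ j, (gMatrix H q v)⁻¹ i j * n (EuclideanSpace.single i 1) *
      n (EuclideanSpace.single j 1) = n w := by
  have h1 := (hG.gMatrix_mulVec_eq hq hv hp (w := w)
    (n := fun j => n (EuclideanSpace.single j 1))).1 fun j => hw _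
  rw [apply_eq_sum n w]
  refine Finset.sum_congr rfl fun i _ => ?_
  rw [congrFun h1 i]
  simp only [Matrix.mulVec, dotProduct, Finset.sum_mul]
  exact Finset.sum_congr rfl fun j _ => by ring

end IsLagrangian

end Coordinates

/-! ### Charts -/

section Charts

variable {N : ℕ} {M : Type*} [TopologicalSpace M] [ChartedSpace (EuclideanSpace ℝ (Fin N)) M]

lemma tangentBundle_ext {p p' : M} (h : p = p') {v v' : EuclideanSpace ℝ (Fin N)} (hv : v = v') :
    (⟨p, v⟩ : TangentBundle (𝓡 N) M) = ⟨p', v'⟩ := by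
  subst h hv; rfl

/-- The tangent vector with coordinates `(q, v)` in the chart `e`. -/
noncomputable def chartTangent (e : OpenPartialHomeomorph M (EuclideanSpace ℝ (Fin N)))
    (q v : EuclideanSpace ℝ (Fin N)) : TangentBundle (𝓡 N) M :=
  ⟨e.symm q, mfderiv (𝓡 N) (𝓡 N) e.symm q v⟩

variable [IsManifold (𝓡 N) 3 M]
  {e e' : OpenPartialHomeomorph M (EuclideanSpace ℝ (Fin N))}
  (he : e ∈ atlas (EuclideanSpace ℝ (Fin N)) M)
  (he' : e' ∈ atlas (EuclideanSpace ℝ (Fin N)) M)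

include he in
lemma mdifferentiable_chart : e.MDifferentiable (𝓡 N) (𝓡 N) :=
  haveI : IsManifold (𝓡 N) 1 M := IsManifold.of_le (n := 3) (by norm_num)
  mdifferentiable_of_mem_atlas he

include he in
lemma mdifferentiableAt_chart_symm {q : EuclideanSpace ℝ (Fin N)} (hq : q ∈ e.target) :
    MDifferentiableAt (𝓡 N) (𝓡 N) e.symm q :=
  (mdifferentiable_chart he).mdifferentiableAt_symm hq

include he in
lemma mdifferentiableAt_chart {p : M} (hp : p ∈ e.source) : MDifferentiableAt (𝓡 N) (𝓡 N) e p :=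
  (mdifferentiable_chart he).mdifferentiableAt hp

include he in
lemma mfderiv_chart_symm_injective {q : EuclideanSpace ℝ (Fin N)} (hq : q ∈ e.target) :
    Function.Injective (mfderiv (𝓡 N) (𝓡 N) e.symm q) := by
  have h := (mdifferentiable_chart he).comp_symm_deriv hq
  intro v w hvw
  have h1 := DFunLike.congr_fun h v
  have h2 := DFunLike.congr_fun h w
  simp only [ContinuousLinearMap.comp_apply] at h1 h2
  rw [hvw] at h1
  exact h1.symm.trans h2

include he in
lemma contMDiffOn_chart : ContMDiffOn (𝓡 N) (𝓡 N) 3 e e.source :=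
  contMDiffOn_of_mem_maximalAtlas (IsManifold.subset_maximalAtlas he)

include he in
lemma contMDiffOn_chart_symm : ContMDiffOn (𝓡 N) (𝓡 N) 3 e.symm e.target :=
  contMDiffOn_symm_of_mem_maximalAtlas (IsManifold.subset_maximalAtlas he)

/-- The domain of the change of coordinates from `e` to `e'`. -/
def overlap (e e' : OpenPartialHomeomorph M (EuclideanSpace ℝ (Fin N))) :
    Set (EuclideanSpace ℝ (Fin N)) := e.target ∩ e.symm ⁻¹' e'.source

omit [ChartedSpace (EuclideanSpace ℝ (Fin N)) M] [IsManifold (𝓡 N) 3 M] in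
lemma isOpen_overlap : IsOpen (overlap e e') :=
  e.symm.isOpen_inter_preimage e'.open_source

omit [ChartedSpace (EuclideanSpace ℝ (Fin N)) M] [IsManifold (𝓡 N) 3 M] in
lemma mem_overlap {p : M} (hp : p ∈ e.source) (hp' : p ∈ e'.source) : e p ∈ overlap e e' :=
  ⟨e.map_source hp, by rwa [mem_preimage, e.left_inv hp]⟩

omit [ChartedSpace (EuclideanSpace ℝ (Fin N)) M] [IsManifold (𝓡 N) 3 M] in
lemma map_mem_overlap {q : EuclideanSpace ℝ (Fin N)} (hq : q ∈ overlap e e') :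
    e' (e.symm q) ∈ overlap e' e :=
  mem_overlap hq.2 (e.map_target hq.1)

include he he' in
lemma contDiffOn_transition : ContDiffOn ℝ 3 (e' ∘ e.symm) (overlap e e') :=
  contMDiffOn_iff_contDiffOn.1 ((contMDiffOn_chart he').comp
    ((contMDiffOn_chart_symm he).mono inter_subset_left) (fun _ hq => hq.2))

include he he' in
lemma differentiableAt_transition {q : EuclideanSpace ℝ (Fin N)} (hq : q ∈ overlap e e') :
    DifferentiableAt ℝ (e' ∘ e.symm) q :=
  ((contDiffOn_transition he he').contDiffAt (isOpen_overlap.mem_nhds hq)).differentiableAt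
    (by norm_num)

include he he' in
lemma fderiv_transition_comp {q : EuclideanSpace ℝ (Fin N)} (hq : q ∈ overlap e e')
    (v : EuclideanSpace ℝ (Fin N)) :
    fderiv ℝ (e ∘ e'.symm) (e' (e.symm q)) (fderiv ℝ (e' ∘ e.symm) q v) = v := by
  have h1 := (differentiableAt_transition he' he (map_mem_overlap hq)).hasFDerivAt.comp q
    (differentiableAt_transition he he' hq).hasFDerivAt
  have h2 : (e ∘ e'.symm) ∘ (e' ∘ e.symm) =ᶠ[𝓝 q] id := by
    filter_upwards [isOpen_overlap.mem_nhds hq] with z hz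
    simp [e'.left_inv hz.2, e.right_inv hz.1]
  have h3 := h1.unique ((hasFDerivAt_id q).congr_of_eventuallyEq h2)
  exact DFunLike.congr_fun h3 v

include he he' in
lemma chartTangent_transition {q : EuclideanSpace ℝ (Fin N)} (hq : q ∈ overlap e e')
    (v : EuclideanSpace ℝ (Fin N)) :
    chartTangent e' (e' (e.symm q)) (fderiv ℝ (e' ∘ e.symm) q v) = chartTangent e q v := by
  refine tangentBundle_ext (e'.left_inv hq.2) ?_
  have h2 : e'.symm ∘ (e' ∘ e.symm) =ᶠ[𝓝 q] e.symm := by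
    filter_upwards [isOpen_overlap.mem_nhds hq] with z hz
    simp [e'.left_inv hz.2]
  have h1 : mfderiv (𝓡 N) (𝓡 N) (e'.symm ∘ (e' ∘ e.symm)) q =
      (mfderiv (𝓡 N) (𝓡 N) e'.symm (e' (e.symm q))).comp (mfderiv (𝓡 N) (𝓡 N) (e' ∘ e.symm) q) :=
    mfderiv_comp (I' := 𝓡 N) q
      (mdifferentiableAt_chart_symm he' (map_mem_overlap hq).1)
      (differentiableAt_transition he he' hq).mdifferentiableAt
  rw [mfderiv_eq_fderiv, h2.mfderiv_eq] at h1
  exact (DFunLike.congr_fun h1 v).symm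

include he he' in
lemma mfderiv_chart_transition {p : M} (hp : p ∈ e.source) (hp' : p ∈ e'.source)
    (ξ : TangentSpace (𝓡 N) p) :
    (mfderiv (𝓡 N) (𝓡 N) e' p ξ : EuclideanSpace ℝ (Fin N)) =
      fderiv ℝ (e' ∘ e.symm) (e p) (mfderiv (𝓡 N) (𝓡 N) e p ξ) := by
  have h2 : (e' ∘ e.symm) ∘ e =ᶠ[𝓝 p] e' := by
    filter_upwards [e.open_source.mem_nhds hp] with z hz
    simp [e.left_inv hz]
  have h1 := mfderiv_comp (I := 𝓡 N) (I' := 𝓡 N) (I'' := 𝓡 N) p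
    (differentiableAt_transition he he' (mem_overlap hp hp')).mdifferentiableAt
    (mdifferentiableAt_chart he hp)
  rw [mfderiv_eq_fderiv, h2.mfderiv_eq] at h1
  exact DFunLike.congr_fun h1 ξ

variable {F : TangentBundle (𝓡 N) M → ℝ} (hF : IsFinslerMetric F)

include he hF in
lemma isLagrangian_chartG : IsLagrangian e.target (Function.uncurry (chartG F e)) := by
  refine isLagrangian_of_posDef e.open_target (fun q hq v hv => ?_) (fun q hq v c hc => ?_)
    (fun q hq v hv => hF.posDef e he q hq v hv)
  · exact ((hF.contDiffOn e he).contDiffAt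
      ((e.open_target.prod isOpen_compl_singleton).mem_nhds
        (show (q, v) ∈ e.target ×ˢ {0}ᶜ from ⟨hq, hv⟩))).pow 2
  · have h1 : mfderiv (𝓡 N) (𝓡 N) e.symm q (c • v : EuclideanSpace ℝ (Fin N)) =
        c • mfderiv (𝓡 N) (𝓡 N) e.symm q v := map_smul _ _ _
    have h2 := hF.homogeneous (e.symm q) (mfderiv (𝓡 N) (𝓡 N) e.symm q v) c hc
    simp only [chartG]
    rw [← mul_pow, ← h2, ← h1]

include he he' hF in
lemma isTransition_chartG : IsTransition e.target e'.target (overlap e e')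
    (Function.uncurry (chartG F e)) (Function.uncurry (chartG F e')) (e' ∘ e.symm) where
  left := isLagrangian_chartG he hF
  right := isLagrangian_chartG he' hF
  isOpen := isOpen_overlap
  subset := inter_subset_left
  mapsTo q hq := (map_mem_overlap hq).1
  contDiffOn := (contDiffOn_transition he he').of_le (by norm_num)
  surjective q hq v := by
    have h1 := fderiv_transition_comp he' he (map_mem_overlap hq) v
    rw [e'.left_inv hq.2, e.right_inv hq.1] at h1
    exact ⟨_, h1⟩
  eq q hq v := by
    change F (chartTangent e q v) ^ 2 =
      F (chartTangent e' (e' (e.symm q)) (fderiv ℝ (e' ∘ e.symm) q v)) ^ 2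
    rw [chartTangent_transition he he' hq v]

end Charts

/-! ### Geodesics and the Finsler Hessian -/

section Hessian

variable {N : ℕ} {M : Type*} [TopologicalSpace M] [ChartedSpace (EuclideanSpace ℝ (Fin N)) M]
  [IsManifold (𝓡 N) 3 M]
  {e e' : OpenPartialHomeomorph M (EuclideanSpace ℝ (Fin N))}
  (he : e ∈ atlas (EuclideanSpace ℝ (Fin N)) M)
  (he' : e' ∈ atlas (EuclideanSpace ℝ (Fin N)) M)

include he in
lemma velocity_eq {γ : ℝ → M} {s : ℝ} (hγ : ContinuousAt γ s) (hs : γ s ∈ e.source)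
    (hd : DifferentiableAt ℝ (e ∘ γ) s) :
    velocity γ s = chartTangent e (e (γ s)) (deriv (e ∘ γ) s) := by
  refine tangentBundle_ext (e.left_inv hs).symm ?_
  have h2 : e.symm ∘ (e ∘ γ) =ᶠ[𝓝 s] γ := by
    filter_upwards [hγ.eventually (e.open_source.mem_nhds hs)] with t ht
    simp [e.left_inv ht]
  have h1 : mfderiv 𝓘(ℝ, ℝ) (𝓡 N) (e.symm ∘ (e ∘ γ)) s =
      (mfderiv (𝓡 N) (𝓡 N) e.symm (e (γ s))).comp (mfderiv 𝓘(ℝ, ℝ) (𝓡 N) (e ∘ γ) s) :=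
    mfderiv_comp (I' := 𝓡 N) s
      (mdifferentiableAt_chart_symm he (e.map_source hs)) hd.mdifferentiableAt
  rw [mfderiv_eq_fderiv, h2.mfderiv_eq] at h1
  have h3 := DFunLike.congr_fun h1 (1 : ℝ)
  exact h3

include he in
lemma tangent_injective {q q' : EuclideanSpace ℝ (Fin N)} (hq : q ∈ e.target)
    (hq' : q' ∈ e.target) {v v' : EuclideanSpace ℝ (Fin N)}
    (h : chartTangent e q v = chartTangent e q' v') : q = q' ∧ v = v' := by
  obtain ⟨h1, h2⟩ := Bundle.TotalSpace.mk.inj h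
  have h3 : q = q' := e.symm.injOn hq hq' h1
  subst h3
  exact ⟨rfl, mfderiv_chart_symm_injective he hq (eq_of_heq h2)⟩

include he he' in
lemma deriv_transition {γ : ℝ → M} {s : ℝ} (hγ : ContinuousAt γ s) (hs : γ s ∈ e.source)
    (hs' : γ s ∈ e'.source) (hd : DifferentiableAt ℝ (e ∘ γ) s) :
    HasDerivAt (e' ∘ γ) (fderiv ℝ (e' ∘ e.symm) (e (γ s)) (deriv (e ∘ γ) s)) s := by
  have h1 := (differentiableAt_transition he he' (mem_overlap hs hs')).hasFDerivAt.comp_hasDerivAt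
    s hd.hasDerivAt
  refine h1.congr_of_eventuallyEq ?_
  filter_upwards [hγ.eventually (e.open_source.mem_nhds hs)] with t ht
  simp [e.left_inv ht]

variable {F : TangentBundle (𝓡 N) M → ℝ} (hF : IsFinslerMetric F)

-- The solution is built in a single chart; invariance of the Euler–Lagrange equation gives the
-- geodesic equation in all the others.
include he hF in
lemma exists_isGeodesicOn {q : EuclideanSpace ℝ (Fin N)} (hq : q ∈ e.target)
    {v : EuclideanSpace ℝ (Fin N)} (hv : v ≠ 0) :
    ∃ γ : ℝ → M, ∃ ε > 0, IsGeodesicOn F (-ε) ε γ ∧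
      velocity γ 0 = chartTangent e q v := by
  obtain ⟨c, ε, hε, hc0, hc0', hc⟩ := (isLagrangian_chartG he hF).exists_geodesic hq hv
  have hmem : ∀ t ∈ Ioo (-ε) ε, c t ∈ e.target := fun t ht => (hc t ht).1
  have heq : ∀ t ∈ Ioo (-ε) ε, (e ∘ (e.symm ∘ c)) =ᶠ[𝓝 t] c := fun t ht => by
    filter_upwards [Ioo_mem_nhds ht.1 ht.2] with r hr
    simp [e.right_inv (hmem r hr)]
  have hcont : ∀ t ∈ Ioo (-ε) ε, ContinuousAt (e.symm ∘ c) t := fun t ht =>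
    (e.continuousAt_symm (hmem t ht)).comp (hc t ht).2.1.continuousAt
  have hsrc : ∀ t ∈ Ioo (-ε) ε, (e.symm ∘ c) t ∈ e.source := fun t ht => e.map_target (hmem t ht)
  have hdiff : ∀ t ∈ Ioo (-ε) ε, DifferentiableAt ℝ (e ∘ (e.symm ∘ c)) t := fun t ht =>
    ((heq t ht).differentiableAt_iff).2 ((hc t ht).2.1.differentiableAt (by norm_num))
  have hder : ∀ t ∈ Ioo (-ε) ε, deriv (e ∘ (e.symm ∘ c)) t = deriv c t := fun t ht =>
    (heq t ht).deriv_eq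
  have h0 : (0 : ℝ) ∈ Ioo (-ε) ε := ⟨by linarith, hε⟩
  refine ⟨e.symm ∘ c, ε, hε, fun s hs => ⟨hcont s hs, fun e' he' hs' => ?_⟩, ?_⟩
  swap
  · rw [velocity_eq he (hcont 0 h0) (hsrc 0 h0) (hdiff 0 h0), hder 0 h0, hc0']
    simp only [Function.comp_apply, hc0]
    rw [e.right_inv hq]
  have hT := isTransition_chartG he he' hF
  obtain ⟨k1, k2, k3, k4⟩ := hc s hs
  have hov : c s ∈ overlap e e' := ⟨k1, hs'⟩
  have hev : ∀ᶠ t in 𝓝 s, t ∈ Ioo (-ε) ε ∧ c t ∈ overlap e e' :=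
    Eventually.and (Ioo_mem_nhds hs.1 hs.2)
      (k2.continuousAt.eventually (isOpen_overlap.mem_nhds hov))
  have hd1 : ∀ t, t ∈ Ioo (-ε) ε ∧ c t ∈ overlap e e' →
      HasDerivAt (e' ∘ (e.symm ∘ c)) (fderiv ℝ (e' ∘ e.symm) (c t) (deriv c t)) t := fun t ht =>
    (hT.hasFDerivAt ht.2).comp_hasDerivAt t ((hc t ht.1).2.1.differentiableAt
      (by norm_num)).hasDerivAt
  have hd2 : deriv (e' ∘ (e.symm ∘ c)) =ᶠ[𝓝 s]
      fun t => fderiv ℝ (e' ∘ e.symm) (c t) (deriv c t) :=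
    hev.mono fun t ht => (hd1 t ht).deriv
  have hcd : HasDerivAt c (deriv c s) s := (k2.differentiableAt (by norm_num)).hasDerivAt
  have hcdd : HasDerivAt (deriv c) (deriv (deriv c) s) s := by
    have h1 : ContDiffAt ℝ 1 (deriv c) s :=
      (k2.fderiv_right (m := 1) (by norm_num)).clm_apply contDiffAt_const
    exact (h1.differentiableAt (by norm_num)).hasDerivAt
  have hd3 : HasDerivAt (fun t => fderiv ℝ (e' ∘ e.symm) (c t) (deriv c t))
      (fderiv ℝ (fderiv ℝ (e' ∘ e.symm)) (c s) (deriv c s) (deriv c s) +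
        fderiv ℝ (e' ∘ e.symm) (c s) (deriv (deriv c) s)) s :=
    ((hT.hasFDerivAt_fderiv hov).comp_hasDerivAt s hcd).clm_apply hcdd
  have hv0 : fderiv ℝ (e' ∘ e.symm) (c s) (deriv c s) ≠ 0 := hT.ne_zero hov k3
  refine ⟨(hT.contDiffAt hov).comp s k2, ?_, ?_⟩
  · rw [hd2.eq_of_nhds]; exact hv0
  · have hq' : e' ((e.symm ∘ c) s) ∈ e'.target := e'.map_source hs'
    rw [hd2.eq_of_nhds, hd2.deriv_eq, hd3.deriv]
    rw [hT.right.geodesic_iff hq' hv0 (hF.posDef e' he' _ hq' _ hv0)]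
    exact hT.eulerLagrange hov k3 k4

include he in
lemma eq_of_velocity_eq {γ : ℝ → M} {s : ℝ} {q v : EuclideanSpace ℝ (Fin N)}
    (hq : q ∈ e.target) (hγ : ContinuousAt γ s)
    (hd : γ s ∈ e.source → DifferentiableAt ℝ (e ∘ γ) s)
    (h : velocity γ s = chartTangent e q v) :
    γ s ∈ e.source ∧ e (γ s) = q ∧ deriv (e ∘ γ) s = v := by
  have h1 : γ s = e.symm q := congrArg Bundle.TotalSpace.proj h
  have h2 : γ s ∈ e.source := h1 ▸ e.map_target hq
  rw [velocity_eq he hγ h2 (hd h2)] at h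
  exact ⟨h2, tangent_injective he (e.map_source h2) hq h⟩

include he in
/-- The Finsler Hessian vanishes on zero vectors. -/
lemma finslerHessian_zero (Φ : M → ℝ) {q : EuclideanSpace ℝ (Fin N)} (hq : q ∈ e.target) :
    finslerHessian F Φ (chartTangent e q 0) = 0 := by
  -- Geodesics have nonzero velocity by definition, so none starts with a zero vector and the
  -- default value 0 is taken.
  rw [finslerHessian, dif_neg]
  rintro ⟨γ, ε, hε, hγ, h⟩
  obtain ⟨h1, h2⟩ := hγ 0 ⟨by linarith, hε⟩
  obtain ⟨k1, -, k3⟩ := eq_of_velocity_eq he hq h1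
    (fun hs => (h2 e he hs).1.differentiableAt (by norm_num)) h
  exact (h2 e he k1).2.1 k3

lemma IsLagrangian.eq_of_eulerLagrange {E : Type*} [NormedAddCommGroup E] [NormedSpace ℝ E]
    {U : Set E} {G : E × E → ℝ} (hG : IsLagrangian U G) {q v a a' : E} (hq : q ∈ U) (hv : v ≠ 0)
    (h : EulerLagrange G q v a) (h' : EulerLagrange G q v a') : a = a' := by
  by_contra hne
  have h0 := hG.posDef q hq v hv (a - a') (sub_ne_zero.2 hne)
  have h1 : ((0 : E), a - a') = (v, a) - (v, a') := by simp
  have h2 : fderiv ℝ (fderiv ℝ G) (q, v) (0, a - a') (0, a - a') = 0 := by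
    nth_rewrite 1 [h1]
    rw [map_sub, sub_apply, h (a - a'), h' (a - a'), sub_self]
  exact h0.ne' h2

-- The geodesic in the definition is an arbitrary choice, but only its acceleration at time 0
-- matters, and the Euler–Lagrange equation determines it. No uniqueness of geodesics is needed.
include he hF in
lemma finslerHessian_eq {Φ : M → ℝ} (hΦ : ContDiffOn ℝ 2 (Φ ∘ e.symm) e.target)
    {q v a : EuclideanSpace ℝ (Fin N)} (hq : q ∈ e.target) (hv : v ≠ 0)
    (ha : EulerLagrange (Function.uncurry (chartG F e)) q v a) :
    finslerHessian F Φ (chartTangent e q v) =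
      fderiv ℝ (fderiv ℝ (Φ ∘ e.symm)) q v v + fderiv ℝ (Φ ∘ e.symm) q a := by
  have hex := exists_isGeodesicOn he hF hq hv
  rw [finslerHessian, dif_pos hex]
  obtain ⟨ε, hε, hγ, hvel⟩ := hex.choose_spec
  set γ := hex.choose
  obtain ⟨h1, h2⟩ := hγ 0 ⟨by linarith, hε⟩
  obtain ⟨k1, k2, k3⟩ := eq_of_velocity_eq he hq h1
    (fun hs => (h2 e he hs).1.differentiableAt (by norm_num)) hvel
  obtain ⟨l1, -, l2⟩ := h2 e he k1
  rw [k2, k3] at l2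
  have hG := isLagrangian_chartG he hF
  have l3 := (hG.geodesic_iff hq hv (hF.posDef e he q hq v hv) _).1 l2
  have l4 := hG.eq_of_eulerLagrange hq hv l3 ha
  set c := e ∘ γ with hc
  have hc0 : c 0 = q := k2
  have hcc : ContinuousAt c 0 := l1.continuousAt
  have heq : Φ ∘ γ =ᶠ[𝓝 0] (Φ ∘ e.symm) ∘ c := by
    filter_upwards [h1.eventually (e.open_source.mem_nhds k1)] with t ht
    simp [hc, e.left_inv ht]
  have hφ : ∀ z ∈ e.target, ContDiffAt ℝ 2 (Φ ∘ e.symm) z := fun z hz =>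
    hΦ.contDiffAt (e.open_target.mem_nhds hz)
  have hd : ∀ᶠ t in 𝓝 0, deriv ((Φ ∘ e.symm) ∘ c) t = fderiv ℝ (Φ ∘ e.symm) (c t) (deriv c t) := by
    have hev : ∀ᶠ t in 𝓝 0, ContDiffAt ℝ 2 c t := l1.eventually (by simp)
    filter_upwards [hev, hcc.eventually (e.open_target.mem_nhds (hc0.symm ▸ hq))] with t ht ht'
    exact (((hφ _ ht').differentiableAt (by norm_num)).hasFDerivAt.comp_hasDerivAt t
      (ht.differentiableAt (by norm_num)).hasDerivAt).deriv
  have hcd : HasDerivAt c v 0 := by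
    rw [← k3]; exact (l1.differentiableAt (by norm_num)).hasDerivAt
  have hcdd : HasDerivAt (deriv c) a 0 := by
    have h1 : ContDiffAt ℝ 1 (deriv c) 0 :=
      (l1.fderiv_right (m := 1) (by norm_num)).clm_apply contDiffAt_const
    rw [← l4]
    exact (h1.differentiableAt (by norm_num)).hasDerivAt
  have hφ2 : HasFDerivAt (fderiv ℝ (Φ ∘ e.symm)) (fderiv ℝ (fderiv ℝ (Φ ∘ e.symm)) q) (c 0) := by
    rw [hc0]
    exact (((hφ q hq).fderiv_right (m := 1) (by norm_num)).differentiableAt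
      (by norm_num)).hasFDerivAt
  have hfin := (hφ2.comp_hasDerivAt 0 hcd).clm_apply hcdd
  rw [heq.deriv.deriv_eq, EventuallyEq.deriv_eq hd]
  refine hfin.deriv.trans ?_
  rw [Function.comp_apply, hc0, k3]

include he hF in
/-- The dual norm of the differential, computed by means of the dual vector. -/
lemma dualNormSq_eq {Φ : M → ℝ} {q v w : EuclideanSpace ℝ (Fin N)} (hq : q ∈ e.target)
    (hv : v ≠ 0) (hw : ∀ η, fderiv ℝ (fderiv ℝ (Function.uncurry (chartG F e))) (q, v)
      (0, w) (0, η) = 2 * fderiv ℝ (Φ ∘ e.symm) q η) :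
    dualNormSq F Φ e q v = fderiv ℝ (Φ ∘ e.symm) q w :=
  (isLagrangian_chartG he hF).sum_inv_eq hq hv (hF.posDef e he q hq v hv) hw

include he hF in
lemma exists_dual_vector {Φ : M → ℝ} {q v : EuclideanSpace ℝ (Fin N)} (hq : q ∈ e.target)
    (hv : v ≠ 0) : ∃ w, ∀ η, fderiv ℝ (fderiv ℝ (Function.uncurry (chartG F e))) (q, v)
      (0, w) (0, η) = 2 * fderiv ℝ (Φ ∘ e.symm) q η :=
  (isLagrangian_chartG he hF).exists_fiberHess_eq hq hv ((2 : ℝ) • fderiv ℝ (Φ ∘ e.symm) q)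

-- The dual norm is `dΦ(w)` for the dual vector `w`, that is, half the vertical Hessian evaluated on
-- `(w, w)`.
include he hF in
lemma dualNormSq_pos {Φ : M → ℝ} {q v : EuclideanSpace ℝ (Fin N)} (hq : q ∈ e.target)
    (hv : v ≠ 0) (hn : fderiv ℝ (Φ ∘ e.symm) q ≠ 0) : 0 < dualNormSq F Φ e q v := by
  obtain ⟨w, hw⟩ := exists_dual_vector he hF (Φ := Φ) hq hv
  rw [dualNormSq_eq he hF hq hv hw]
  have hw0 : w ≠ 0 := by
    rintro rfl
    refine hn (ContinuousLinearMap.ext fun η => ?_)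
    have := hw η
    have h0 : ((0 : EuclideanSpace ℝ (Fin N)), (0 : EuclideanSpace ℝ (Fin N))) = 0 := rfl
    rw [h0, map_zero, zero_apply] at this
    simpa using this.symm
  have := (isLagrangian_chartG he hF).posDef q hq v hv w hw0
  rw [hw] at this
  linarith

include he he' in
lemma fderiv_function_transition {Φ : M → ℝ} (hΦ : ContDiffOn ℝ 2 (Φ ∘ e'.symm) e'.target)
    {q : EuclideanSpace ℝ (Fin N)} (hq : q ∈ overlap e e') (v : EuclideanSpace ℝ (Fin N)) :
    fderiv ℝ (Φ ∘ e.symm) q v =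
      fderiv ℝ (Φ ∘ e'.symm) (e' (e.symm q)) (fderiv ℝ (e' ∘ e.symm) q v) := by
  have hq' := (map_mem_overlap hq).1
  have h1 := ((hΦ.contDiffAt (e'.open_target.mem_nhds hq')).differentiableAt
    (by norm_num)).hasFDerivAt.comp q (differentiableAt_transition he he' hq).hasFDerivAt
  have h2 : Φ ∘ e.symm =ᶠ[𝓝 q] (Φ ∘ e'.symm) ∘ (e' ∘ e.symm) := by
    filter_upwards [isOpen_overlap.mem_nhds hq] with z hz
    simp [e'.left_inv hz.2]
  rw [(h1.congr_of_eventuallyEq h2).fderiv]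
  rfl

-- The derivative of the change of coordinates carries the dual vector to the dual vector, and the
-- pairing with `dΦ` is invariant.
include he he' hF in
lemma dualNormSq_transition {Φ : M → ℝ} (hΦ : ContDiffOn ℝ 2 (Φ ∘ e'.symm) e'.target)
    {q v : EuclideanSpace ℝ (Fin N)} (hq : q ∈ overlap e e') (hv : v ≠ 0) :
    dualNormSq F Φ e q v =
      dualNormSq F Φ e' (e' (e.symm q)) (fderiv ℝ (e' ∘ e.symm) q v) := by
  have hT := isTransition_chartG he he' hF
  obtain ⟨w, hw⟩ := exists_dual_vector he hF (Φ := Φ) hq.1 hv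
  rw [dualNormSq_eq he hF hq.1 hv hw, fderiv_function_transition he he' hΦ hq]
  refine (dualNormSq_eq he' hF (map_mem_overlap hq).1 (hT.ne_zero hq hv) fun η => ?_).symm
  obtain ⟨η, rfl⟩ := hT.surjective q hq η
  rw [← fderiv_function_transition he he' hΦ hq, ← hw]
  exact (hT.fiberHess_eq hq hv w η).symm

include he hF in
/-- A multiplier of the constrained Euler–Lagrange equation is determined by the Finsler Hessian. -/
lemma multiplier_eq {Φ : M → ℝ} (hΦ : ContDiffOn ℝ 2 (Φ ∘ e.symm) e.target)
    {q v a : EuclideanSpace ℝ (Fin N)} {m : ℝ} (hq : q ∈ e.target) (hv : v ≠ 0)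
    (hn : fderiv ℝ (Φ ∘ e.symm) q ≠ 0)
    (ha : ∀ η, fderiv ℝ (fderiv ℝ (Function.uncurry (chartG F e))) (q, v) (v, a) (0, η) =
      baseDeriv (Function.uncurry (chartG F e)) (q, v) η + m * fderiv ℝ (Φ ∘ e.symm) q η)
    (h2 : fderiv ℝ (fderiv ℝ (Φ ∘ e.symm)) q v v + fderiv ℝ (Φ ∘ e.symm) q a = 0) :
    finslerHessian F Φ (chartTangent e q v) / dualNormSq F Φ e q v = -(1 / 2) * m := by
  obtain ⟨w, hw⟩ := exists_dual_vector he hF (Φ := Φ) hq hv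
  -- Subtracting this multiple of the dual vector removes the reaction and leaves the geodesic
  -- acceleration. By `h2` the Hessian is then `-(m / 2) dΦ(w)`.
  have hΓ : EulerLagrange (Function.uncurry (chartG F e)) q v (a - (m / 2) • w) := by
    intro η
    have h1 : ((v, a - (m / 2) • w) : _ × _) = (v, a) - (m / 2) • (0, w) := by simp
    rw [h1, map_sub, map_smul, sub_apply, smul_apply, ha, hw, smul_eq_mul]
    ring
  have hpos := dualNormSq_pos he hF hq hv hn
  rw [div_eq_iff hpos.ne', finslerHessian_eq he hF hΦ hq hv hΓ, dualNormSq_eq he hF hq hv hw,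
    map_sub, map_smul, smul_eq_mul]
  linarith

end Hessian

/-! ### Variations supported in a chart -/

section Variations

variable {N : ℕ} {M : Type*} [TopologicalSpace M] [ChartedSpace (EuclideanSpace ℝ (Fin N)) M]
  [IsManifold (𝓡 N) 3 M]
  {e e' : OpenPartialHomeomorph M (EuclideanSpace ℝ (Fin N))}
  (he : e ∈ atlas (EuclideanSpace ℝ (Fin N)) M)
  (he' : e' ∈ atlas (EuclideanSpace ℝ (Fin N)) M)

include he in
lemma mfderiv_chart_apply_symm {p : M} (hp : p ∈ e.source) {ξ : TangentSpace (𝓡 N) p}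
    {w : EuclideanSpace ℝ (Fin N)} (hξ : ξ = mfderiv (𝓡 N) (𝓡 N) e.symm (e p) w) :
    mfderiv (𝓡 N) (𝓡 N) e p ξ = w := by
  refine mfderiv_chart_symm_injective he (e.map_source hp) ?_
  have h := DFunLike.congr_fun ((mdifferentiable_chart he).symm_comp_deriv hp) ξ
  exact h.trans hξ

variable {Φ : M → ℝ} (hΦ : ContMDiff (𝓡 N) 𝓘(ℝ, ℝ) 2 Φ)

include he hΦ in
lemma contDiffOn_function : ContDiffOn ℝ 2 (Φ ∘ e.symm) e.target :=
  contMDiffOn_iff_contDiffOn.1 (hΦ.comp_contMDiffOn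
    ((contMDiffOn_chart_symm he).of_le (by norm_num)))

include he hΦ in
lemma mfderiv_function_apply {p : M} (hp : p ∈ e.source) (ξ : TangentSpace (𝓡 N) p) :
    mfderiv (𝓡 N) 𝓘(ℝ, ℝ) Φ p ξ =
      fderiv ℝ (Φ ∘ e.symm) (e p) (mfderiv (𝓡 N) (𝓡 N) e p ξ) := by
  have h2 : (Φ ∘ e.symm) ∘ e =ᶠ[𝓝 p] Φ := by
    filter_upwards [e.open_source.mem_nhds hp] with z hz
    simp [e.left_inv hz]
  have h0 : DifferentiableAt ℝ (Φ ∘ e.symm) (e p) :=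
    ((contDiffOn_function he hΦ).contDiffAt
      (e.open_target.mem_nhds (e.map_source hp))).differentiableAt (by norm_num)
  have h1 := mfderiv_comp (I := 𝓡 N) (I' := 𝓡 N) (I'' := 𝓘(ℝ, ℝ)) p h0.mdifferentiableAt
    (mdifferentiableAt_chart he hp)
  rw [mfderiv_eq_fderiv, h2.mfderiv_eq] at h1
  exact DFunLike.congr_fun h1 ξ

variable {F : TangentBundle (𝓡 N) M → ℝ} (hF : IsFinslerMetric F) {x : ℝ → M}

-- The energy differential uses a chart that varies with `s`; here the integrand is brought back to
-- the fixed chart `e`. Symmetry of the second derivative of the transition map matches the two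
-- expressions.
include he he' hF in
lemma variationIntegrand_eq {ξ : (s : ℝ) → TangentSpace (𝓡 N) (x s)} {s : ℝ}
    {v η' : EuclideanSpace ℝ (Fin N)} (hx : ContinuousAt x s) (hs : x s ∈ e.source)
    (hs' : x s ∈ e'.source) (hv : HasDerivAt (e ∘ x) v s)
    (hη : HasDerivAt (fieldInChart e x ξ) η' s) :
    variationIntegrand F e' x ξ s =
      fderiv ℝ (Function.uncurry (chartG F e)) (e (x s), v) (fieldInChart e x ξ s, η') := by
  have hT := isTransition_chartG he he' hF
  have hov := mem_overlap hs hs'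
  have h1 := deriv_transition he he' hx hs hs' hv.differentiableAt
  rw [hv.deriv] at h1
  have hev : ∀ᶠ t in 𝓝 s, x t ∈ e.source ∧ x t ∈ e'.source :=
    (hx.eventually (e.open_source.mem_nhds hs)).and (hx.eventually (e'.open_source.mem_nhds hs'))
  have hfield : ∀ t, x t ∈ e.source ∧ x t ∈ e'.source → fieldInChart e' x ξ t =
      fderiv ℝ (e' ∘ e.symm) (e (x t)) (fieldInChart e x ξ t) := fun t ht =>
    mfderiv_chart_transition he he' ht.1 ht.2 (ξ t)
  have h2 : HasDerivAt (fieldInChart e' x ξ)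
      (fderiv ℝ (fderiv ℝ (e' ∘ e.symm)) (e (x s)) v (fieldInChart e x ξ s) +
        fderiv ℝ (e' ∘ e.symm) (e (x s)) η') s := by
    have h3 := (hT.hasFDerivAt_fderiv hov).comp_hasDerivAt s hv
    exact (h3.clm_apply hη).congr_of_eventuallyEq (hev.mono hfield)
  have hq : e' (x s) = (e' ∘ e.symm) (e (x s)) := by simp [e.left_inv hs]
  have h4 := hT.fderiv_eq hov v (fieldInChart e x ξ s) η'
  rw [hT.symm hov (fieldInChart e x ξ s) v, ← hq, ← hfield s ⟨hs, hs'⟩, ← h2.deriv, ← h1.deriv,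
    hT.right.fderiv_eq_sum (e'.map_source hs')] at h4
  exact h4.symm

omit [IsManifold (𝓡 N) 3 M] in
lemma variationIntegrand_eq_zero {ξ : (s : ℝ) → TangentSpace (𝓡 N) (x s)} {s : ℝ}
    (h : ∀ᶠ t in 𝓝 s, ξ t = 0) : variationIntegrand F e' x ξ s = 0 := by
  have h1 : fieldInChart e' x ξ =ᶠ[𝓝 s] fun _ => 0 := h.mono fun t ht => by
    rw [fieldInChart, ht, map_zero]; rfl
  rw [variationIntegrand, h1.eq_of_nhds, h1.deriv_eq]
  simp

open Classical in
/-- The field with components `τ Y` in the chart `e` along the part of `x` over `[a, b]`, extended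
by zero. -/
noncomputable def chartField (e : OpenPartialHomeomorph M (EuclideanSpace ℝ (Fin N)))
    (x : ℝ → M) (a b : ℝ) (τ : ℝ → ℝ) (Y : EuclideanSpace ℝ (Fin N) → EuclideanSpace ℝ (Fin N))
    (s : ℝ) : TangentSpace (𝓡 N) (x s) :=
  if s ∈ Icc a b then
    (mfderiv (𝓡 N) (𝓡 N) e.symm (e (x s)) (τ s • Y (e (x s))) : EuclideanSpace ℝ (Fin N))
  else (0 : EuclideanSpace ℝ (Fin N))

omit [IsManifold (𝓡 N) 3 M] in
lemma chartField_of_notMem {a b : ℝ} {τ : ℝ → ℝ}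
    {Y : EuclideanSpace ℝ (Fin N) → EuclideanSpace ℝ (Fin N)} {s : ℝ} (hs : s ∉ Icc a b) :
    chartField e x a b τ Y s = 0 := if_neg hs

omit [IsManifold (𝓡 N) 3 M] in
lemma chartField_of_eq_zero {a b : ℝ} {τ : ℝ → ℝ}
    {Y : EuclideanSpace ℝ (Fin N) → EuclideanSpace ℝ (Fin N)} {s : ℝ} (hs : τ s = 0) :
    chartField e x a b τ Y s = 0 := by
  by_cases h : s ∈ Icc a b
  · refine (if_pos h).trans ?_
    rw [hs, zero_smul]
    exact (mfderiv (𝓡 N) (𝓡 N) e.symm (e (x s))).map_zero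
  · exact chartField_of_notMem h

include he in
lemma mfderiv_chartField {a b : ℝ} {τ : ℝ → ℝ}
    {Y : EuclideanSpace ℝ (Fin N) → EuclideanSpace ℝ (Fin N)} {s : ℝ} (hs : s ∈ Icc a b)
    (hx : x s ∈ e.source) :
    mfderiv (𝓡 N) (𝓡 N) e (x s) (chartField e x a b τ Y s) = τ s • Y (e (x s)) :=
  mfderiv_chart_apply_symm he hx (if_pos hs)

lemma _root_.MeasureTheory.MemLp.clm_apply_of_continuousOn {V W : Type*} [NormedAddCommGroup V]
    [NormedSpace ℝ V] [NormedAddCommGroup W] [NormedSpace ℝ W] {p : ℝ≥0∞} {a b : ℝ} {g : ℝ → V}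
    {A : ℝ → V →L[ℝ] W} (hg : MemLp g p (volume.restrict (Icc a b)))
    (hA : ContinuousOn A (Icc a b)) :
    MemLp (fun t => A t (g t)) p (volume.restrict (Icc a b)) := by
  obtain ⟨B, hB⟩ := isCompact_Icc.exists_bound_of_continuousOn hA
  refine hg.of_le_mul (c := B) ((ContinuousLinearMap.id ℝ (V →L[ℝ] W)).aestronglyMeasurable_comp₂
    (hA.aestronglyMeasurable measurableSet_Icc) hg.aestronglyMeasurable) ?_
  filter_upwards [ae_restrict_mem measurableSet_Icc] with t ht
  exact (ContinuousLinearMap.le_opNorm _ _).trans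
    (mul_le_mul_of_nonneg_right (hB t ht) (norm_nonneg _))

lemma _root_.MeasureTheory.MemLp.restrict_indicator_Icc {V : Type*} [NormedAddCommGroup V]
    {p : ℝ≥0∞} {c d α β : ℝ} {g : ℝ → V} (hg : MemLp g p (volume.restrict (Icc α β))) :
    MemLp ((Icc α β).indicator g) p (volume.restrict (Icc c d)) := by
  rw [memLp_indicator_iff_restrict measurableSet_Icc]
  exact hg.mono_measure (Measure.restrict_mono subset_rfl Measure.restrict_le_self)

-- In another chart the field is `τ` times a `C^1` function of the curve on the common time
-- interval, and zero elsewhere; the vanishing of `τ` at `a` and `b` lets the pieces be glued.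
include he in
lemma isH1Field_chartField (hx : IsH1Curve (N := N) x) {a b : ℝ} (ha : 0 ≤ a) (hab : a < b)
    (hb : b ≤ 1) (hmaps : MapsTo x (Icc a b) e.source) {τ τ' : ℝ → ℝ}
    {Y : EuclideanSpace ℝ (Fin N) → EuclideanSpace ℝ (Fin N)} (hY : ContDiffOn ℝ 1 Y e.target)
    (hτ' : MemLp τ' 2 (volume.restrict (Icc a b))) (hτ : PrimitiveOn τ τ' a b) (hτa : τ a = 0)
    (hτb : τ b = 0) : IsH1Field x (chartField e x a b τ Y) := by
  intro e' he' c d hc hcd hd hmaps'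
  rw [sobolevOne_iff (by norm_num)]
  obtain ⟨g, hg, hu⟩ := (sobolevOne_iff (by norm_num)).1 (hx.2 e he a b ha hab hb hmaps)
  rcases lt_or_ge (min b d) (max a c) with hlt | hle
  · have hz : ∀ t ∈ Icc c d, t ∉ Icc a b := fun t ht ht' =>
      hlt.not_ge ((max_le ht'.1 ht.1).trans (le_min ht'.2 ht.2))
    refine ⟨fun _ => 0, MemLp.zero', (PrimitiveOn.const 0).congr (fun t ht => ?_)
      (Eventually.of_forall fun _ => rfl)⟩
    rw [fieldInChart, chartField_of_notMem (hz t ht), map_zero]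
    rfl
  set α := max a c
  set β := min b d
  have hα : a ≤ α := le_max_left _ _
  have hα' : c ≤ α := le_max_right _ _
  have hβ : β ≤ b := min_le_left _ _
  have hβ' : β ≤ d := min_le_right _ _
  have hov : ∀ t ∈ Icc α β, (e ∘ x) t ∈ overlap e e' := fun t ht =>
    mem_overlap (hmaps ⟨hα.trans ht.1, ht.2.trans hβ⟩) (hmaps' ⟨hα'.trans ht.1, ht.2.trans hβ'⟩)
  let Ψ : EuclideanSpace ℝ (Fin N) → EuclideanSpace ℝ (Fin N) :=
    fun q => fderiv ℝ (e' ∘ e.symm) q (Y q)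
  have hΨ : ContDiffOn ℝ 1 Ψ (overlap e e') :=
    ((contDiffOn_transition he he').fderiv_of_isOpen isOpen_overlap (by norm_num)).clm_apply
      (hY.mono inter_subset_left)
  have hu' := hu.mono hα hβ
  have hτ1 := hτ.mono hα hβ
  have hP := hτ1.smul (hu'.comp isOpen_overlap hΨ hov)
  have heq : ∀ t ∈ Icc α β, fieldInChart e' x (chartField e x a b τ Y) t =
      τ t • Ψ ((e ∘ x) t) := fun t ht => by
    have ht' : t ∈ Icc a b := ⟨hα.trans ht.1, ht.2.trans hβ⟩
    rw [fieldInChart, mfderiv_chart_transition he he' (hmaps ht')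
      (hmaps' ⟨hα'.trans ht.1, ht.2.trans hβ'⟩), mfderiv_chartField he ht' (hmaps ht'), map_smul]
    rfl
  have hsub : volume.restrict (Icc α β) ≤ volume.restrict (Icc a b) :=
    Measure.restrict_mono (Icc_subset_Icc hα hβ) le_rfl
  have hDΨ : ContinuousOn (fun t => fderiv ℝ Ψ ((e ∘ x) t)) (Icc α β) :=
    (hΨ.continuousOn_fderiv_of_isOpen isOpen_overlap le_rfl).comp hu'.continuousOn hov
  have hΨc : ContinuousOn (fun t => Ψ ((e ∘ x) t)) (Icc α β) :=
    hΨ.continuousOn.comp hu'.continuousOn hov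
  have hL : MemLp (fun t => τ t • fderiv ℝ Ψ ((e ∘ x) t) (g t) + τ' t • Ψ ((e ∘ x) t)) 2
      (volume.restrict (Icc α β)) := by
    refine MemLp.add ?_ ?_
    · exact (hg.mono_measure hsub).clm_apply_of_continuousOn
        (A := fun t => τ t • fderiv ℝ Ψ ((e ∘ x) t)) (hτ1.continuousOn.smul hDΨ)
    · exact (hτ'.mono_measure hsub).clm_apply_of_continuousOn
        (A := fun t => ContinuousLinearMap.toSpanSingleton ℝ (Ψ ((e ∘ x) t)))
        ((ContinuousLinearMap.toSpanSingletonCLE (𝕜 := ℝ)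
          (E := EuclideanSpace ℝ (Fin N))).continuous.comp_continuousOn hΨc)
  have hzero : ∀ t, t ∉ Icc a b → fieldInChart e' x (chartField e x a b τ Y) t = 0 :=
    fun t ht => by rw [fieldInChart, chartField_of_notMem ht, map_zero]; rfl
  have hzero' : ∀ t, τ t = 0 → fieldInChart e' x (chartField e x a b τ Y) t = 0 :=
    fun t ht => by rw [fieldInChart, chartField_of_eq_zero ht, map_zero]; rfl
  refine ⟨_, hL.restrict_indicator_Icc, (hP.congr heq (Eventually.of_forall
    fun _ => rfl)).extend_zero hα' hle hβ' (fun t ht => hzero t fun h => ?_)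
    (fun t ht => hzero t fun h => ?_) (fun h => hzero' _ ?_) (fun h => hzero' _ ?_)⟩
  · exact ht.2.not_ge (max_le h.1 ht.1)
  · exact ht.1.not_ge (le_min h.2 ht.2)
  -- If the common interval starts strictly after `c`, it starts at `a`, where `τ` vanishes.
  · have : α = a := max_eq_left (le_of_not_ge fun h' => h.ne (max_eq_right h').symm)
    rw [this, hτa]
  · have : β = b := min_eq_left (le_of_not_ge fun h' => h.ne (min_eq_right h'))
    rw [this, hτb]

include he hF in
lemma integral_variationIntegrand (hx : ContinuousOn x (Icc 0 1)) {a b : ℝ} (ha : 0 ≤ a)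
    (hab : a < b) (hb : b ≤ 1) (hmaps : MapsTo x (Icc a b) e.source) {τ τ' : ℝ → ℝ}
    {Y : EuclideanSpace ℝ (Fin N) → EuclideanSpace ℝ (Fin N)} (hY : ContDiffOn ℝ 1 Y e.target)
    (hτ : PrimitiveOn τ τ' a b) {g : ℝ → EuclideanSpace ℝ (Fin N)}
    (hu : PrimitiveOn (e ∘ x) g a b) :
    ∫ s in (0 : ℝ)..1, variationIntegrand F (chartAt (EuclideanSpace ℝ (Fin N)) (x s)) x
      (chartField e x a b τ Y) s = ∫ s in a..b,
        (τ s * fderiv ℝ (Function.uncurry (chartG F e)) ((e ∘ x) s, g s)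
          (Y ((e ∘ x) s), fderiv ℝ Y ((e ∘ x) s) (g s)) +
        τ' s * fiberDeriv (Function.uncurry (chartG F e)) ((e ∘ x) s, g s) (Y ((e ∘ x) s))) := by
  rw [intervalIntegral.integral_of_le zero_le_one, intervalIntegral.integral_of_le hab.le]
  have hI : Ioc (0 : ℝ) 1 ∩ Ioc a b = Ioc a b :=
    inter_eq_right.2 (Ioc_subset_Ioc ha hb)
  rw [← hI, ← setIntegral_indicator measurableSet_Ioc]
  refine integral_congr_ae (ae_restrict_of_ae ?_)
  have hne : ∀ c : ℝ, ∀ᵐ s : ℝ, s ≠ c := fun c => by simp [ae_iff, measure_singleton]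
  have hutgt : ∀ t ∈ Icc a b, (e ∘ x) t ∈ e.target := fun t ht => e.map_source (hmaps ht)
  filter_upwards [hne a, hne b, hu.ae_hasDerivAt,
    (hτ.smul (hu.comp e.open_target hY hutgt)).ae_hasDerivAt] with s h1 h2 hu' hη
  by_cases hs : s ∈ Icc a b
  swap
  · rw [indicator_of_notMem (fun h => hs (Ioc_subset_Icc_self h))]
    refine variationIntegrand_eq_zero ?_
    filter_upwards [isClosed_Icc.isOpen_compl.mem_nhds hs] with t ht
    exact chartField_of_notMem ht
  have hs' : s ∈ Ioo a b := ⟨lt_of_le_of_ne hs.1 (Ne.symm h1), lt_of_le_of_ne hs.2 h2⟩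
  rw [indicator_of_mem (Ioo_subset_Ioc_self hs')]
  have hxc : ContinuousAt x s :=
    hx.continuousAt (Icc_mem_nhds (ha.trans_lt hs'.1) (hs'.2.trans_le hb))
  have heq : ∀ t ∈ Icc a b, fieldInChart e x (chartField e x a b τ Y) t = τ t • Y ((e ∘ x) t) :=
    fun t ht => mfderiv_chartField he ht (hmaps ht)
  have hfield : HasDerivAt (fieldInChart e x (chartField e x a b τ Y))
      (τ s • fderiv ℝ Y ((e ∘ x) s) (g s) + τ' s • Y ((e ∘ x) s)) s := by
    refine (hη hs').congr_of_eventuallyEq ?_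
    filter_upwards [Icc_mem_nhds hs'.1 hs'.2] with t ht using heq t ht
  rw [variationIntegrand_eq he (chart_mem_atlas _ _) hF hxc (hmaps hs) (mem_chart_source _ _)
    (hu' hs') hfield, heq s hs]
  simp only [fderiv_apply_eq, map_add, map_smul, smul_eq_mul, Function.comp_apply]
  ring

/-- The part of a critical curve in the domain of a chart solves an obstacle problem. -/
lemma exists_obstacle (hF : IsFinslerMetric F) (hΦ : ContMDiff (𝓡 N) 𝓘(ℝ, ℝ) 2 Φ) {Ω : Set M}
    (hΩ : Ω = {q | Φ q < 0}) (hΩ' : frontier Ω = {q | Φ q = 0})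
    (hdΦ : ∀ q ∈ frontier Ω, mfderiv (𝓡 N) 𝓘(ℝ, ℝ) Φ q ≠ 0) (hx : IsVCritical F Ω Φ x)
    (he : e ∈ atlas (EuclideanSpace ℝ (Fin N)) M) {a b : ℝ} (ha : 0 ≤ a) (hab : a < b)
    (hb : b ≤ 1) (hmaps : MapsTo x (Icc a b) e.source) :
    ∃ O : Obstacle (EuclideanSpace ℝ (Fin N)), O.U = e.target ∧
      O.G = Function.uncurry (chartG F e) ∧ O.φ = Φ ∘ e.symm ∧ O.a = a ∧ O.b = b ∧
      O.u = e ∘ x := by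
  obtain ⟨⟨hH1, hcl, -, -⟩, hcrit⟩ := hx
  obtain ⟨g, hg, hu⟩ := (sobolevOne_iff (by norm_num)).1 (hH1.2 e he a b ha hab hb hmaps)
  have hφ := contDiffOn_function he hΦ
  have hφx : ∀ t ∈ Icc a b, (Φ ∘ e.symm) ((e ∘ x) t) = Φ (x t) := fun t ht => by
    simp [e.left_inv (hmaps ht)]
  have hreg : ∀ q ∈ e.target, (Φ ∘ e.symm) q = 0 → fderiv ℝ (Φ ∘ e.symm) q ≠ 0 := by
    intro q hq h0 h1
    refine hdΦ (e.symm q) (by rw [hΩ']; exact h0) (ContinuousLinearMap.ext fun ξ => ?_)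
    rw [mfderiv_function_apply he hΦ (e.map_target hq), e.right_inv hq, h1]
    rfl
  obtain ⟨Nf, hN, hN1⟩ := exists_transverse e.open_target hφ hreg
  refine ⟨
    { U := e.target
      G := Function.uncurry (chartG F e)
      φ := Φ ∘ e.symm
      N := Nf
      a := a
      b := b
      u := e ∘ x
      g := g
      lagr := isLagrangian_chartG he hF
      lt := hab
      smooth := hφ
      prim := hu
      memLp := hg
      mem := fun t ht => e.map_source (hmaps ht)
      nonpos := fun t ht => ?_
      smoothN := hN
      normal := hN1
      critical := fun τ τ' Y hY hτ' hτ hτa hτb hsign => ?_ }, rfl, rfl, rfl, rfl, rfl, rfl⟩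
  · rw [hφx t ht]
    have hsub : closure Ω ⊆ {q | Φ q ≤ 0} :=
      closure_minimal (by rw [hΩ]; exact fun q (hq : Φ q < 0) => hq.le)
        (isClosed_le hΦ.continuous continuous_const)
    exact hsub (hcl t ⟨ha.trans ht.1, ht.2.trans hb⟩)
  · have hadm : chartField e x a b τ Y ∈ admissibleVariations Ω Φ x := by
      refine ⟨isH1Field_chartField he hH1 ha hab hb hmaps hY hτ' hτ hτa hτb, ?_, ?_, ?_⟩
      -- The tangency conditions at times 0 and 1 hold trivially, since the field vanishes there: if
      -- 0 lies in `[a, b]`, then `a = 0` and `τ a = 0`.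
      · have : chartField e x a b τ Y 0 = 0 := by
          by_cases h : (0 : ℝ) ∈ Icc a b
          · exact chartField_of_eq_zero (le_antisymm h.1 ha ▸ hτa)
          · exact chartField_of_notMem h
        rw [this, map_zero]
      · have : chartField e x a b τ Y 1 = 0 := by
          by_cases h : (1 : ℝ) ∈ Icc a b
          · exact chartField_of_eq_zero (le_antisymm hb h.2 ▸ hτb)
          · exact chartField_of_notMem h
        rw [this, map_zero]
      · intro s _ hsf
        by_cases h : s ∈ Icc a b
        · have h0 : Φ (x s) = 0 := by rw [hΩ'] at hsf; exact hsf
          rw [mfderiv_function_apply he hΦ (hmaps h), mfderiv_chartField he h (hmaps h), map_smul]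
          exact hsign s h (by rw [hφx s h, h0])
        · rw [chartField_of_notMem h, map_zero]
          exact le_refl (0 : ℝ)
    have h1 := hcrit _ hadm
    rw [energyDifferential, integral_variationIntegrand he hF hH1.1 ha hab hb hmaps hY hτ hu] at h1
    linarith

end Variations

/-! ### Regularity of critical curves -/

section Regularity

variable {N : ℕ} {M : Type*} [TopologicalSpace M] [ChartedSpace (EuclideanSpace ℝ (Fin N)) M]

/-- The velocity `v` and the multiplier `m` of a constrained critical curve, over an interval on
which the curve stays in the domain of the chart `e`. -/
structure LocalSolution (F : TangentBundle (𝓡 N) M → ℝ) (Ω : Set M) (Φ : M → ℝ) (x : ℝ → M)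
    (e : OpenPartialHomeomorph M (EuclideanSpace ℝ (Fin N))) (a b : ℝ)
    (v : ℝ → EuclideanSpace ℝ (Fin N)) (m : ℝ → ℝ) (C : ℝ≥0) : Prop where
  lip : LipschitzWith C v
  measurable : Measurable m
  bound : ∀ t, ‖m t‖ ≤ C
  primitiveOn : PrimitiveOn (e ∘ x) v a b
  hasDerivAt : ∀ t ∈ Ioo a b, HasDerivAt (e ∘ x) (v t) t
  momentum : ∀ᵐ t, t ∈ Ioo a b →
    HasDerivAt (fun t => fiberDeriv (Function.uncurry (chartG F e)) (e (x t), v t))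
      (baseDeriv (Function.uncurry (chartG F e)) (e (x t), v t) +
        m t • fderiv ℝ (Φ ∘ e.symm) (e (x t))) t
  nonneg : ∀ᵐ t, t ∈ Ioo a b → 0 ≤ m t
  eq_zero : ∀ᵐ t, t ∈ Ioo a b → x t ∉ frontier Ω → m t = 0
  eq_zero_of_velocity : ∀ᵐ t, t ∈ Ioo a b → v t = 0 → m t = 0
  eq_hessian : ∀ᵐ t, t ∈ Ioo a b → x t ∈ frontier Ω → v t ≠ 0 →
    finslerHessian F Φ (chartTangent e (e (x t)) (v t)) / dualNormSq F Φ e (e (x t)) (v t) =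
      -(1 / 2) * m t

variable [IsManifold (𝓡 N) 3 M] {e : OpenPartialHomeomorph M (EuclideanSpace ℝ (Fin N))}
  {F : TangentBundle (𝓡 N) M → ℝ} {Ω : Set M} {Φ : M → ℝ} {x : ℝ → M}

lemma exists_localSolution (hF : IsFinslerMetric F) (hΦ : ContMDiff (𝓡 N) 𝓘(ℝ, ℝ) 2 Φ)
    (hΩ : Ω = {q | Φ q < 0}) (hΩ' : frontier Ω = {q | Φ q = 0})
    (hdΦ : ∀ q ∈ frontier Ω, mfderiv (𝓡 N) 𝓘(ℝ, ℝ) Φ q ≠ 0) (hx : IsVCritical F Ω Φ x)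
    (he : e ∈ atlas (EuclideanSpace ℝ (Fin N)) M) {a b : ℝ} (ha : 0 ≤ a) (hab : a < b)
    (hb : b ≤ 1) (hmaps : MapsTo x (Icc a b) e.source) :
    ∃ v m C, LocalSolution F Ω Φ x e a b v m C := by
  obtain ⟨O, hU, hG, hφ, rfl, rfl, hu⟩ :=
    exists_obstacle hF hΦ hΩ hΩ' hdΦ hx he ha hab hb hmaps
  obtain ⟨v, μ, C, h⟩ := O.exists_rep_Icc
  have hφ' := contDiffOn_function he hΦ
  have hcontact : ∀ t ∈ Ioo O.a O.b, (x t ∈ frontier Ω ↔ O.φ (O.u t) = 0) := fun t ht => by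
    rw [hΩ', hφ, hu]
    simp [e.left_inv (hmaps (Ioo_subset_Icc_self ht))]
  have hn : ∀ t, O.n t = fderiv ℝ (Φ ∘ e.symm) (e (x t)) := fun t => by
    rw [Obstacle.n, hφ, hu]; rfl
  have hut : ∀ t, O.u t = e (x t) := fun t => by rw [hu]; rfl
  refine ⟨v, deriv μ, C, h.lip, measurable_deriv μ, fun t => norm_deriv_le_of_lipschitz h.lipM,
    hu ▸ h.primitiveOn, fun t ht => hu ▸ h.hasDerivAt_u ht, ?_, h.ae_deriv_nonneg, ?_,
    h.ae_deriv_eq_zero_of_velocity, ?_⟩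
  · filter_upwards [h.ae_hasDerivAt_momentum] with t ht ht'
    have := ht ht'
    simp only [hn, hut, hG] at this
    exact this
  · filter_upwards [h.ae_deriv_eq_zero] with t ht ht' hne
    exact ht ht' fun h0 => hne ((hcontact t ht').2 h0)
  · filter_upwards [h.ae_hasDerivAt_momentum, h.ae_second_order,
      h.lip.ae_differentiableAt_real] with t hmom hsec hv ht hc hv0
    have hφ0 := (hcontact t ht).1 hc
    have hacc := h.acceleration ht hv (hmom ht) hv0
    have h2 := hsec ht hφ0 hv
    have hsrc := hmaps (Ioo_subset_Icc_self ht)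
    simp only [hn, hut, hG] at hacc
    rw [hn, hut, hφ] at h2
    refine multiplier_eq he hF hφ' (e.map_source hsrc) hv0 (fun h0 => ?_) hacc h2
    have h3 := O.normal _ (h.mem_U ht) hφ0
    rw [show fderiv ℝ O.φ (O.u t) = 0 by rw [hφ, hut, h0]] at h3
    exact zero_ne_one h3

open Classical in
/-- The Lagrange multiplier of a critical curve. -/
noncomputable def multiplier (F : TangentBundle (𝓡 N) M → ℝ) (Ω : Set M) (Φ : M → ℝ) (x : ℝ → M)
    (s : ℝ) : ℝ :=
  if x s ∈ frontier Ω then finslerHessian F Φ (velocity x s) /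
    dualNormSq F Φ (chartAt (EuclideanSpace ℝ (Fin N)) (x s))
      (chartAt (EuclideanSpace ℝ (Fin N)) (x s) (x s))
      (deriv (chartAt (EuclideanSpace ℝ (Fin N)) (x s) ∘ x) s)
  else 0

/-- For nonzero velocity the dual norm is chart independent. For zero velocity the numerator is
zero, so the denominator is irrelevant. -/
lemma hessian_quotient_eq (hF : IsFinslerMetric F) (hΦ : ContMDiff (𝓡 N) 𝓘(ℝ, ℝ) 2 Φ)
    {e' : OpenPartialHomeomorph M (EuclideanSpace ℝ (Fin N))}
    (he : e ∈ atlas (EuclideanSpace ℝ (Fin N)) M) (he' : e' ∈ atlas (EuclideanSpace ℝ (Fin N)) M)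
    {s : ℝ} (hx : ContinuousAt x s) (hs : x s ∈ e.source) (hs' : x s ∈ e'.source)
    (hd : DifferentiableAt ℝ (e ∘ x) s) :
    finslerHessian F Φ (velocity x s) / dualNormSq F Φ e' (e' (x s)) (deriv (e' ∘ x) s) =
      finslerHessian F Φ (velocity x s) / dualNormSq F Φ e (e (x s)) (deriv (e ∘ x) s) := by
  rcases eq_or_ne (deriv (e ∘ x) s) 0 with h0 | h0
  · rw [velocity_eq he hx hs hd, h0, finslerHessian_zero he Φ (e.map_source hs), zero_div, zero_div]
  · rw [(deriv_transition he he' hx hs hs' hd).deriv,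
      dualNormSq_transition he he' hF (contDiffOn_function he' hΦ) (mem_overlap hs hs') h0,
      e.left_inv hs]

namespace LocalSolution

variable {a b : ℝ} {v : ℝ → EuclideanSpace ℝ (Fin N)} {m : ℝ → ℝ} {C : ℝ≥0}
  (h : LocalSolution F Ω Φ x e a b v m C)
include h

lemma multiplier_eq (hF : IsFinslerMetric F) (hΦ : ContMDiff (𝓡 N) 𝓘(ℝ, ℝ) 2 Φ)
    (he : e ∈ atlas (EuclideanSpace ℝ (Fin N)) M) (hx : ContinuousOn x (Icc a b))
    (hmaps : MapsTo x (Icc a b) e.source) :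
    ∀ᵐ t, t ∈ Ioo a b → multiplier F Ω Φ x t = -(1 / 2) * m t := by
  filter_upwards [h.eq_zero, h.eq_zero_of_velocity, h.eq_hessian] with t h1 h2 h3 ht
  have hxc : ContinuousAt x t := hx.continuousAt (Icc_mem_nhds ht.1 ht.2)
  have hs := hmaps (Ioo_subset_Icc_self ht)
  have hd := h.hasDerivAt t ht
  by_cases hc : x t ∈ frontier Ω
  swap
  · rw [multiplier, if_neg hc, h1 ht hc, mul_zero]
  rw [multiplier, if_pos hc, hessian_quotient_eq hF hΦ he (chart_mem_atlas _ _) hxc hs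
    (mem_chart_source _ _) hd.differentiableAt, velocity_eq he hxc hs hd.differentiableAt, hd.deriv]
  rcases eq_or_ne (v t) 0 with h0 | h0
  · rw [h2 ht h0, h0, finslerHessian_zero he Φ (e.map_source hs), zero_div, mul_zero]
  · exact h3 ht hc h0

lemma eulerLagrange (hF : IsFinslerMetric F) (hΦ : ContMDiff (𝓡 N) 𝓘(ℝ, ℝ) 2 Φ)
    (he : e ∈ atlas (EuclideanSpace ℝ (Fin N)) M) (hx : ContinuousOn x (Icc a b))
    (hmaps : MapsTo x (Icc a b) e.source) :
    ∀ᵐ s, s ∈ Ioo a b → ∀ i : Fin N,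
      DifferentiableAt ℝ (fun t => dv (chartG F e) i (e (x t)) (deriv (e ∘ x) t)) s ∧
      (1 / 2) * (dq (chartG F e) i (e (x s)) (deriv (e ∘ x) s) -
        deriv (fun t => dv (chartG F e) i (e (x t)) (deriv (e ∘ x) t)) s) =
          multiplier F Ω Φ x s * chartD Φ e i (e (x s)) := by
  filter_upwards [h.multiplier_eq hF hΦ he hx hmaps, h.momentum] with s h1 h2 hs i
  have hG := isLagrangian_chartG he hF
  have htgt : ∀ t ∈ Ioo a b, e (x t) ∈ e.target := fun t ht =>
    e.map_source (hmaps (Ioo_subset_Icc_self ht))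
  have heq : (fun t => dv (chartG F e) i (e (x t)) (deriv (e ∘ x) t)) =ᶠ[𝓝 s] fun t =>
      fiberDeriv (Function.uncurry (chartG F e)) (e (x t), v t) (EuclideanSpace.single i 1) := by
    filter_upwards [Ioo_mem_nhds hs.1 hs.2] with t ht
    rw [(h.hasDerivAt t ht).deriv, hG.dv_eq (htgt t ht)]
  have hd := ((h2 hs).clm_apply (hasDerivAt_const s
    (EuclideanSpace.single i (1 : ℝ)))).congr_of_eventuallyEq heq
  refine ⟨hd.differentiableAt, ?_⟩
  rw [hd.deriv, (h.hasDerivAt s hs).deriv, hG.dq_eq (htgt s hs), h1 hs, map_zero, add_zero,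
    add_apply, smul_apply, smul_eq_mul, chartD]
  ring

omit [IsManifold (𝓡 N) 3 M] in
lemma sobolevTwo : SobolevTwo ∞ a b (e ∘ x) := by
  refine ⟨v, (sobolevOne_iff le_top).2 ⟨deriv v, ?_, h.lip.primitiveOn a b⟩, h.primitiveOn.2⟩
  exact memLp_top_of_bound (aestronglyMeasurable_deriv v _) C
    (Eventually.of_forall fun t => norm_deriv_le_of_lipschitz h.lip)

end LocalSolution

-- Every interior time at which the curve is in the chart lies in an interval with rational ends
-- that stays in the chart, and there are countably many of these.
omit [ChartedSpace (EuclideanSpace ℝ (Fin N)) M] [IsManifold (𝓡 N) 3 M] in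
lemma ae_of_forall_Ioo (hx : ContinuousOn x (Icc 0 1)) {P : ℝ → Prop}
    (hP : ∀ a b : ℝ, 0 ≤ a → a < b → b ≤ 1 → MapsTo x (Icc a b) e.source →
      ∀ᵐ s, s ∈ Ioo a b → P s) :
    ∀ᵐ s ∂(volume.restrict (Icc 0 1)), x s ∈ e.source → P s := by
  have hne : ∀ c : ℝ, ∀ᵐ s : ℝ, s ≠ c := fun c => by simp [ae_iff, measure_singleton]
  have hall : ∀ᵐ s : ℝ, ∀ p q : ℚ, (0 : ℝ) ≤ p → (p : ℝ) < q → (q : ℝ) ≤ 1 →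
      MapsTo x (Icc (p : ℝ) q) e.source → s ∈ Ioo (p : ℝ) q → P s := by
    simp only [ae_all_iff]
    exact fun p q h1 h2 h3 h4 => hP p q h1 h2 h3 h4
  rw [ae_restrict_iff' measurableSet_Icc]
  filter_upwards [hall, hne 0, hne 1] with s hs h0 h1 hs' hse
  have hs0 : 0 < s := lt_of_le_of_ne hs'.1 (Ne.symm h0)
  have hs1 : s < 1 := lt_of_le_of_ne hs'.2 h1
  have hxc : ContinuousAt x s := hx.continuousAt (Icc_mem_nhds hs0 hs1)
  have hnhds : Icc (0 : ℝ) 1 ∩ x ⁻¹' e.source ∈ 𝓝 s :=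
    inter_mem (Icc_mem_nhds hs0 hs1) (hxc (e.open_source.mem_nhds hse))
  obtain ⟨δ, hδ, hball⟩ := Metric.mem_nhds_iff.1 hnhds
  obtain ⟨p, hp1, hp2⟩ := exists_rat_btwn (show s - δ < s by linarith)
  obtain ⟨q, hq1, hq2⟩ := exists_rat_btwn (show s < s + δ by linarith)
  have hmem : ∀ t ∈ Icc (p : ℝ) q, t ∈ Icc (0 : ℝ) 1 ∩ x ⁻¹' e.source := fun t ht => hball (by
    rw [Metric.mem_ball, Real.dist_eq, abs_lt]
    exact ⟨by linarith [ht.1], by linarith [ht.2]⟩)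
  have hpq : (p : ℝ) < q := hp2.trans hq1
  exact hs p q (hmem p ⟨le_rfl, hpq.le⟩).1.1 hpq (hmem q ⟨hpq.le, le_rfl⟩).1.2
    (fun t ht => (hmem t ht).2) ⟨hp2, hq1⟩

-- By compactness `[0, 1]` has a finite subdivision whose pieces are each mapped into the domain of
-- one chart.
omit [IsManifold (𝓡 N) 3 M] in
lemma induction_on_charts (hx : ContinuousOn x (Icc 0 1)) {Q : ℝ → ℝ → Prop}
    (hrefl : ∀ a, Q a a) (htrans : ∀ a b c, a ≤ b → b ≤ c → Q a b → Q b c → Q a c)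
    (hloc : ∀ e ∈ atlas (EuclideanSpace ℝ (Fin N)) M, ∀ a b : ℝ, 0 ≤ a → a < b → b ≤ 1 →
      MapsTo x (Icc a b) e.source → Q a b) : Q 0 1 := by
  let c : M → Set (Icc (0 : ℝ) 1) := fun p =>
    {t | x t ∈ (chartAt (EuclideanSpace ℝ (Fin N)) p).source}
  have hc₁ : ∀ p, IsOpen (c p) := fun p =>
    (chartAt (EuclideanSpace ℝ (Fin N)) p).open_source.preimage hx.domRestrict
  have hc₂ : univ ⊆ ⋃ p, c p := fun t _ => mem_iUnion.2 ⟨x t, mem_chart_source _ _⟩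
  obtain ⟨t, ht0, hmono, ⟨k, hk⟩, hsub⟩ :=
    exists_monotone_Icc_subset_open_cover_Icc (zero_le_one' ℝ) hc₁ hc₂
  have key : ∀ n, Q 0 (t n) := by
    intro n
    induction n with
    | zero => rw [ht0]; exact hrefl 0
    | succ n ih =>
      have hle : (t n : ℝ) ≤ t (n + 1) := hmono n.le_succ
      refine htrans 0 (t n) (t (n + 1)) (t n).2.1 hle ih ?_
      rcases hle.eq_or_lt with h | h
      · rw [← h]; exact hrefl _
      obtain ⟨p, hp⟩ := hsub n
      refine hloc _ (chart_mem_atlas _ p) _ _ (t n).2.1 h (t (n + 1)).2.2 fun s hs => ?_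
      exact hp (show (⟨s, (t n).2.1.trans hs.1, hs.2.trans (t (n + 1)).2.2⟩ : Icc (0 : ℝ) 1) ∈
        Icc (t n) (t (n + 1)) from hs)
  have := key k
  rwa [hk k le_rfl] at this

end Regularity

end Finsler

/-! ### Globalization of the local regularity and of the multiplier -/

theorem mainTheorem2 {N : ℕ} (hN : 2 ≤ N)
    {M : Type*} [TopologicalSpace M] [T2Space M] [SecondCountableTopology M]
    [ChartedSpace (EuclideanSpace ℝ (Fin N)) M] [IsManifold (𝓡 N) 3 M]
    (F : TangentBundle (𝓡 N) M → ℝ) (hF : Finsler.IsFinslerMetric F)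
    (Ω : Set M) (Φ : M → ℝ) (hΦ : ContMDiff (𝓡 N) 𝓘(ℝ, ℝ) 2 Φ)
    (hΩ : Ω = {q | Φ q < 0}) (hΩ' : frontier Ω = {q | Φ q = 0})
    (hdΦ : ∀ q ∈ frontier Ω, mfderiv (𝓡 N) 𝓘(ℝ, ℝ) Φ q ≠ 0)
    (hdisk : Nonempty (closure Ω ≃ₜ Metric.closedBall (0 : EuclideanSpace ℝ (Fin N)) 1))
    (x : ℝ → M) (hx : Finsler.IsVCritical F Ω Φ x) :
    Finsler.IsH2InftyCurve (N := N) x ∧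
    ∃ lam : ℝ → ℝ,
      MemLp lam ∞ (volume.restrict (Icc 0 1)) ∧
      (∀ᵐ s ∂(volume.restrict (Icc 0 1)), lam s ≤ 0) ∧
      (∀ s ∈ Icc (0 : ℝ) 1, x s ∉ frontier Ω → lam s = 0) ∧
      (∀ e ∈ atlas (EuclideanSpace ℝ (Fin N)) M,
        ∀ᵐ s ∂(volume.restrict (Icc 0 1)), x s ∈ e.source → ∀ i : Fin N,
          DifferentiableAt ℝ
            (fun t => Finsler.dv (Finsler.chartG F e) i (e (x t)) (deriv (e ∘ x) t)) s ∧
          (1 / 2) * (Finsler.dq (Finsler.chartG F e) i (e (x s)) (deriv (e ∘ x) s) -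
            deriv (fun t => Finsler.dv (Finsler.chartG F e) i (e (x t)) (deriv (e ∘ x) t)) s) =
              lam s * Finsler.chartD Φ e i (e (x s))) ∧
      (∀ e ∈ atlas (EuclideanSpace ℝ (Fin N)) M,
        ∀ᵐ s ∂(volume.restrict (Icc 0 1)), x s ∈ e.source → x s ∈ frontier Ω →
          lam s = Finsler.finslerHessian F Φ (Finsler.velocity x s) /
            Finsler.dualNormSq F Φ e (e (x s)) (deriv (e ∘ x) s)) := by
  have hxc : ContinuousOn x (Icc 0 1) := hx.1.1.1
  have hsub : ∀ {a b : ℝ}, 0 ≤ a → b ≤ 1 → ContinuousOn x (Icc a b) := fun ha hb =>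
    hxc.mono (Icc_subset_Icc ha hb)
  refine ⟨⟨hxc, fun e he a b ha hab hb hmaps => ?_⟩, Finsler.multiplier F Ω Φ x, ?_⟩
  · obtain ⟨v, m, C, h⟩ :=
      Finsler.exists_localSolution hF hΦ hΩ hΩ' hdΦ hx he ha hab hb hmaps
    exact h.sobolevTwo
  have hne : ∀ c : ℝ, ∀ᵐ s : ℝ, s ≠ c := fun c => by simp [ae_iff, measure_singleton]
  -- The multiplier is already defined on all of `[0, 1]`; only measurability, boundedness and sign
  -- have to be assembled, and these pass to unions of adjacent intervals.
  have hQ := Finsler.induction_on_charts (N := N) hxc (Q := fun a b =>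
    AEStronglyMeasurable (Finsler.multiplier F Ω Φ x) (volume.restrict (Icc a b)) ∧
    (∃ C, ∀ᵐ s ∂(volume.restrict (Icc a b)), ‖Finsler.multiplier F Ω Φ x s‖ ≤ C) ∧
    ∀ᵐ s ∂(volume.restrict (Icc a b)), Finsler.multiplier F Ω Φ x s ≤ 0)
    (fun a => by simp) (fun a b c hab hbc ⟨h1, ⟨C, h2⟩, h3⟩ ⟨k1, ⟨D, k2⟩, k3⟩ => by
      rw [← Icc_union_Icc_eq_Icc hab hbc]
      simp only [ae_restrict_union_iff]
      exact ⟨aestronglyMeasurable_union_iff.2 ⟨h1, k1⟩, ⟨max C D,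
        h2.mono fun s hs => hs.trans (le_max_left _ _),
        k2.mono fun s hs => hs.trans (le_max_right _ _)⟩, h3, k3⟩)
    (fun e he a b ha hab hb hmaps => by
      obtain ⟨v, m, C, h⟩ :=
        Finsler.exists_localSolution hF hΦ hΩ hΩ' hdΦ hx he ha hab hb hmaps
      have hIoo : volume.restrict (Icc a b) = volume.restrict (Ioo a b) :=
        Measure.restrict_congr_set Ioo_ae_eq_Icc.symm
      have heq : Finsler.multiplier F Ω Φ x =ᵐ[volume.restrict (Icc a b)]
          fun t => -(1 / 2) * m t := by
        rw [hIoo]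
        exact (ae_restrict_iff' measurableSet_Ioo).2 (h.multiplier_eq hF hΦ he (hsub ha hb) hmaps)
      refine ⟨((h.measurable.const_mul _).aestronglyMeasurable).congr heq.symm, ⟨C, ?_⟩, ?_⟩
      · filter_upwards [heq] with s hs
        rw [hs, norm_mul, norm_neg]
        norm_num
        have h1 := h.bound s
        rw [Real.norm_eq_abs] at h1
        linarith [abs_nonneg (m s)]
      · rw [hIoo] at heq ⊢
        filter_upwards [heq, (ae_restrict_iff' measurableSet_Ioo).2 h.nonneg] with s hs hs'
        rw [hs]
        linarith)
  obtain ⟨hmeas, ⟨C, hC⟩, hneg⟩ := hQ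
  refine ⟨memLp_top_of_bound hmeas C hC, hneg, fun s _ hs => if_neg hs, fun e he => ?_,
    fun e he => ?_⟩
  · refine Finsler.ae_of_forall_Ioo hxc fun a b ha hab hb hmaps => ?_
    obtain ⟨v, m, C, h⟩ :=
      Finsler.exists_localSolution hF hΦ hΩ hΩ' hdΦ hx he ha hab hb hmaps
    exact h.eulerLagrange hF hΦ he (hsub ha hb) hmaps
  · refine Finsler.ae_of_forall_Ioo hxc fun a b ha hab hb hmaps => ?_
    obtain ⟨v, m, C, h⟩ :=
      Finsler.exists_localSolution hF hΦ hΩ hΩ' hdΦ hx he ha hab hb hmaps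
    refine Filter.Eventually.of_forall fun s hs hsf => ?_
    have hs' := Ioo_subset_Icc_self hs
    rw [Finsler.multiplier, if_pos hsf]
    exact Finsler.hessian_quotient_eq hF hΦ he (chart_mem_atlas _ _)
      ((hsub ha hb).continuousAt (Icc_mem_nhds hs.1 hs.2)) (hmaps hs') (mem_chart_source _ _)
      (h.hasDerivAt s hs).differentiableAt
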